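/- **Setting.** Let $\mathfrak G$ be a finite-dimensional complex Hilbert space, $M$ a diagonalizable operator on $\mathfrak G$, and $\mathcal H=\ell^2(\mathbb Z;\mathfrak G)$. Let $(\Delta u)(n)=2u(n)-u(n+1)-u(n-1)$, $H_0=\Delta\otimes I+I\otimes M$ and $H_\omega=H_0+\omega V$ for $\omega\in\mathbb C$, where $(Vu)(n)=\sum_m V(n,m)u(m)$ with operators $V(n,m)$ on $\mathfrak G$ such that $\|V(n,m)\|\le C' e^{-\rho(|n|+|m|)}$ for all $n,m\in\mathbb Z$, for some $C',\rho>0$. Put $c_\rho=\|e^{-\frac{\rho}{2}|\cdot|}\|_{\ell^2(\mathbb Z)}$, $W_{\pm\rho}(n)=c_\rho^{\pm1}e^{\pm\frac{\rho}{2}|n|}$, let $\boldsymbol W_{-\rho}$ be the operator of multiplication by $W_{-\rho}$ on $\mathcal H$, and let $V_\rho$ be the bounded operator on $\mathcal H$ with kernel $W_\rho(n)V(n,m)W_\rho(m)$. Let $\lambda_q$ be an eigenvalue of $M$ which is a non-degenerate threshold, i.e. $\lambda_q-4$ is not an eigenvalue of $M$. Let $\nu_q=\dim\ker(M-\lambda_q)$,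 let $\pi_q=\frac1{2\pi i}\oint_{|z-\lambda_q|=\varepsilon}(z-M)^{-1}dz$ ($0<\varepsilon\ll1$), let $\Pi_q$ be the projection on $\mathcal H$ with kernel $W_{-\rho}(n)W_{-\rho}(m)\,\pi_q$, and let $E_q=\Pi_qV_\rho\Pi_q$. Let $\alpha_1,\dots,\alpha_r$ be the distinct eigenvalues of $E_q|_{\mathrm{Ran}\,\Pi_q}$, with algebraic multiplicities $m_{q,1},\dots,m_{q,r}$. If $k\mapsto \boldsymbol W_{-\rho}(H_\omega-\lambda_q-k^2)^{-1}\boldsymbol W_{-\rho}$, defined for $|k|<r_0$, $\mathrm{Re}\,k>0$, $\mathrm{Im}\,k>0$, $\lambda_q+k^2\notin\sigma(H_\omega)$, has a meromorphic extension $\mathcal R_\omega$ to $\{|k|<r_0\}$, the resonances of $H_\omega$ near $\lambda_q$ are the points $\lambda_q+k^2$ (labelled by $k$) with $k$ a pole of $\mathcal R_\omega$, $|k|<r_0$; the multiplicity of the resonance labelled by $k_0$ is the rank of $\frac1{2\pi i}\oint\mathcal R_\omega(k)\,dk$ over a small positively oriented circle centred at $k_0$. **Theorem.** There exist $r_0,\varepsilon_0,\delta_0,C>0$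 with $\varepsilon_0\delta_0\le r_0$ such that for all $\omega\in\mathbb C$ with $0<|\omega|<\delta_0$ the meromorphic extension $\mathcal R_\omega$ to $\{|k|<r_0\}$ exists, and the following holds. For each $j$, let the $j$-th cluster be the set of resonances near $\lambda_q$ such that $$\Bigl|k+\tfrac i2\alpha_j\,\omega\Bigr|\le C\,|\omega|^{1+1/m_{q,j}} .$$ (i) Every resonance with $|k|<\varepsilon_0|\omega|$ belongs to the $j$-th cluster for exactly one $j$. Conversely, for every $j$ the $j$-th cluster is contained in $\{|k|<\varepsilon_0|\omega|\}$ and consists of at least one and at most $m_{q,j}$ resonances; the upper bound $m_{q,j}$ also holds when they are counted with multiplicity. (ii) If $M$ and $V$ are selfadjoint, then for every $j$ the multiplicities of the resonances in the $j$-th cluster add up to $m_{q,j}$. In particular there are finitely many resonances with $|k|<\varepsilon_0|\omega|$, and the sum of their multiplicities is $\nu_q$. -/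

import Mathlib

open Filter Topology

noncomputable section

namespace ThresholdResonances

/-- The Hilbert space `ℓ²(ℤ; G) = ℓ²(ℤ) ⊗ G` of square summable sequences with values in `G`. -/
abbrev L2Z (G : Type*) [NormedAddCommGroup G] : Type _ := lp (fun _ : ℤ => G) 2

/-! ### The operators `Δ ⊗ I`, `I ⊗ M` and the multiplication operators -/

theorem memℓp_shift {G : Type*} [NormedAddCommGroup G] (j : ℤ) (u : L2Z G) :
    Memℓp (fun n : ℤ => u (n + j)) 2 := by
  have h := (lp.memℓp u).summable (by norm_num)
  exact memℓp_gen ((Equiv.addRight j).summable_iff.mpr h)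

/-- The translation `u ↦ (n ↦ u (n + j))` on `ℓ²(ℤ; G)`. -/
def shiftOp (G : Type*) [NormedAddCommGroup G] [InnerProductSpace ℂ G] (j : ℤ) :
    L2Z G →L[ℂ] L2Z G :=
  LinearMap.mkContinuous
    { toFun := fun u => ⟨fun n : ℤ => u (n + j), memℓp_shift j u⟩
      map_add' := fun _ _ => rfl
      map_smul' := fun _ _ => rfl } 1 (by
    intro u
    refine lp.norm_le_of_tsum_le (by norm_num) (by positivity) ?_
    rw [one_mul, lp.norm_rpow_eq_tsum (by norm_num) u]
    exact le_of_eq ((Equiv.addRight j).tsum_eq (fun n => ‖u n‖ ^ (2 : ENNReal).toReal)))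

/-- `Δ ⊗ I`, where `(Δ u)(n) = 2 u(n) - u(n+1) - u(n-1)` is the positive discrete Laplacian. -/
def laplacian (G : Type*) [NormedAddCommGroup G] [InnerProductSpace ℂ G] :
    L2Z G →L[ℂ] L2Z G :=
  (2 : ℂ) • 1 - shiftOp G 1 - shiftOp G (-1)

theorem laplacian_apply {G : Type*} [NormedAddCommGroup G] [InnerProductSpace ℂ G]
    (u : L2Z G) (n : ℤ) :
    laplacian G u n = (2 : ℂ) • u n - u (n + 1) - u (n - 1) := rfl

theorem norm_fiber_le {G : Type*} [NormedAddCommGroup G] [InnerProductSpace ℂ G]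
    {T : ℤ → G →L[ℂ] G} {C : ℝ} (hT : ∀ n, ‖T n‖ ≤ C) (u : L2Z G) (n : ℤ) :
    ‖T n (u n)‖ ≤ ‖((C : ℂ) • u) n‖ := by
  have hC : 0 ≤ C := (norm_nonneg _).trans (hT 0)
  have h1 : ‖((C : ℂ) • u) n‖ = C * ‖u n‖ := by
    rw [lp.coeFn_smul, Pi.smul_apply, norm_smul, Complex.norm_real, Real.norm_of_nonneg hC]
  rw [h1]
  exact (T n).le_of_opNorm_le (hT n) (u n)

/-- The operator `u ↦ (n ↦ T n (u n))` on `ℓ²(ℤ; G)`, for a bounded family `T`. -/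
def fiberOp {G : Type*} [NormedAddCommGroup G] [InnerProductSpace ℂ G]
    (T : ℤ → G →L[ℂ] G) (hT : ∃ C : ℝ, ∀ n, ‖T n‖ ≤ C) : L2Z G →L[ℂ] L2Z G :=
  LinearMap.mkContinuousOfExistsBound
    { toFun := fun u => ⟨fun n : ℤ => T n (u n), by
        obtain ⟨C, hC⟩ := hT
        exact (lp.memℓp ((C : ℂ) • u)).mono' (norm_fiber_le hC u)⟩
      map_add' := fun u v => by
        ext n
        exact (T n).map_add (u n) (v n)
      map_smul' := fun c u => by
        ext n
        exact (T n).map_smul c (u n) } (by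
    obtain ⟨C, hC⟩ := hT
    refine ⟨‖(C : ℂ)‖, fun u => ?_⟩
    rw [← norm_smul]
    exact lp.norm_mono (by norm_num) (norm_fiber_le hC u))

theorem fiberOp_apply {G : Type*} [NormedAddCommGroup G] [InnerProductSpace ℂ G]
    (T : ℤ → G →L[ℂ] G) (hT : ∃ C : ℝ, ∀ n, ‖T n‖ ≤ C) (u : L2Z G) (n : ℤ) :
    fiberOp T hT u n = T n (u n) := rfl

/-- The free operator `H₀ = Δ ⊗ I + I ⊗ M`. -/
def freeOp {G : Type*} [NormedAddCommGroup G] [InnerProductSpace ℂ G] (M : G →L[ℂ] G) :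
    L2Z G →L[ℂ] L2Z G :=
  laplacian G + fiberOp (fun _ => M) ⟨‖M‖, fun _ => le_rfl⟩

/-! ### Operators with a summation kernel -/

/-- The operator `∑_{n,m} |δ_n⟩⟨δ_m| ⊗ Y(n,m)`; the series converges in operator norm as soon as
`∑_{n,m} ‖Y(n,m)‖ < ∞`, which is the case for all the kernels used here. -/
def kernelOp {G : Type*} [NormedAddCommGroup G] [InnerProductSpace ℂ G]
    (Y : ℤ → ℤ → G →L[ℂ] G) : L2Z G →L[ℂ] L2Z G :=
  ∑' p : ℤ × ℤ, (lp.singleContinuousLinearMap ℂ (fun _ : ℤ => G) 2 p.1) ∘L (Y p.1 p.2) ∘L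
    (lp.evalCLM ℂ (fun _ : ℤ => G) 2 p.2)

/-- `(Y u)(n) = ∑_m Y(n,m) u(m)`. -/
theorem kernelOp_apply {G : Type*} [NormedAddCommGroup G] [InnerProductSpace ℂ G]
    [CompleteSpace G] (Y : ℤ → ℤ → G →L[ℂ] G)
    (hY : Summable fun p : ℤ × ℤ => ‖Y p.1 p.2‖) (u : L2Z G) (n : ℤ) :
    kernelOp Y u n = ∑' m : ℤ, Y n m (u m) := by
  have hE : ∀ m, ‖lp.evalCLM ℂ (fun _ : ℤ => G) 2 m‖ ≤ 1 := fun m =>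
    ContinuousLinearMap.opNorm_le_bound _ zero_le_one fun v => by
      rw [one_mul]
      exact lp.norm_apply_le_norm (by norm_num) v m
  have hS : ∀ m, ‖lp.singleContinuousLinearMap ℂ (fun _ : ℤ => G) 2 m‖ ≤ 1 := fun m =>
    ContinuousLinearMap.opNorm_le_bound _ zero_le_one fun v => by
      rw [one_mul, lp.singleContinuousLinearMap_apply, lp.norm_single (by norm_num)]
  have hsum : Summable fun p : ℤ × ℤ =>
      (lp.singleContinuousLinearMap ℂ (fun _ : ℤ => G) 2 p.1) ∘L (Y p.1 p.2) ∘L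
        (lp.evalCLM ℂ (fun _ : ℤ => G) 2 p.2) := by
    refine Summable.of_norm_bounded hY fun p => ?_
    calc _ ≤ _ := ContinuousLinearMap.opNorm_comp_le _ _
      _ ≤ 1 * (‖Y p.1 p.2‖ * 1) := by
        refine mul_le_mul (hS _) ?_ (norm_nonneg _) zero_le_one
        exact (ContinuousLinearMap.opNorm_comp_le _ _).trans
          (mul_le_mul_of_nonneg_left (hE _) (norm_nonneg _))
      _ = _ := by ring
  have h1 := (hsum.hasSum.mapL (ContinuousLinearMap.apply ℂ (L2Z G) u)).mapL
    (lp.evalCLM ℂ (fun _ : ℤ => G) 2 n)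
  have h2 : kernelOp Y u n = ∑' p : ℤ × ℤ, if p.1 = n then Y p.1 p.2 (u p.2) else 0 := by
    refine h1.tsum_eq.symm.trans (tsum_congr fun p => ?_)
    change (lp.single 2 p.1 (Y p.1 p.2 (u p.2)) : L2Z G) n = _
    by_cases hp : p.1 = n
    · subst hp
      simp
    · rw [if_neg hp, lp.single_apply_ne _ _ _ (Ne.symm hp)]
  rw [h2, ← tsum_subtype_eq_of_support_subset (s := Set.range fun m : ℤ => (n, m))]
  · rw [tsum_range (fun p : ℤ × ℤ => if p.1 = n then Y p.1 p.2 (u p.2) else 0)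
      (fun a b h => (Prod.mk.inj h).2)]
    simp
  · intro p hp
    by_cases hpn : p.1 = n
    · exact ⟨p.2, by rw [← hpn]⟩
    · simp [hpn] at hp

/-- The perturbed operator `H_ω = H₀ + ω V`, where `V` has the kernel `V(n,m)`. -/
def perturbedOp {G : Type*} [NormedAddCommGroup G] [InnerProductSpace ℂ G]
    (M : G →L[ℂ] G) (V : ℤ → ℤ → G →L[ℂ] G) (ω : ℂ) : L2Z G →L[ℂ] L2Z G :=
  freeOp M + ω • kernelOp V

/-! ### Exponential weights -/

/-- The norm in `ℓ²(ℤ)` of the sequence `n ↦ exp (-s|n|/2)`. -/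
def expNorm (s : ℝ) : ℝ := Real.sqrt (∑' n : ℤ, (Real.exp (-(s / 2) * |(n : ℝ)|)) ^ 2)

/-- The growing weight `W_s(n) = ‖exp (-s|·|/2)‖ exp (s|n|/2)`. -/
def weightPos (s : ℝ) (n : ℤ) : ℝ := expNorm s * Real.exp (s / 2 * |(n : ℝ)|)

/-- The decaying weight `W_{-s}(n) = ‖exp (-s|·|/2)‖⁻¹ exp (-s|n|/2)`. -/
def weightNeg (s : ℝ) (n : ℤ) : ℝ := (expNorm s)⁻¹ * Real.exp (-(s / 2) * |(n : ℝ)|)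

theorem weightNeg_bounded (G : Type*) [NormedAddCommGroup G] [InnerProductSpace ℂ G]
    {s : ℝ} (hs : 0 < s) :
    ∃ C : ℝ, ∀ n : ℤ, ‖((weightNeg s n : ℝ) : ℂ) • (1 : G →L[ℂ] G)‖ ≤ C := by
  refine ⟨(expNorm s)⁻¹, fun n => ?_⟩
  have h0 : 0 ≤ (expNorm s)⁻¹ := inv_nonneg.mpr (Real.sqrt_nonneg _)
  have h1 : Real.exp (-(s / 2) * |(n : ℝ)|) ≤ 1 := by
    rw [Real.exp_le_one_iff]
    have := mul_nonneg (half_pos hs).le (abs_nonneg (n : ℝ))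
    linarith
  have h2 : ‖((weightNeg s n : ℝ) : ℂ)‖ ≤ (expNorm s)⁻¹ := by
    rw [Complex.norm_real, weightNeg, Real.norm_of_nonneg (mul_nonneg h0 (Real.exp_pos _).le)]
    exact mul_le_of_le_one_right h0 h1
  rw [norm_smul]
  calc _ ≤ (expNorm s)⁻¹ * 1 :=
        mul_le_mul h2 ContinuousLinearMap.norm_id_le (norm_nonneg _) h0
    _ = _ := mul_one _

/-- The multiplication operator `W_{-s} ⊗ I` on `ℓ²(ℤ; G)`. -/
def weightOp (G : Type*) [NormedAddCommGroup G] [InnerProductSpace ℂ G] (s : ℝ) (hs : 0 < s) :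
    L2Z G →L[ℂ] L2Z G :=
  fiberOp (fun n => ((weightNeg s n : ℝ) : ℂ) • (1 : G →L[ℂ] G)) (weightNeg_bounded G hs)

/-- `V_s = W_s V W_s`, the bounded operator with kernel `W_s(n) V(n,m) W_s(m)`. -/
def weightedPotential {G : Type*} [NormedAddCommGroup G] [InnerProductSpace ℂ G]
    (V : ℤ → ℤ → G →L[ℂ] G) (s : ℝ) : L2Z G →L[ℂ] L2Z G :=
  kernelOp (fun n m => ((weightPos s n * weightPos s m : ℝ) : ℂ) • V n m)

/-- `M` is diagonalizable: its eigenvectors span the whole space. -/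
def IsDiagonalizable {G : Type*} [NormedAddCommGroup G] [InnerProductSpace ℂ G]
    (M : G →L[ℂ] G) : Prop :=
  ⨆ μ : ℂ, Module.End.eigenspace (M : G →ₗ[ℂ] G) μ = ⊤

/-- For an eigenvalue `lam` of `M`, the left threshold `lam` is degenerate if it is also a right
threshold, i.e. `lam = lam' + 4` for an eigenvalue `lam'` of `M`. -/
def IsDegenerate {G : Type*} [NormedAddCommGroup G] [InnerProductSpace ℂ G]
    (M : G →L[ℂ] G) (lam : ℂ) : Prop :=
  ∃ lam' : ℂ, Module.End.HasEigenvalue (M : G →ₗ[ℂ] G) lam' ∧ lam = lam' + 4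

/-! ### Residues -/

/-- `(2πi)⁻¹ ∮ f(z) dz` over the positively oriented circles of small radius centred at `c`; for
`f` meromorphic at `c` the integral does not depend on the small radius. -/
def residueAt {E : Type*} [NormedAddCommGroup E] [NormedSpace ℂ E] (f : ℂ → E) (c : ℂ) : E :=
  limUnder (𝓝[>] (0 : ℝ)) fun ε : ℝ =>
    (2 * (Real.pi : ℂ) * Complex.I)⁻¹ • ∮ z in C(c, ε), f z

/-- The spectral projection `π = (2πi)⁻¹ ∮_{|z - lam| = ε} (z - M)⁻¹ dz`, `0 < ε ≪ 1`. -/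
def spectralProj {G : Type*} [NormedAddCommGroup G] [InnerProductSpace ℂ G]
    (M : G →L[ℂ] G) (lam : ℂ) : G →L[ℂ] G :=
  residueAt (fun z : ℂ => Ring.inverse (z • (1 : G →L[ℂ] G) - M)) lam

/-! ### The effective operator `E = Π V_ρ Π` on `Ran Π` -/

/-- The operator `a_{-1} ⊗ π`, where `a_{-1}` has the kernel `(i/2) W_{-s}(n) W_{-s}(m)`. -/
def aOp {G : Type*} [NormedAddCommGroup G] [InnerProductSpace ℂ G]
    (s : ℝ) (π : G →L[ℂ] G) : L2Z G →L[ℂ] L2Z G :=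
  kernelOp (fun n m => (Complex.I / 2 * (weightNeg s n : ℂ) * (weightNeg s m : ℂ)) • π)

/-- The projection `Π = (2/i) a_{-1} ⊗ π` attached to the threshold `lam`. -/
def thresholdProj {G : Type*} [NormedAddCommGroup G] [InnerProductSpace ℂ G]
    (M : G →L[ℂ] G) (s : ℝ) (lam : ℂ) : L2Z G →L[ℂ] L2Z G :=
  (2 / Complex.I) • aOp s (spectralProj M lam)

/-- `E = Π V_ρ Π`. -/
def effOp {G : Type*} [NormedAddCommGroup G] [InnerProductSpace ℂ G]
    (M : G →L[ℂ] G) (V : ℤ → ℤ → G →L[ℂ] G) (s : ℝ) (lam : ℂ) : L2Z G →L[ℂ] L2Z G :=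
  thresholdProj M s lam ∘L weightedPotential V s ∘L thresholdProj M s lam

/-- The restriction of `E = Π V_ρ Π` to `Ran Π`. -/
def effOpRan {G : Type*} [NormedAddCommGroup G] [InnerProductSpace ℂ G]
    (M : G →L[ℂ] G) (V : ℤ → ℤ → G →L[ℂ] G) (s : ℝ) (lam : ℂ) :
    Module.End ℂ (LinearMap.range (thresholdProj M s lam : L2Z G →ₗ[ℂ] L2Z G)) :=
  LinearMap.restrict (effOp M V s lam : L2Z G →ₗ[ℂ] L2Z G) fun x _ =>
    ⟨weightedPotential V s (thresholdProj M s lam x), rfl⟩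

/-- The (algebraic) multiplicity of `α` as an eigenvalue of the restriction of `E` to `Ran Π`. -/
def effMult {G : Type*} [NormedAddCommGroup G] [InnerProductSpace ℂ G]
    (M : G →L[ℂ] G) (V : ℤ → ℤ → G →L[ℂ] G) (s : ℝ) (lam α : ℂ) : ℕ :=
  Module.finrank ℂ (Module.End.maxGenEigenspace (effOpRan M V s lam) α)

/-! ### Resonances -/

/-- `R` is a meromorphic extension to the disk `|k| < r` of the weighted resolvent
`k ↦ W_{-s} (H_ω - (lam + k²))⁻¹ W_{-s}`, originally defined for those `k` in the open first
quadrant such that `lam + k²` is in the resolvent set of `H_ω`. -/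
structure IsResolventExtension {G : Type*} [NormedAddCommGroup G] [InnerProductSpace ℂ G]
    (M : G →L[ℂ] G) (V : ℤ → ℤ → G →L[ℂ] G) (s : ℝ) (hs : 0 < s) (lam ω : ℂ) (r : ℝ)
    (R : ℂ → L2Z G →L[ℂ] L2Z G) : Prop where
  meromorphic : MeromorphicOn R (Metric.ball 0 r)
  eq_resolvent : ∀ k ∈ Metric.ball (0 : ℂ) r, 0 < k.re → 0 < k.im →
    lam + k ^ 2 ∈ resolventSet ℂ (perturbedOp M V ω) →
      R k = weightOp G s hs ∘L
        Ring.inverse (perturbedOp M V ω - (lam + k ^ 2) • (1 : L2Z G →L[ℂ] L2Z G)) ∘L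
          weightOp G s hs

/-- The poles `k` of `R` in the disk `|k| < r`; the resonances near the threshold `lam` are the
points `lam + k²` of the Riemann surface parametrized by `k`. -/
def resonances {E : Type*} [NormedAddCommGroup E] [NormedSpace ℂ E]
    (r : ℝ) (R : ℂ → E) : Set ℂ :=
  {k | k ∈ Metric.ball (0 : ℂ) r ∧ meromorphicOrderAt R k < 0}

/-- The multiplicity of the resonance with parameter `k₀`: the rank of the contour integral
`(2πi)⁻¹ ∮ R(k) dk` over a small circle centred at `k₀`. -/
def resMult {E : Type*} [NormedAddCommGroup E] [NormedSpace ℂ E]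
    (R : ℂ → E →L[ℂ] E) (k₀ : ℂ) : ℕ∞ :=
  Cardinal.toENat (LinearMap.rank (residueAt R k₀).toLinearMap)

/-- The cluster of resonances whose parameter satisfies
`|k + (i/2) α ω| ≤ C |ω|^(1 + 1/m)`. -/
def cluster {E : Type*} [NormedAddCommGroup E] [NormedSpace ℂ E]
    (r : ℝ) (R : ℂ → E) (C : ℝ) (ω α : ℂ) (m : ℕ) : Set ℂ :=
  {k | k ∈ resonances r R ∧ ‖k - (-(Complex.I / 2) * α * ω)‖ ≤ C * ‖ω‖ ^ (1 + 1 / (m : ℝ))}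

end ThresholdResonances

end

open ThresholdResonances

/-!
The theorem reduces the poles of the weighted resolvent to the eigenvalues of a matrix close to the
effective operator `E = Π V_ρ Π`, and then applies finite-dimensional perturbation theory.

*The free resolvent.* Along the eigenspaces of `M`, the resolvent of `H₀` at `lam + k²` splits into
resolvents of the discrete Laplacian, whose kernels are multiples of `x^|n-m|` with
`x + x⁻¹ = 2 - ζ`. The weights make these kernels analytic in `x` up to and beyond the unit circle.
Since `lam - 4` is not an eigenvalue of `M`, the only singular contribution comes from
`ker (M - lam)`, where `x = 1` at `k = 0`. Hence
`W (H₀ - lam - k²)⁻¹ W = (i/2k) Π + B(k)` with `B` analytic near `0`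
(`exists_freeOp_resolvent_extension`, `thresholdProj_eq`).

*Reduction to a matrix.* Write `V = W V_ρ W` and `R₀(k) = (i/2k) Π + B(k)`. By the resolvent
identity the weighted resolvent of `H_ω` is the solution of `(1 + ω R₀ V_ρ) R = R₀`
(`one_add_sandwich`). Inverting `1 + ω B V_ρ` first leaves on `Ran Π` the matrix function
`K(k) = k + (iω/2) (E + T(k))` with `T = O(ω)` analytic. A contraction argument yields a matrix `X`
with `X = E + T(cX)`, `c = -iω/2`, the coefficients of `T` multiplying powers of `cX` from the left
(`exists_solvent`). Then `k - cX` divides `K(k)` with an invertible analytic quotient, and dividing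
also the two outer factors by `k - cX` gives `R(k) = Q(k) + (i/2) U (k - cX)⁻¹ Y`, where `Q` is
analytic, `U` injective, `Y` surjective, and `X`, `U`, `Y` do not depend on `k`
(`exists_reduction`). So the resonances are exactly the numbers `c x`, `x` an eigenvalue of `X`, and
the residue `(i/2) U P Y` has the rank of the spectral projection `P` (`pole_structure`). Any other
meromorphic extension agrees with this one by the identity theorem.

*Counting.* Since `X - E = O(ω)`, the Cayley-Hamilton theorem puts each eigenvalue of `X` at
distance `O(|ω|^{1/m})` from an eigenvalue of `E` of multiplicity `m`, and the traces of `h(X)`, with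
`h` a polynomial separating the eigenvalues of `E`, show that exactly `m` eigenvalues, counted with
multiplicity, lie in that cluster (`exists_eigenvalue_clusters`). The total is `dim Ran Π`, which is
`dim ker (M - lam)`.
-/

open ThresholdResonances

namespace ThresholdResonances

/-! ### Residues of meromorphic functions -/

theorem residueAt_congr {E : Type*} [NormedAddCommGroup E] [NormedSpace ℂ E] {f g : ℂ → E} {c : ℂ}
    (h : f =ᶠ[𝓝[≠] c] g) : residueAt f c = residueAt g c := by
  unfold residueAt limUnder
  congr 1
  refine Filter.map_congr ?_
  obtain ⟨r, hr, hrs⟩ := Metric.mem_nhdsWithin_iff.mp h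
  filter_upwards [Ioo_mem_nhdsGT hr] with ε hε
  congr 1
  refine circleIntegral.integral_congr hε.1.le fun z hz => hrs ⟨?_, ?_⟩
  · rw [Metric.mem_ball, Metric.mem_sphere.mp hz]
    exact hε.2
  · rintro rfl
    rw [Metric.mem_sphere, dist_self] at hz
    exact hε.1.ne hz

/-- The residue of a function with finite principal part is the coefficient of `(z - c)⁻¹`. -/
theorem residueAt_eq_coeff {E : Type*} [NormedAddCommGroup E] [NormedSpace ℂ E] [CompleteSpace E]
    {f g : ℂ → E} {c : ℂ} {n : ℕ} {a : ℕ → E} (hg : AnalyticAt ℂ g c) (hn : 0 < n)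
    (hf : ∀ᶠ z in 𝓝[≠] c, f z = g z + ∑ l ∈ Finset.range n, ((z - c)⁻¹) ^ (l + 1) • a l) :
    residueAt f c = a 0 := by
  rw [residueAt_congr hf]
  refine Tendsto.limUnder_eq (tendsto_const_nhds.congr' ?_)
  obtain ⟨r, hr, hrs⟩ := Metric.eventually_nhds_iff_ball.mp hg.eventually_analyticAt
  filter_upwards [Ioo_mem_nhdsGT hr] with ε hε
  have hsub : Metric.closedBall c ε ⊆ Metric.ball c r := Metric.closedBall_subset_ball hε.2
  have hgc : ContinuousOn g (Metric.closedBall c ε) := fun z hz =>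
    (hrs z (hsub hz)).continuousAt.continuousWithinAt
  have hne : ∀ z ∈ Metric.sphere c ε, z - c ≠ 0 := by
    intro z hz h0
    rw [sub_eq_zero.mp h0, Metric.mem_sphere, dist_self] at hz
    exact hε.1.ne hz
  have hint : ∀ l, CircleIntegrable (fun z => ((z - c)⁻¹) ^ (l + 1) • a l) c ε := fun l => by
    refine ContinuousOn.circleIntegrable hε.1.le ?_
    exact (((continuousOn_id.sub continuousOn_const).inv₀ hne).pow _).smul continuousOn_const
  have hpow : ∀ l, (∮ z in C(c, ε), ((z - c)⁻¹) ^ (l + 1) • a l) =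
      if l = 0 then (2 * (Real.pi : ℂ) * Complex.I) • a 0 else 0 := by
    intro l
    rw [circleIntegral.integral_smul_const]
    split_ifs with hl
    · subst hl
      simp only [zero_add, pow_one]
      rw [circleIntegral.integral_sub_center_inv c hε.1.ne']
    · have : ∀ z : ℂ, ((z - c)⁻¹) ^ (l + 1) = (z - c) ^ (-((l : ℤ) + 1)) := fun z => by
        rw [zpow_neg, inv_pow]
        norm_cast
      simp_rw [this]
      rw [circleIntegral.integral_sub_zpow_of_ne (by omega), zero_smul]
  have hg0 : (∮ z in C(c, ε), g z) = 0 :=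
    Complex.circleIntegral_eq_zero_of_differentiable_on_off_countable hε.1.le
      Set.countable_empty hgc fun z hz =>
        (hrs z (hsub (Metric.ball_subset_closedBall hz.1))).differentiableAt
  rw [circleIntegral.integral_add (hgc.mono Metric.sphere_subset_closedBall |>.circleIntegrable
      hε.1.le) (CircleIntegrable.fun_sum _ fun l _ => hint l), hg0, zero_add,
    circleIntegral.integral_fun_sum fun l _ => hint l, Finset.sum_congr rfl fun l _ => hpow l,
    Finset.sum_ite_eq' (Finset.range n) 0, if_pos (Finset.mem_range.mpr hn), smul_smul,
    inv_mul_cancel₀ Complex.two_pi_I_ne_zero, one_smul]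

/-! ### The resolvent of an operator on a finite-dimensional space -/

theorem inverse_eq_of_mul_eq_one {R : Type*} [MonoidWithZero R] {a b : R} (ha : IsUnit a)
    (h : a * b = 1) : Ring.inverse a = b := by
  rw [← mul_one (Ring.inverse a), ← h, ← mul_assoc, Ring.inverse_mul_cancel a ha, one_mul]

theorem isUnit_of_mul_eq_one_of_finiteDimensional {F : Type*} [NormedAddCommGroup F]
    [NormedSpace ℂ F] [FiniteDimensional ℂ F] {A B : F →L[ℂ] F} (h : A * B = 1) : IsUnit A := by
  have h1 : (A : F →ₗ[ℂ] F) * (B : F →ₗ[ℂ] F) = 1 := by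
    ext x
    exact congrArg (fun T : F →L[ℂ] F => T x) h
  have h2 := mul_eq_one_comm.mp h1
  refine ⟨⟨A, B, h, ?_⟩, rfl⟩
  ext x
  exact congrArg (fun T : F →ₗ[ℂ] F => T x) h2

/-- The spectral (Riesz) projection of an operator on a finite-dimensional space: the projection
onto the generalized eigenspace along the complementary invariant subspace. -/
theorem exists_riesz_projection {F : Type*} [NormedAddCommGroup F] [NormedSpace ℂ F]
    [FiniteDimensional ℂ F] (X : F →L[ℂ] F) (c : ℂ) :
    ∃ (n : ℕ) (P : F →L[ℂ] F), 0 < n ∧ P * P = P ∧ Commute X P ∧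
      LinearMap.range (P : F →ₗ[ℂ] F) = Module.End.maxGenEigenspace (X : F →ₗ[ℂ] F) c ∧
      (X - c • 1) ^ n * P = 0 ∧ IsUnit ((X - c • 1) * (1 - P) + P) := by
  set f : Module.End ℂ F := (X : F →ₗ[ℂ] F) - algebraMap ℂ _ c with hf
  obtain ⟨n, hn, hn1, hn2⟩ := ((f.eventually_isCompl_ker_pow_range_pow).and
    ((eventually_ge_atTop 1).and (eventually_ge_atTop (Module.finrank ℂ F)))).exists
  have hfX : ∀ x, f x = (X - c • 1) x := fun x => rfl
  have hpow : ∀ (m : ℕ) x, (f ^ m) x = ((X - c • 1) ^ m) x := by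
    intro m
    induction m with
    | zero => intro x; rfl
    | succ m ih => intro x; rw [pow_succ, pow_succ]; exact ih _
  set P : F →L[ℂ] F := LinearMap.toContinuousLinearMap (Submodule.projection _ _ hn) with hP
  have hPx : ∀ x, P x = Submodule.projection _ _ hn x := fun _ => rfl
  have hPmem : ∀ x, P x ∈ LinearMap.ker (f ^ n) := fun x => Submodule.projection_apply_mem hn x
  have hPid : ∀ x ∈ LinearMap.ker (f ^ n), P x = x := fun x hx =>
    Submodule.projection_apply_of_mem_left hn hx
  have hP0 : ∀ x, P x = 0 ↔ x ∈ LinearMap.range (f ^ n) := fun x =>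
    Submodule.projection_apply_eq_zero_iff hn
  have hPP : P * P = P := by
    ext x
    exact hPid _ (hPmem x)
  have hker : ∀ x ∈ LinearMap.ker (f ^ n), f x ∈ LinearMap.ker (f ^ n) := by
    intro x hx
    rw [LinearMap.mem_ker] at hx ⊢
    rw [← Module.End.mul_apply, ← pow_succ, pow_succ', Module.End.mul_apply, hx, map_zero]
  have hran : ∀ x ∈ LinearMap.range (f ^ n), f x ∈ LinearMap.range (f ^ n) := by
    rintro _ ⟨y, rfl⟩
    exact ⟨f y, by rw [← Module.End.mul_apply, ← pow_succ, pow_succ', Module.End.mul_apply]⟩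
  have hfP : ∀ x, f (P x) = P (f x) := by
    intro x
    have h1 : P (x - P x) = 0 := by
      rw [map_sub, hPid _ (hPmem x), sub_self]
    have h2 := (hP0 _).mpr (hran _ ((hP0 _).mp h1))
    rw [map_sub, map_sub, hPid _ (hker _ (hPmem x)), sub_eq_zero] at h2
    exact h2.symm
  refine ⟨n, P, hn1, hPP, ?_, ?_, ?_, ?_⟩
  · have h1 : Commute (X - c • 1) P := by
      ext x
      exact hfP x
    have h2 : Commute (c • (1 : F →L[ℂ] F)) P := (Commute.one_left P).smul_left c
    have h3 := h1.add_left h2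
    rwa [sub_add_cancel] at h3
  · rw [hP, LinearMap.coe_toContinuousLinearMap, Submodule.range_projection,
      Module.End.maxGenEigenspace_eq_genEigenspace_finrank,
      ← Module.End.genEigenspace_eq_genEigenspace_finrank_of_le _ _ hn2,
      Module.End.genEigenspace_nat]
    rfl
  · ext x
    have := hPmem x
    rw [LinearMap.mem_ker, hpow] at this
    exact this
  · have hinj : Function.Injective ((X - c • 1) * (1 - P) + P : F →L[ℂ] F) := by
      rw [injective_iff_map_eq_zero]
      intro x hx
      have hx1 : f (x - P x) + P x = 0 := hx
      have h0 : P (x - P x) = 0 := by rw [map_sub, hPid _ (hPmem x), sub_self]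
      have h1 : P x = 0 := by
        have h2 := congrArg P hx1
        rw [map_add, map_zero, ← hfP, h0, map_zero, zero_add, hPid _ (hPmem x)] at h2
        exact h2
      rw [h1, add_zero, sub_zero] at hx1
      have h3 : x ∈ LinearMap.ker (f ^ n) := by
        rw [LinearMap.mem_ker]
        obtain ⟨m, rfl⟩ := Nat.exists_eq_succ_of_ne_zero (by omega : n ≠ 0)
        rw [Nat.succ_eq_add_one, pow_succ, Module.End.mul_apply, hx1, map_zero]
      rw [← hPid x h3, h1]
    rw [ContinuousLinearMap.isUnit_iff_bijective]
    exact ⟨hinj, LinearMap.surjective_of_injective (f := (((X - c • 1) * (1 - P) + P :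
      F →L[ℂ] F) : F →ₗ[ℂ] F)) hinj⟩

/-- The Laurent expansion of the resolvent of an operator on a finite-dimensional space. -/
theorem exists_resolvent_expansion {F : Type*} [NormedAddCommGroup F] [NormedSpace ℂ F]
    [FiniteDimensional ℂ F] (X : F →L[ℂ] F) (c : ℂ) :
    ∃ (n : ℕ) (P : F →L[ℂ] F) (g : ℂ → F →L[ℂ] F), 0 < n ∧ P * P = P ∧ Commute X P ∧
      LinearMap.range (P : F →ₗ[ℂ] F) = Module.End.maxGenEigenspace (X : F →ₗ[ℂ] F) c ∧
      (X - c • 1) ^ n * P = 0 ∧ AnalyticAt ℂ g c ∧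
      ∀ᶠ z in 𝓝[≠] c, IsUnit (z • 1 - X) ∧ Ring.inverse (z • 1 - X) =
        g z + ∑ l ∈ Finset.range n, ((z - c)⁻¹) ^ (l + 1) • ((X - c • 1) ^ l * P) := by
  have : CompleteSpace F := FiniteDimensional.complete ℂ F
  obtain ⟨n, P, hn, hPP, hXP, hran, hnil, hu⟩ := exists_riesz_projection X c
  set N : F →L[ℂ] F := X - c • 1 with hN
  set J : F →L[ℂ] F := N * (1 - P) + P with hJ
  have hu' : IsUnit ((c - c) • 1 - J) := by
    rw [sub_self, zero_smul, zero_sub]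
    exact hu.neg
  have han : AnalyticAt ℂ (fun z : ℂ => (z - c) • (1 : F →L[ℂ] F) - J) c :=
    ((analyticAt_id.sub analyticAt_const).smul analyticAt_const).sub analyticAt_const
  refine ⟨n, P, fun z => Ring.inverse ((z - c) • 1 - J) * (1 - P), hn, hPP, hXP, hran, hnil,
    ?_, ?_⟩
  · refine AnalyticAt.mul ?_ analyticAt_const
    refine AnalyticAt.fun_comp (g := Ring.inverse) ?_ han
    obtain ⟨u, hu⟩ := hu'
    rw [← hu]
    exact analyticAt_inverse u
  · have hev : ∀ᶠ z in 𝓝 c, IsUnit ((z - c) • 1 - J) :=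
      han.continuousAt.eventually (Units.isOpen.mem_nhds hu')
    filter_upwards [hev.filter_mono nhdsWithin_le_nhds, self_mem_nhdsWithin] with z hz hzc
    have hz0 : z - c ≠ 0 := sub_ne_zero.mpr hzc
    set t := z - c with ht
    have hzX : z • 1 - X = t • 1 - N := by
      rw [ht, hN, sub_smul]
      abel
    have h1 : (t • 1 - N) * (Ring.inverse (t • 1 - J) * (1 - P)) = 1 - P := by
      have hJP : Commute J P := by
        have hNP : Commute N P := hXP.sub_left ((Commute.one_left P).smul_left c)
        exact (hNP.mul_left ((Commute.one_left P).sub_left rfl)).add_left rfl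
      have hcomm : Commute (t • 1 - J) (1 - P) :=
        (Commute.one_right _).sub_right (((Commute.one_left P).smul_left t).sub_left hJP)
      have hcomm' : Commute (Ring.inverse (t • 1 - J)) (1 - P) := by
        obtain ⟨u, hu⟩ := hz
        rw [← hu] at hcomm ⊢
        rw [Ring.inverse_unit]
        exact hcomm.units_inv_left
      have hq : (t • 1 - N) * (1 - P) = (t • 1 - J) * (1 - P) := by
        rw [hJ]
        simp only [sub_mul, add_mul, mul_sub, mul_one, mul_assoc, hPP]
        abel
      rw [hcomm'.eq, ← mul_assoc, hq, mul_assoc, ← hcomm'.eq, ← mul_assoc,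
        Ring.mul_inverse_cancel _ hz, one_mul]
    have h2 : (t • 1 - N) * ∑ l ∈ Finset.range n, (t⁻¹) ^ (l + 1) • (N ^ l * P) = P := by
      have : ∀ l, (t • 1 - N) * ((t⁻¹) ^ (l + 1) • (N ^ l * P)) =
          (t⁻¹) ^ l • (N ^ l * P) - (t⁻¹) ^ (l + 1) • (N ^ (l + 1) * P) := by
        intro l
        rw [sub_mul, smul_mul_assoc, one_mul, smul_smul, mul_smul_comm, ← mul_assoc, ← pow_succ',
          pow_succ (t⁻¹) l, mul_comm t, mul_assoc, inv_mul_cancel₀ hz0, mul_one]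
      rw [Finset.mul_sum, Finset.sum_congr rfl fun l _ => this l,
        Finset.sum_range_sub' (fun l => (t⁻¹) ^ l • (N ^ l * P)), hnil]
      simp
    have h3 : (z • 1 - X) * (Ring.inverse (t • 1 - J) * (1 - P) +
        ∑ l ∈ Finset.range n, (t⁻¹) ^ (l + 1) • (N ^ l * P)) = 1 := by
      rw [hzX, mul_add, h1, h2, sub_add_cancel]
    have h4 := isUnit_of_mul_eq_one_of_finiteDimensional h3
    exact ⟨h4, inverse_eq_of_mul_eq_one h4 h3⟩

/-! ### Perturbation of the eigenvalues of an operator on a finite-dimensional space -/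

/-- The algebraic multiplicity of `x` as an eigenvalue of `f`; it vanishes when `x` is not an
eigenvalue. -/
noncomputable abbrev algMult {F : Type*} [AddCommGroup F] [Module ℂ F] (f : Module.End ℂ F)
    (x : ℂ) : ℕ :=
  Module.finrank ℂ (Module.End.maxGenEigenspace f x)

/-- The finite set of eigenvalues. -/
noncomputable def eigenvalueFinset {F : Type*} [AddCommGroup F] [Module ℂ F]
    [FiniteDimensional ℂ F] (f : Module.End ℂ F) : Finset ℂ :=
  (LinearMap.charpoly f).roots.toFinset

theorem mem_eigenvalueFinset {F : Type*} [AddCommGroup F] [Module ℂ F] [FiniteDimensional ℂ F]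
    {f : Module.End ℂ F} {x : ℂ} : x ∈ eigenvalueFinset f ↔ f.HasEigenvalue x := by
  rw [eigenvalueFinset, Multiset.mem_toFinset, Polynomial.mem_roots f.charpoly_monic.ne_zero,
    Module.End.hasEigenvalue_iff_isRoot_charpoly]

theorem hasEigenvalue_iff_maxGenEigenspace_ne_bot {F : Type*} [AddCommGroup F] [Module ℂ F]
    {f : Module.End ℂ F} {x : ℂ} :
    f.HasEigenvalue x ↔ Module.End.maxGenEigenspace f x ≠ ⊥ := by
  have := Module.End.hasUnifEigenvalue_iff_hasUnifEigenvalue_one (f := f) (μ := x) (k := ⊤)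
    ENat.top_pos
  exact this.symm

theorem algMult_pos_iff {F : Type*} [AddCommGroup F] [Module ℂ F] [FiniteDimensional ℂ F]
    {f : Module.End ℂ F} {x : ℂ} : 0 < algMult f x ↔ f.HasEigenvalue x := by
  rw [hasEigenvalue_iff_maxGenEigenspace_ne_bot, algMult, Module.finrank_pos_iff,
    Submodule.nontrivial_iff_ne_bot]

/-- If `g - x` is nilpotent, then `g ^ k` has the trace of the scalar `x ^ k`. -/
theorem trace_pow_of_isNilpotent_sub {F : Type*} [AddCommGroup F] [Module ℂ F]
    [FiniteDimensional ℂ F] {g : Module.End ℂ F} {x : ℂ} (h : IsNilpotent (g - algebraMap ℂ _ x))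
    (k : ℕ) : LinearMap.trace ℂ F (g ^ k) = Module.finrank ℂ F * x ^ k := by
  induction k with
  | zero => simp [LinearMap.trace_one]
  | succ k ih =>
    rw [pow_succ, Module.End.mul_eq_comp,
      LinearMap.trace_comp_eq_mul_of_commute_of_isNilpotent x ((Commute.refl g).pow_left k) h, ih]
    ring

theorem trace_pow_eq_sum {F : Type*} [AddCommGroup F] [Module ℂ F] [FiniteDimensional ℂ F]
    (f : Module.End ℂ F) (k : ℕ) :
    LinearMap.trace ℂ F (f ^ k) = ∑ x ∈ eigenvalueFinset f, (algMult f x : ℂ) * x ^ k := by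
  classical
  have hds := DirectSum.isInternal_submodule_of_iSupIndep_of_iSup_eq_top
    f.independent_maxGenEigenspace (Module.End.iSup_maxGenEigenspace_eq_top f)
  have hfin : {x | f.maxGenEigenspace x ≠ ⊥}.Finite :=
    WellFoundedGT.finite_ne_bot_of_iSupIndep f.independent_maxGenEigenspace
  have hmaps : ∀ x, Set.MapsTo (f ^ k) (f.maxGenEigenspace x) (f.maxGenEigenspace x) :=
    fun x => f.mapsTo_maxGenEigenspace_of_comm ((Commute.refl f).pow_right k) x
  have hset : hfin.toFinset = eigenvalueFinset f := by
    ext x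
    rw [Set.Finite.mem_toFinset, mem_eigenvalueFinset, hasEigenvalue_iff_maxGenEigenspace_ne_bot]
    rfl
  rw [LinearMap.trace_eq_sum_trace_restrict' hds hfin hmaps, hset]
  refine Finset.sum_congr rfl fun x _ => ?_
  have hm := f.mapsTo_maxGenEigenspace_of_comm (Commute.refl f) x
  have hr : (f ^ k).restrict (hmaps x) = (f.restrict hm) ^ k :=
    (Module.End.pow_restrict k hm (hmaps x)).symm
  rw [hr]
  exact trace_pow_of_isNilpotent_sub
    (f.isNilpotent_restrict_maxGenEigenspace_sub_algebraMap x) k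

theorem trace_aeval_eq_sum {F : Type*} [AddCommGroup F] [Module ℂ F] [FiniteDimensional ℂ F]
    (f : Module.End ℂ F) (h : Polynomial ℂ) :
    LinearMap.trace ℂ F (Polynomial.aeval f h) =
      ∑ x ∈ eigenvalueFinset f, (algMult f x : ℂ) * h.eval x := by
  induction h using Polynomial.induction_on' with
  | add p q hp hq =>
    rw [map_add, map_add, hp, hq, ← Finset.sum_add_distrib]
    exact Finset.sum_congr rfl fun x _ => by rw [Polynomial.eval_add, mul_add]
  | monomial k a =>
    rw [Polynomial.aeval_monomial, ← Algebra.smul_def, map_smul, trace_pow_eq_sum, smul_eq_mul,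
      Finset.mul_sum]
    exact Finset.sum_congr rfl fun x _ => by rw [Polynomial.eval_monomial]; ring

theorem sum_algMult {F : Type*} [AddCommGroup F] [Module ℂ F] [FiniteDimensional ℂ F]
    (f : Module.End ℂ F) : ∑ x ∈ eigenvalueFinset f, algMult f x = Module.finrank ℂ F := by
  have h := trace_pow_eq_sum f 0
  simp only [pow_zero, LinearMap.trace_one, mul_one] at h
  exact_mod_cast h.symm

theorem exists_lipschitz_aeval {A : Type*} [NormedRing A] [NormedAlgebra ℂ A]
    (h : Polynomial ℂ) (R : ℝ) : ∃ C : ℝ, 0 ≤ C ∧ ∀ X Y : A, ‖X‖ ≤ R → ‖Y‖ ≤ R →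
      ‖Polynomial.aeval X h - Polynomial.aeval Y h‖ ≤ C * ‖X - Y‖ := by
  induction h using Polynomial.induction_on with
  | C a => exact ⟨0, le_rfl, fun X Y _ _ => by simp⟩
  | add p q hp hq =>
    obtain ⟨C₁, h₁, hp⟩ := hp
    obtain ⟨C₂, h₂, hq⟩ := hq
    refine ⟨C₁ + C₂, by positivity, fun X Y hX hY => ?_⟩
    rw [map_add, map_add, add_sub_add_comm, add_mul]
    exact (norm_add_le _ _).trans (add_le_add (hp X Y hX hY) (hq X Y hX hY))
  | monomial n a ih =>
    obtain ⟨C, hC, ih⟩ := ih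
    set K := C * R + ‖Polynomial.aeval (0 : A) (Polynomial.C a * Polynomial.X ^ n)‖ with hK
    have hD : ∀ Y : A, ‖Y‖ ≤ R → ‖Polynomial.aeval Y (Polynomial.C a * Polynomial.X ^ n)‖ ≤ K := by
      intro Y hY
      have h1 := ih Y 0 hY (norm_zero.trans_le ((norm_nonneg _).trans hY))
      have h2 : C * ‖Y - 0‖ ≤ C * R := by
        rw [sub_zero]
        exact mul_le_mul_of_nonneg_left hY hC
      exact (norm_le_norm_sub_add _ _).trans (add_le_add (h1.trans h2) le_rfl)
    refine ⟨C * |R| + |K|, by positivity, fun X Y hX hY => ?_⟩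
    rw [pow_succ, ← mul_assoc, map_mul (Polynomial.aeval X) (_ * _),
      map_mul (Polynomial.aeval Y) (_ * _), Polynomial.aeval_X, Polynomial.aeval_X]
    set p := Polynomial.aeval X (Polynomial.C a * Polynomial.X ^ n)
    set q := Polynomial.aeval Y (Polynomial.C a * Polynomial.X ^ n)
    have e : p * X - q * Y = (p - q) * X + q * (X - Y) := by
      rw [sub_mul, mul_sub]
      abel
    rw [e]
    calc _ ≤ ‖p - q‖ * ‖X‖ + ‖q‖ * ‖X - Y‖ :=
          (norm_add_le _ _).trans (add_le_add (norm_mul_le _ _) (norm_mul_le _ _))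
      _ ≤ C * ‖X - Y‖ * |R| + |K| * ‖X - Y‖ := by
          gcongr
          · exact ih X Y hX hY
          · exact hX.trans (le_abs_self R)
          · exact (hD Y hY).trans (le_abs_self K)
      _ = _ := by ring

/-- Polynomials may be evaluated in the normed algebra of operators or in the algebra of
endomorphisms. -/
theorem coe_aeval_continuousLinearMap {F : Type*} [NormedAddCommGroup F] [NormedSpace ℂ F]
    [FiniteDimensional ℂ F] (X : F →L[ℂ] F) (h : Polynomial ℂ) :
    ((Polynomial.aeval X h : F →L[ℂ] F) : F →ₗ[ℂ] F) =
      Polynomial.aeval (X : F →ₗ[ℂ] F) h :=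
  (Polynomial.aeval_algHom_apply
    (Module.End.toContinuousLinearMap F).symm.toAlgHom X h).symm

theorem charpoly_eval_eq_prod {F : Type*} [AddCommGroup F] [Module ℂ F] [FiniteDimensional ℂ F]
    (f : Module.End ℂ F) (x : ℂ) :
    (LinearMap.charpoly f).eval x = ∏ α ∈ eigenvalueFinset f, (x - α) ^ algMult f α := by
  rw [(IsAlgClosed.splits _).eval_eq_prod_roots_of_monic f.charpoly_monic,
    Finset.prod_multiset_map_count]
  refine Finset.prod_congr rfl fun α _ => ?_
  rw [algMult, LinearMap.finrank_maxGenEigenspace_eq, Polynomial.count_roots]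

/-- By the Cayley-Hamilton theorem, the characteristic polynomial of `E` is of the order of the
perturbation at the eigenvalues of a perturbation of `E`. -/
theorem exists_bound_charpoly_eval {F : Type*} [NormedAddCommGroup F] [NormedSpace ℂ F]
    [FiniteDimensional ℂ F] (E : F →L[ℂ] F) (C₀ : ℝ) :
    ∃ K : ℝ, 0 < K ∧ ∀ t : ℝ, 0 < t → t ≤ 1 → ∀ X : F →L[ℂ] F, ‖X - E‖ ≤ C₀ * t → ∀ x : ℂ,
      Module.End.HasEigenvalue (X : F →ₗ[ℂ] F) x →
        ‖(LinearMap.charpoly (E : F →ₗ[ℂ] F)).eval x‖ ≤ K * t := by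
  set q := LinearMap.charpoly (E : F →ₗ[ℂ] F) with hq
  obtain ⟨C₁, hC₁, hlip⟩ := exists_lipschitz_aeval (A := F →L[ℂ] F) q (‖E‖ + |C₀|)
  refine ⟨C₁ * |C₀| + 1, by positivity, fun t ht0 ht X hX x hx => ?_⟩
  have hXE : ‖X - E‖ ≤ |C₀| * t := hX.trans (mul_le_mul_of_nonneg_right (le_abs_self _) ht0.le)
  have hXn : ‖X‖ ≤ ‖E‖ + |C₀| := by
    calc ‖X‖ ≤ ‖E‖ + ‖X - E‖ := norm_le_insert' _ _
      _ ≤ ‖E‖ + |C₀| := by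
        gcongr
        exact hXE.trans (mul_le_of_le_one_right (abs_nonneg _) ht)
  have h1 := hlip X E hXn (le_add_of_nonneg_right (abs_nonneg _))
  have hE0 : Polynomial.aeval E q = 0 := by
    apply ContinuousLinearMap.coe_injective
    rw [coe_aeval_continuousLinearMap, hq, LinearMap.aeval_self_charpoly]
    rfl
  rw [hE0, sub_zero] at h1
  obtain ⟨v, hv⟩ := hx.exists_hasEigenvector
  have h2 : Polynomial.aeval X q v = q.eval x • v := by
    have := Module.End.aeval_apply_of_hasEigenvector (p := q) hv
    rw [← coe_aeval_continuousLinearMap] at this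
    exact this
  have hv0 : 0 < ‖v‖ := norm_pos_iff.mpr hv.2
  have h3 : ‖q.eval x‖ * ‖v‖ ≤ (C₁ * ‖X - E‖) * ‖v‖ := by
    rw [← norm_smul, ← h2]
    exact (Polynomial.aeval X q).le_of_opNorm_le h1 v
  calc ‖q.eval x‖ ≤ C₁ * ‖X - E‖ := le_of_mul_le_mul_right h3 hv0
    _ ≤ C₁ * (|C₀| * t) := by gcongr
    _ ≤ (C₁ * |C₀| + 1) * t := by linarith

theorem exists_separation (S : Finset ℂ) :
    ∃ d : ℝ, 0 < d ∧ d ≤ 1 ∧ ∀ α ∈ S, ∀ β ∈ S, α ≠ β → 2 * d ≤ ‖α - β‖ := by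
  have h : ∀ᶠ d in 𝓝[>] (0 : ℝ), ∀ α ∈ S, ∀ β ∈ S, α ≠ β → 2 * d ≤ ‖α - β‖ := by
    rw [Finset.eventually_all]
    intro α _
    rw [Finset.eventually_all]
    intro β _
    rw [eventually_imp_distrib_left]
    intro hne
    have h0 : 0 < ‖α - β‖ / 2 := half_pos (norm_pos_iff.mpr (sub_ne_zero.mpr hne))
    filter_upwards [Ioo_mem_nhdsGT h0] with d hd
    linarith [hd.2]
  obtain ⟨d, hd, hd'⟩ := (h.and (Ioo_mem_nhdsGT one_pos)).exists
  exact ⟨d, hd'.1, hd'.2.le, hd⟩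

/-- A point at which a product of powers of linear factors is small lies close to one of the
roots, the distance being controlled by the multiplicity of that root. -/
theorem exists_near_root (S : Finset ℂ) (m : ℂ → ℕ) (hm : ∀ α ∈ S, 0 < m α) (K : ℝ) {d : ℝ}
    (hd : 0 < d) (hd1 : d ≤ 1) (hsep : ∀ α ∈ S, ∀ β ∈ S, α ≠ β → 2 * d ≤ ‖α - β‖) :
    ∃ C : ℝ, 0 < C ∧ ∀ᶠ t in 𝓝[>] (0 : ℝ), ∀ x : ℂ,
      ‖∏ α ∈ S, (x - α) ^ m α‖ ≤ K * t → ∃ α ∈ S, ‖x - α‖ ≤ C * t ^ (1 / (m α : ℝ)) := by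
  set n := ∑ α ∈ S, m α with hn
  set c : ℝ := d ^ n with hc
  have hc0 : 0 < c := pow_pos hd n
  set C := |K| / c + 1 with hC
  have hC1 : 1 ≤ C := by
    rw [hC]
    have : 0 ≤ |K| / c := by positivity
    linarith
  refine ⟨C, by linarith, ?_⟩
  have hsmall : ∀ᶠ t in 𝓝[>] (0 : ℝ), K * t < c := by
    have : Tendsto (fun t : ℝ => K * t) (𝓝[>] 0) (𝓝 (K * 0)) :=
      (tendsto_id.const_mul K).mono_left nhdsWithin_le_nhds
    rw [mul_zero] at this
    exact this.eventually_lt_const hc0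
  filter_upwards [hsmall, self_mem_nhdsWithin] with t ht ht0 x hx
  have ht0 : 0 < t := ht0
  rw [norm_prod] at hx
  simp only [norm_pow] at hx
  obtain ⟨α, hα, hαd⟩ : ∃ α ∈ S, ‖x - α‖ < d := by
    by_contra! hcon
    have : c ≤ ∏ α ∈ S, ‖x - α‖ ^ m α := by
      rw [hc, hn, ← Finset.prod_pow_eq_pow_sum]
      exact Finset.prod_le_prod (fun _ _ => pow_nonneg hd.le _) fun α hα =>
        pow_le_pow_left₀ hd.le (hcon α hα) _
    linarith
  refine ⟨α, hα, ?_⟩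
  have h1 : c ≤ ∏ β ∈ S.erase α, ‖x - β‖ ^ m β := by
    calc c ≤ d ^ ∑ β ∈ S.erase α, m β :=
          pow_le_pow_of_le_one hd.le hd1 (Finset.sum_le_sum_of_subset (Finset.erase_subset _ _))
      _ = ∏ β ∈ S.erase α, d ^ m β := (Finset.prod_pow_eq_pow_sum _ _ _).symm
      _ ≤ _ := by
        refine Finset.prod_le_prod (fun _ _ => pow_nonneg hd.le _) fun β hβ =>
          pow_le_pow_left₀ hd.le ?_ _
        have h2 := hsep α hα β (Finset.mem_of_mem_erase hβ) (Finset.ne_of_mem_erase hβ).symm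
        have h3 : ‖α - β‖ ≤ ‖x - α‖ + ‖x - β‖ := by
          rw [norm_sub_rev x α]
          exact norm_sub_le_norm_sub_add_norm_sub _ _ _
        linarith
  rw [← Finset.mul_prod_erase S _ hα] at hx
  have h2 : ‖x - α‖ ^ m α * c ≤ |K| * t := by
    refine (mul_le_mul_of_nonneg_left h1 (by positivity)).trans (hx.trans ?_)
    exact mul_le_mul_of_nonneg_right (le_abs_self K) ht0.le
  have h3 : ‖x - α‖ ^ m α ≤ C * t := by
    rw [← le_div_iff₀ hc0] at h2
    refine h2.trans ?_
    rw [hC, add_mul, one_mul, div_mul_eq_mul_div]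
    linarith
  have hm0 : (m α : ℝ) ≠ 0 := Nat.cast_ne_zero.mpr (hm α hα).ne'
  have hm1 : (1 : ℝ) ≤ m α := Nat.one_le_cast.mpr (hm α hα)
  calc ‖x - α‖ = (‖x - α‖ ^ m α) ^ (1 / (m α : ℝ)) := by
        rw [one_div, Real.pow_rpow_inv_natCast (norm_nonneg _) (hm α hα).ne']
    _ ≤ (C * t) ^ (1 / (m α : ℝ)) :=
        Real.rpow_le_rpow (by positivity) h3 (by positivity)
    _ = C ^ (1 / (m α : ℝ)) * t ^ (1 / (m α : ℝ)) := Real.mul_rpow (by linarith) ht0.le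
    _ ≤ C * t ^ (1 / (m α : ℝ)) := by
        gcongr
        calc C ^ (1 / (m α : ℝ)) ≤ C ^ (1 : ℝ) :=
              Real.rpow_le_rpow_of_exponent_le hC1 (by rw [div_le_one (by linarith)]; exact hm1)
          _ = C := Real.rpow_one C

/-- Every eigenvalue of a perturbation `X` of `E` lies in exactly one of the discs around the
eigenvalues of `E`, and the disc around `α` contains as many of them as the multiplicity of `α`.
The count compares the traces of `h(X)` and `h(E)`, where the polynomial `h` equals `1` at `α` and
`0` at the other eigenvalues of `E`. -/
theorem exists_eigenvalue_clusters {F : Type*} [NormedAddCommGroup F] [NormedSpace ℂ F]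
    [FiniteDimensional ℂ F] (E : F →L[ℂ] F) (C₀ : ℝ) :
    ∃ C : ℝ, 0 < C ∧ ∀ᶠ t in 𝓝[>] (0 : ℝ),
      (∀ α ∈ eigenvalueFinset (E : F →ₗ[ℂ] F),
        C * t ^ (1 / (algMult (E : F →ₗ[ℂ] F) α : ℝ)) < 1) ∧
      ∀ X : F →L[ℂ] F, ‖X - E‖ ≤ C₀ * t →
        (∀ x ∈ eigenvalueFinset (X : F →ₗ[ℂ] F), ∃! α, α ∈ eigenvalueFinset (E : F →ₗ[ℂ] F) ∧
          ‖x - α‖ ≤ C * t ^ (1 / (algMult (E : F →ₗ[ℂ] F) α : ℝ))) ∧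
        ∀ α ∈ eigenvalueFinset (E : F →ₗ[ℂ] F),
          ∑ x ∈ eigenvalueFinset (X : F →ₗ[ℂ] F) with
            ‖x - α‖ ≤ C * t ^ (1 / (algMult (E : F →ₗ[ℂ] F) α : ℝ)),
            algMult (X : F →ₗ[ℂ] F) x = algMult (E : F →ₗ[ℂ] F) α := by
  classical
  set S := eigenvalueFinset (E : F →ₗ[ℂ] F) with hS
  set m := algMult (E : F →ₗ[ℂ] F) with hm
  have hmpos : ∀ α ∈ S, 0 < m α := fun α hα => algMult_pos_iff.mpr (mem_eigenvalueFinset.mp hα)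
  obtain ⟨K, hK, hchar⟩ := exists_bound_charpoly_eval E C₀
  obtain ⟨d, hd, hd1, hsep⟩ := exists_separation S
  obtain ⟨C, hC, hnear⟩ := exists_near_root S m hmpos K hd hd1 hsep
  -- the polynomials separating the eigenvalues of `E`
  set h : ℂ → Polynomial ℂ := fun α => Lagrange.interpolate S id fun β => if β = α then 1 else 0
    with hh
  have hnode : ∀ α, ∀ β ∈ S, (h α).eval β = if β = α then 1 else 0 := fun α β hβ =>
    Lagrange.eval_interpolate_at_node (v := id) _ (Set.injOn_id _) hβ
  set N : ℝ := ((Module.finrank ℂ F : ℕ) : ℝ) with hN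
  have hN0 : 0 ≤ N := Nat.cast_nonneg _
  have hη : ∀ᶠ η in 𝓝[>] (0 : ℝ), ∀ α ∈ S, ∀ β ∈ S, ∀ x : ℂ, ‖x - β‖ < η →
      ‖(h α).eval x - (h α).eval β‖ < 1 / (4 * (N + 1)) := by
    rw [Finset.eventually_all]
    intro α _
    rw [Finset.eventually_all]
    intro β _
    obtain ⟨η, hη0, hη⟩ := Metric.continuous_iff.mp (h α).continuous β (1 / (4 * (N + 1)))
      (by positivity)
    filter_upwards [Ioo_mem_nhdsGT hη0] with η' hη' x hx
    have := hη x (by rw [dist_eq_norm]; exact hx.trans hη'.2)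
    rwa [dist_eq_norm] at this
  obtain ⟨η, hη, hη0, hηd⟩ := (hη.and (Ioo_mem_nhdsGT hd)).exists
  -- continuity of the traces
  set tr : (F →L[ℂ] F) →L[ℂ] ℂ := LinearMap.toContinuousLinearMap
    ((LinearMap.trace ℂ F) ∘ₗ (ContinuousLinearMap.coeLM ℂ : (F →L[ℂ] F) →ₗ[ℂ] F →ₗ[ℂ] F)) with htr
  have htrace : ∀ (X : F →L[ℂ] F) (p : Polynomial ℂ), tr (Polynomial.aeval X p) =
      ∑ x ∈ eigenvalueFinset (X : F →ₗ[ℂ] F), (algMult (X : F →ₗ[ℂ] F) x : ℂ) * p.eval x := by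
    intro X p
    rw [← trace_aeval_eq_sum, ← coe_aeval_continuousLinearMap]
    rfl
  have htrlip : ∀ᶠ t in 𝓝[>] (0 : ℝ), ∀ α ∈ S, ∀ X : F →L[ℂ] F, ‖X - E‖ ≤ C₀ * t →
      ‖tr (Polynomial.aeval X (h α)) - tr (Polynomial.aeval E (h α))‖ < 1 / 2 := by
    rw [Finset.eventually_all]
    intro α _
    have hcont : Continuous fun X : F →L[ℂ] F => tr (Polynomial.aeval X (h α)) :=
      tr.continuous.comp (h α).continuous_aeval
    obtain ⟨ε, hε, hball⟩ := Metric.continuous_iff.mp hcont E (1 / 2) (by norm_num)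
    have : Tendsto (fun t : ℝ => C₀ * t) (𝓝[>] 0) (𝓝 (C₀ * 0)) :=
      (tendsto_id.const_mul C₀).mono_left nhdsWithin_le_nhds
    rw [mul_zero] at this
    filter_upwards [this.eventually_lt_const hε] with t ht X hX
    have := hball X (by rw [dist_eq_norm]; exact hX.trans_lt ht)
    rwa [dist_eq_norm] at this
  have hsmall : ∀ᶠ t in 𝓝[>] (0 : ℝ), ∀ α ∈ S, C * t ^ (1 / (m α : ℝ)) < η := by
    rw [Finset.eventually_all]
    intro α hα
    have hp : (0 : ℝ) < 1 / (m α : ℝ) := by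
      have := hmpos α hα
      positivity
    have : Tendsto (fun t : ℝ => C * t ^ (1 / (m α : ℝ))) (𝓝[>] 0)
        (𝓝 (C * (0 : ℝ) ^ (1 / (m α : ℝ)))) :=
      (((Real.continuousAt_rpow_const 0 _ (Or.inr hp.le)).tendsto).const_mul C).mono_left
        nhdsWithin_le_nhds
    rw [Real.zero_rpow hp.ne', mul_zero] at this
    exact this.eventually_lt_const hη0
  refine ⟨C, hC, ?_⟩
  filter_upwards [hnear, htrlip, hsmall, Ioo_mem_nhdsGT one_pos] with t hnear htrlip hsmall ht
  refine ⟨fun α hα => (hsmall α hα).trans_le (hηd.le.trans hd1), fun X hX => ?_⟩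
  set mX := algMult (X : F →ₗ[ℂ] F) with hmX
  set SX := eigenvalueFinset (X : F →ₗ[ℂ] F) with hSX
  have hex : ∀ x ∈ SX, ∃ α ∈ S, ‖x - α‖ ≤ C * t ^ (1 / (m α : ℝ)) := by
    intro x hx
    refine hnear x ?_
    have := hchar t ht.1 ht.2.le X hX x (mem_eigenvalueFinset.mp hx)
    rwa [charpoly_eval_eq_prod] at this
  have huniq : ∀ x, ∀ α ∈ S, ∀ β ∈ S, ‖x - α‖ ≤ C * t ^ (1 / (m α : ℝ)) →
      ‖x - β‖ ≤ C * t ^ (1 / (m β : ℝ)) → α = β := by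
    intro x α hα β hβ h1 h2
    by_contra hne
    have h3 := hsep α hα β hβ hne
    have h4 : ‖α - β‖ ≤ ‖x - α‖ + ‖x - β‖ := by
      rw [norm_sub_rev x α]
      exact norm_sub_le_norm_sub_add_norm_sub _ _ _
    linarith [hsmall α hα, hsmall β hβ]
  refine ⟨fun x hx => ?_, fun α hα => ?_⟩
  · obtain ⟨α, hα, hxα⟩ := hex x hx
    exact ⟨α, ⟨hα, hxα⟩, fun β hβ => (huniq x α hα β hβ.1 hxα hβ.2).symm⟩
  · set r := C * t ^ (1 / (m α : ℝ)) with hr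
    have h1 : tr (Polynomial.aeval E (h α)) = m α := by
      rw [htrace, Finset.sum_congr rfl fun β hβ => by rw [hnode α β hβ]]
      rw [Finset.sum_eq_single_of_mem α hα fun β _ hβ => by rw [if_neg hβ, mul_zero], if_pos rfl,
        mul_one]
    -- on the eigenvalues of `X` the polynomial is almost the indicator of the disc around `α`
    have h2 : ∀ x ∈ SX, ‖(h α).eval x - if ‖x - α‖ ≤ r then 1 else 0‖ ≤ 1 / (4 * (N + 1)) := by
      intro x hx
      obtain ⟨β, hβ, hxβ⟩ := hex x hx
      have h3 := (hη α hα β hβ x (hxβ.trans_lt (hsmall β hβ))).le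
      rw [hnode α β hβ] at h3
      have h4 : (β = α) ↔ ‖x - α‖ ≤ r := by
        refine ⟨?_, fun h => huniq x β hβ α hα hxβ h⟩
        rintro rfl
        exact hxβ
      simp only [h4] at h3
      exact h3
    have h3 : ‖tr (Polynomial.aeval X (h α)) -
        (∑ x ∈ SX with ‖x - α‖ ≤ r, mX x : ℕ)‖ ≤ 1 / 4 := by
      rw [htrace, Nat.cast_sum, Finset.sum_filter, ← Finset.sum_sub_distrib]
      calc _ ≤ ∑ x ∈ SX, (mX x : ℝ) * (1 / (4 * (N + 1))) := by
            refine norm_sum_le_of_le _ fun x hx => ?_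
            have e : (algMult (X : F →ₗ[ℂ] F) x : ℂ) * (h α).eval x -
                (if ‖x - α‖ ≤ r then (mX x : ℂ) else 0) =
                (mX x : ℂ) * ((h α).eval x - if ‖x - α‖ ≤ r then 1 else 0) := by
              split_ifs <;> ring
            rw [e, norm_mul, Complex.norm_natCast]
            exact mul_le_mul_of_nonneg_left (h2 x hx) (Nat.cast_nonneg _)
        _ = N * (1 / (4 * (N + 1))) := by
            rw [← Finset.sum_mul, ← Nat.cast_sum, sum_algMult]
        _ ≤ 1 / 4 := by
            rw [mul_one_div, div_le_div_iff₀ (by positivity) (by norm_num)]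
            linarith
    -- two natural numbers at distance less than one are equal
    have h4 := htrlip α hα X hX
    rw [h1] at h4
    generalize (∑ x ∈ SX with ‖x - α‖ ≤ r, mX x) = k at h3 ⊢
    have h5 : ‖(k : ℂ) - (m α : ℂ)‖ < 1 := by
      rw [norm_sub_rev] at h3
      linarith [norm_sub_le_norm_sub_add_norm_sub (k : ℂ) (tr (Polynomial.aeval X (h α))) (m α : ℂ)]
    have h6 : |(k : ℤ) - (m α : ℤ)| < 1 := by
      have h7 : ‖(((k : ℤ) - (m α : ℤ) : ℤ) : ℂ)‖ < 1 := by
        push_cast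
        exact h5
      rw [Complex.norm_intCast] at h7
      exact_mod_cast h7
    have h7 := Int.abs_lt_one_iff.mp h6
    exact_mod_cast sub_eq_zero.mp h7

/-! ### Division of holomorphic operator functions by a linear pencil -/

section Division

variable {𝓔 : Type*} [NormedAddCommGroup 𝓔] [NormedSpace ℂ 𝓔] [CompleteSpace 𝓔]

theorem isUnit_smul_one_sub {Φ : 𝓔 →L[ℂ] 𝓔} {z : ℂ} (h : ‖Φ‖ < ‖z‖) :
    IsUnit (z • (1 : 𝓔 →L[ℂ] 𝓔) - Φ) := by
  have hz : z ≠ 0 := norm_pos_iff.mp ((norm_nonneg _).trans_lt h)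
  have h1 : ‖z⁻¹ • Φ‖ < 1 := by
    rw [norm_smul, norm_inv, inv_mul_lt_iff₀ (norm_pos_iff.mpr hz), mul_one]
    exact h
  have h2 : z • (1 : 𝓔 →L[ℂ] 𝓔) - Φ = z • (1 - z⁻¹ • Φ) := by
    rw [smul_sub, smul_smul, mul_inv_cancel₀ hz, one_smul]
  rw [h2]
  have h3 := (isUnit_one_sub_of_norm_lt_one h1).smul (Units.mk0 z hz)
  exact h3

theorem norm_inverse_smul_one_sub_apply_le {Φ : 𝓔 →L[ℂ] 𝓔} {r : ℝ} (hr : 0 < r)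
    (hΦ : ‖Φ‖ ≤ r / 2) {z : ℂ} (hz : ‖z‖ = r) (x : 𝓔) :
    ‖Ring.inverse (z • (1 : 𝓔 →L[ℂ] 𝓔) - Φ) x‖ ≤ 2 / r * ‖x‖ := by
  have hu : IsUnit (z • (1 : 𝓔 →L[ℂ] 𝓔) - Φ) := isUnit_smul_one_sub (by linarith)
  set y := Ring.inverse (z • (1 : 𝓔 →L[ℂ] 𝓔) - Φ) x with hy
  have h1 : z • y - Φ y = x :=
    congrArg (fun T : 𝓔 →L[ℂ] 𝓔 => T x) (Ring.mul_inverse_cancel _ hu)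
  have h2 : r * ‖y‖ - r / 2 * ‖y‖ ≤ ‖x‖ := by
    rw [← h1]
    refine le_trans (sub_le_sub ?_ (Φ.le_of_opNorm_le hΦ y)) (norm_sub_norm_le _ _)
    rw [norm_smul, hz]
  rw [div_mul_eq_mul_div, le_div_iff₀ hr]
  linarith

/-- The holomorphic functional calculus `f(Φ) = (2πi)⁻¹ ∮ (z - Φ)⁻¹ f(z) dz` over `|z| = r`, where
the values of `f` are vectors of the space on which `Φ` acts. -/
noncomputable def opEval (f : ℂ → 𝓔) (r : ℝ) (Φ : 𝓔 →L[ℂ] 𝓔) : 𝓔 :=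
  (2 * (Real.pi : ℂ) * Complex.I)⁻¹ • ∮ z in C(0, r), Ring.inverse (z • (1 : 𝓔 →L[ℂ] 𝓔) - Φ) (f z)

/-- The quotient `(k - Φ)⁻¹ (f(k) - f(Φ))`, given by a Cauchy integral over `|z| = r`. -/
noncomputable def opDiv (f : ℂ → 𝓔) (r : ℝ) (Φ : 𝓔 →L[ℂ] 𝓔) (k : ℂ) : 𝓔 :=
  (2 * (Real.pi : ℂ) * Complex.I)⁻¹ •
    ∮ z in C(0, r), (z - k)⁻¹ • Ring.inverse (z • (1 : 𝓔 →L[ℂ] 𝓔) - Φ) (f z)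

theorem continuousOn_inverse_apply {f : ℂ → 𝓔} {r : ℝ} {Φ : 𝓔 →L[ℂ] 𝓔}
    (hΦ : ‖Φ‖ < r) (hf : ContinuousOn f (Metric.sphere 0 r)) :
    ContinuousOn (fun z => Ring.inverse (z • (1 : 𝓔 →L[ℂ] 𝓔) - Φ) (f z)) (Metric.sphere 0 r) := by
  refine ContinuousOn.clm_apply (fun z hz => ?_) hf
  have hu : IsUnit (z • (1 : 𝓔 →L[ℂ] 𝓔) - Φ) :=
    isUnit_smul_one_sub (by rw [mem_sphere_zero_iff_norm.mp hz]; exact hΦ)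
  have h1 : ContinuousAt Ring.inverse (z • (1 : 𝓔 →L[ℂ] 𝓔) - Φ) := by
    obtain ⟨u, hu⟩ := hu
    rw [← hu]
    exact NormedRing.inverse_continuousAt u
  have h2 : ContinuousAt (fun z : ℂ => z • (1 : 𝓔 →L[ℂ] 𝓔) - Φ) z := by fun_prop
  exact (ContinuousAt.comp (f := fun z : ℂ => z • (1 : 𝓔 →L[ℂ] 𝓔) - Φ) (g := Ring.inverse)
    h1 h2).continuousWithinAt

/-- Division with remainder of a vector-valued holomorphic function by the pencil `k - Φ`; for `k`
inside the circle it follows from the identity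
`(z - k)⁻¹ (k - Φ) (z - Φ)⁻¹ = (z - k)⁻¹ - (z - Φ)⁻¹`. -/
theorem opDiv_spec {f : ℂ → 𝓔} {r : ℝ} {Φ : 𝓔 →L[ℂ] 𝓔} (hΦ : ‖Φ‖ < r)
    (hf : DiffContOnCl ℂ f (Metric.ball 0 r)) {k : ℂ} (hk : k ∈ Metric.ball (0 : ℂ) r) :
    k • opDiv f r Φ k - Φ (opDiv f r Φ k) = f k - opEval f r Φ := by
  have hr : 0 < r := (norm_nonneg _).trans_lt hΦ
  have hfs : ContinuousOn f (Metric.sphere 0 r) := by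
    have := hf.continuousOn
    rw [closure_ball _ hr.ne'] at this
    exact this.mono Metric.sphere_subset_closedBall
  have hc := continuousOn_inverse_apply hΦ hfs
  have hne : ∀ z ∈ Metric.sphere (0 : ℂ) r, z - k ≠ 0 := by
    intro z hz h0
    rw [sub_eq_zero.mp h0, Metric.mem_sphere] at hz
    exact hk.ne hz
  have hinv : ContinuousOn (fun z : ℂ => (z - k)⁻¹) (Metric.sphere 0 r) :=
    (continuousOn_id.sub continuousOn_const).inv₀ hne
  set L : 𝓔 →L[ℂ] 𝓔 := k • 1 - Φ with hL
  have h1 : L (∮ z in C(0, r), (z - k)⁻¹ • Ring.inverse (z • (1 : 𝓔 →L[ℂ] 𝓔) - Φ) (f z)) =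
      ∮ z in C(0, r), L ((z - k)⁻¹ • Ring.inverse (z • (1 : 𝓔 →L[ℂ] 𝓔) - Φ) (f z)) := by
    have hci : CircleIntegrable
        (fun z => (z - k)⁻¹ • Ring.inverse (z • (1 : 𝓔 →L[ℂ] 𝓔) - Φ) (f z)) 0 r :=
      (hinv.smul hc).circleIntegrable hr.le
    have hint := hci.out
    rw [circleIntegral, circleIntegral, ← ContinuousLinearMap.intervalIntegral_comp_comm L hint]
    simp only [map_smul]
  have h2 : (∮ z in C(0, r), L ((z - k)⁻¹ • Ring.inverse (z • (1 : 𝓔 →L[ℂ] 𝓔) - Φ) (f z))) =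
      ∮ z in C(0, r), ((z - k)⁻¹ • f z - Ring.inverse (z • (1 : 𝓔 →L[ℂ] 𝓔) - Φ) (f z)) := by
    refine circleIntegral.integral_congr hr.le fun z hz => ?_
    have hu : IsUnit (z • (1 : 𝓔 →L[ℂ] 𝓔) - Φ) :=
      isUnit_smul_one_sub (by rw [mem_sphere_zero_iff_norm.mp hz]; exact hΦ)
    have h3 : z • Ring.inverse (z • (1 : 𝓔 →L[ℂ] 𝓔) - Φ) (f z) -
        Φ (Ring.inverse (z • (1 : 𝓔 →L[ℂ] 𝓔) - Φ) (f z)) = f z :=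
      congrArg (fun T : 𝓔 →L[ℂ] 𝓔 => T (f z)) (Ring.mul_inverse_cancel _ hu)
    generalize Ring.inverse (z • (1 : 𝓔 →L[ℂ] 𝓔) - Φ) (f z) = y at h3 ⊢
    have h4 : L ((z - k)⁻¹ • y) = (z - k)⁻¹ • (k • y - Φ y) := by rw [map_smul]; rfl
    have h5 : k • y - Φ y = f z - (z - k) • y := by
      rw [← h3, sub_smul]
      abel
    rw [h4, h5, smul_sub, smul_smul, inv_mul_cancel₀ (hne z hz), one_smul]
  have hfi : CircleIntegrable (fun z => (z - k)⁻¹ • f z) 0 r :=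
    (hinv.smul hfs).circleIntegrable hr.le
  have h3 : k • opDiv f r Φ k - Φ (opDiv f r Φ k) = L (opDiv f r Φ k) := rfl
  rw [h3, opDiv, map_smul, h1, h2, circleIntegral.integral_sub
    hfi (hc.circleIntegrable hr.le), smul_sub,
    hf.two_pi_i_inv_smul_circleIntegral_sub_inv_smul hk]
  rfl

theorem analyticOnNhd_opDiv {f : ℂ → 𝓔} {r : ℝ} {Φ : 𝓔 →L[ℂ] 𝓔} (hΦ : ‖Φ‖ < r)
    (hf : DiffContOnCl ℂ f (Metric.ball 0 r)) :
    AnalyticOnNhd ℂ (opDiv f r Φ) (Metric.ball 0 r) := by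
  have hr : 0 < r := (norm_nonneg _).trans_lt hΦ
  have hfs : ContinuousOn f (Metric.sphere 0 r) := by
    have := hf.continuousOn
    rw [closure_ball _ hr.ne'] at this
    exact this.mono Metric.sphere_subset_closedBall
  have hc := continuousOn_inverse_apply hΦ hfs
  lift r to NNReal using hr.le
  have := hasFPowerSeriesOn_cauchy_integral (hc.circleIntegrable hr.le) hr
  have h2 := this.analyticOnNhd
  rw [Metric.eball_coe] at h2
  exact h2

theorem norm_opEval_le {f : ℂ → 𝓔} {r b : ℝ} (hr : 0 < r) {Φ : 𝓔 →L[ℂ] 𝓔} (hΦ : ‖Φ‖ ≤ r / 2)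
    (hb : ∀ z ∈ Metric.closedBall (0 : ℂ) r, ‖f z‖ ≤ b) : ‖opEval f r Φ‖ ≤ 2 * b := by
  have h := circleIntegral.norm_two_pi_i_inv_smul_integral_le_of_norm_le_const
    (f := fun z => Ring.inverse (z • (1 : 𝓔 →L[ℂ] 𝓔) - Φ) (f z)) (c := 0) (C := 2 / r * b) hr.le
    fun z hz => by
      refine (norm_inverse_smul_one_sub_apply_le hr hΦ (mem_sphere_zero_iff_norm.mp hz) _).trans ?_
      gcongr
      exact hb z (Metric.sphere_subset_closedBall hz)
  refine h.trans_eq ?_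
  field_simp

theorem norm_opDiv_le {f : ℂ → 𝓔} {r b : ℝ} (hr : 0 < r) {Φ : 𝓔 →L[ℂ] 𝓔} (hΦ : ‖Φ‖ ≤ r / 2)
    (hb : ∀ z ∈ Metric.closedBall (0 : ℂ) r, ‖f z‖ ≤ b) {k : ℂ} (hk : ‖k‖ ≤ r / 2) :
    ‖opDiv f r Φ k‖ ≤ 4 * b / r := by
  have hb0 : 0 ≤ b := (norm_nonneg _).trans (hb 0 (Metric.mem_closedBall_self hr.le))
  have h := circleIntegral.norm_two_pi_i_inv_smul_integral_le_of_norm_le_const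
    (f := fun z => (z - k)⁻¹ • Ring.inverse (z • (1 : 𝓔 →L[ℂ] 𝓔) - Φ) (f z)) (c := 0)
    (C := 2 / r * (2 / r * b)) hr.le
    fun z hz => by
      have hz' := mem_sphere_zero_iff_norm.mp hz
      rw [norm_smul]
      gcongr
      · rw [norm_inv, inv_le_comm₀ _ (by positivity), inv_div]
        · have := norm_sub_norm_le z k
          linarith
        · have := norm_sub_norm_le z k
          linarith
      · refine (norm_inverse_smul_one_sub_apply_le hr hΦ hz' _).trans ?_
        gcongr
        exact hb z (Metric.sphere_subset_closedBall hz)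
  refine h.trans_eq ?_
  field_simp
  ring

theorem norm_opEval_sub_le {f : ℂ → 𝓔} {r b : ℝ} (hr : 0 < r) {Φ Ψ : 𝓔 →L[ℂ] 𝓔}
    (hΦ : ‖Φ‖ ≤ r / 2) (hΨ : ‖Ψ‖ ≤ r / 2) (hf : ContinuousOn f (Metric.sphere 0 r))
    (hb : ∀ z ∈ Metric.closedBall (0 : ℂ) r, ‖f z‖ ≤ b) :
    ‖opEval f r Φ - opEval f r Ψ‖ ≤ 4 * b / r * ‖Φ - Ψ‖ := by
  have hc := (continuousOn_inverse_apply (by linarith : ‖Φ‖ < r) hf).circleIntegrable hr.le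
  have hc' := (continuousOn_inverse_apply (by linarith : ‖Ψ‖ < r) hf).circleIntegrable hr.le
  rw [opEval, opEval, ← smul_sub, ← circleIntegral.integral_sub hc hc']
  have h := circleIntegral.norm_two_pi_i_inv_smul_integral_le_of_norm_le_const
    (f := fun z => Ring.inverse (z • (1 : 𝓔 →L[ℂ] 𝓔) - Φ) (f z) -
      Ring.inverse (z • (1 : 𝓔 →L[ℂ] 𝓔) - Ψ) (f z)) (c := 0)
    (C := 2 / r * (‖Φ - Ψ‖ * (2 / r * b))) hr.le
    fun z hz => by
      have hz' := mem_sphere_zero_iff_norm.mp hz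
      have hu : IsUnit (z • (1 : 𝓔 →L[ℂ] 𝓔) - Φ) := isUnit_smul_one_sub (by linarith)
      have hv : IsUnit (z • (1 : 𝓔 →L[ℂ] 𝓔) - Ψ) := isUnit_smul_one_sub (by linarith)
      have e : Ring.inverse (z • (1 : 𝓔 →L[ℂ] 𝓔) - Φ) (f z) -
          Ring.inverse (z • (1 : 𝓔 →L[ℂ] 𝓔) - Ψ) (f z) =
          Ring.inverse (z • (1 : 𝓔 →L[ℂ] 𝓔) - Φ)
            ((Φ - Ψ) (Ring.inverse (z • (1 : 𝓔 →L[ℂ] 𝓔) - Ψ) (f z))) := by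
        have h1 : Ring.inverse (z • (1 : 𝓔 →L[ℂ] 𝓔) - Φ) - Ring.inverse (z • 1 - Ψ) =
            Ring.inverse (z • (1 : 𝓔 →L[ℂ] 𝓔) - Φ) * ((Φ - Ψ) * Ring.inverse (z • 1 - Ψ)) := by
          have h2 : Φ - Ψ = (z • 1 - Ψ) - (z • 1 - Φ) := by abel
          rw [h2, sub_mul, Ring.mul_inverse_cancel _ hv, mul_sub, mul_one, ← mul_assoc,
            Ring.inverse_mul_cancel _ hu, one_mul]
        exact congrArg (fun T : 𝓔 →L[ℂ] 𝓔 => T (f z)) h1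
      rw [e]
      refine (norm_inverse_smul_one_sub_apply_le hr hΦ hz' _).trans ?_
      gcongr
      refine (ContinuousLinearMap.le_opNorm _ _).trans ?_
      gcongr
      refine (norm_inverse_smul_one_sub_apply_le hr hΨ hz' _).trans ?_
      gcongr
      exact hb z (Metric.sphere_subset_closedBall hz)
  refine h.trans_eq ?_
  field_simp
  ring

end Division

/-! ### Reduction of the poles to the eigenvalues of a matrix -/

theorem analyticAt_ring_inverse {𝔸 : Type*} [NormedRing 𝔸] [NormedAlgebra ℂ 𝔸] [CompleteSpace 𝔸]
    {f : ℂ → 𝔸} {z : ℂ} (hf : AnalyticAt ℂ f z) (hz : IsUnit (f z)) :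
    AnalyticAt ℂ (fun k => Ring.inverse (f k)) z := by
  refine AnalyticAt.fun_comp (g := Ring.inverse) ?_ hf
  obtain ⟨u, hu⟩ := hz
  rw [← hu]
  exact analyticAt_inverse u

theorem isUnit_one_add_of_norm_le_half {𝔸 : Type*} [NormedRing 𝔸] [CompleteSpace 𝔸]
    {a : 𝔸} (ha : ‖a‖ ≤ 1 / 2) : IsUnit (1 + a) := by
  have h := isUnit_one_sub_of_norm_lt_one (x := -a) (by rw [norm_neg]; linarith)
  rwa [sub_neg_eq_add] at h

theorem norm_inverse_one_add_le {𝔸 : Type*} [NormedRing 𝔸] [CompleteSpace 𝔸]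
    (hone : ‖(1 : 𝔸)‖ ≤ 1) {a : 𝔸} (ha : ‖a‖ ≤ 1 / 2) :
    ‖Ring.inverse (1 + a)‖ ≤ 2 ∧ ‖Ring.inverse (1 + a) - 1‖ ≤ 2 * ‖a‖ := by
  have hu := isUnit_one_add_of_norm_le_half ha
  set g := Ring.inverse (1 + a) with hg
  have h1 : g - 1 = -(a * g) := by
    have := Ring.mul_inverse_cancel _ hu
    rw [← hg, add_mul, one_mul] at this
    rw [← this]
    abel
  have h2 : ‖g - 1‖ ≤ ‖a‖ * ‖g‖ := by
    rw [h1, norm_neg]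
    exact norm_mul_le _ _
  have h3 : ‖g‖ ≤ 1 + ‖a‖ * ‖g‖ := by
    have := norm_le_norm_add_norm_sub' g 1
    linarith
  have h4 : ‖a‖ * ‖g‖ ≤ 1 / 2 * ‖g‖ := mul_le_mul_of_nonneg_right ha (norm_nonneg _)
  have h5 : ‖g‖ ≤ 2 := by linarith
  refine ⟨h5, h2.trans ?_⟩
  rw [mul_comm 2]
  exact mul_le_mul_of_nonneg_left h5 (norm_nonneg _)

section Reduction

variable {F H : Type*} [NormedAddCommGroup F] [NormedSpace ℂ F]
  [NormedAddCommGroup H] [NormedSpace ℂ H]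

/-- Composition with `X` on the right, as an operator on the space of operators from `F`. -/
noncomputable def rightComp (H : Type*) [NormedAddCommGroup H] [NormedSpace ℂ H] (X : F →L[ℂ] F) :
    (F →L[ℂ] H) →L[ℂ] (F →L[ℂ] H) :=
  (ContinuousLinearMap.compL ℂ F F H).flip X

/-- Composition with `X` on the left, as an operator on the space of operators into `F`. -/
noncomputable def leftComp (H : Type*) [NormedAddCommGroup H] [NormedSpace ℂ H] (X : F →L[ℂ] F) :
    (H →L[ℂ] F) →L[ℂ] (H →L[ℂ] F) :=
  ContinuousLinearMap.compL ℂ H F F X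

theorem norm_rightComp_le (X : F →L[ℂ] F) : ‖rightComp H X‖ ≤ ‖X‖ :=
  ContinuousLinearMap.opNorm_le_bound _ (norm_nonneg _) fun f => by
    rw [mul_comm]
    exact ContinuousLinearMap.opNorm_comp_le f X

theorem norm_leftComp_le (X : F →L[ℂ] F) : ‖leftComp H X‖ ≤ ‖X‖ :=
  ContinuousLinearMap.opNorm_le_bound _ (norm_nonneg _) fun f =>
    ContinuousLinearMap.opNorm_comp_le X f

/-- The equation `X = E + T(cX)`, with `T(cX) = ∑ Tₗ (cX)ˡ` for `T(z) = ∑ Tₗ zˡ`, has a solution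
close to `E` when `c` and `T` are small. The value `T(cX)` is the functional calculus of the
operator of right multiplication by `cX`, applied to the matrix-valued function `T`. -/
theorem exists_solvent [FiniteDimensional ℂ F] (E : F →L[ℂ] F) (c : ℂ)
    {T : ℂ → F →L[ℂ] F} {r b : ℝ} (hr : 0 < r)
    (hT : DiffContOnCl ℂ T (Metric.ball 0 r))
    (hb : ∀ z ∈ Metric.closedBall (0 : ℂ) r, ‖T z‖ ≤ b) (hb1 : 2 * b ≤ 1)
    (hc : ‖c‖ * (‖E‖ + 1) ≤ r / 2) (hcb : 4 * b / r * ‖c‖ ≤ 1 / 2) :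
    ∃ X : F →L[ℂ] F, ‖X - E‖ ≤ 2 * b ∧ X = E + opEval T r (rightComp F (c • X)) := by
  have : CompleteSpace F := FiniteDimensional.complete ℂ F
  have hTs : ContinuousOn T (Metric.sphere 0 r) := by
    have := hT.continuousOn
    rw [closure_ball _ hr.ne'] at this
    exact this.mono Metric.sphere_subset_closedBall
  have hb0 : 0 ≤ b := (norm_nonneg _).trans (hb 0 (Metric.mem_closedBall_self hr.le))
  set s : Set (F →L[ℂ] F) := Metric.closedBall E (2 * b) with hs
  set f : (F →L[ℂ] F) → F →L[ℂ] F := fun X => E + opEval T r (rightComp F (c • X)) with hf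
  have hsmall : ∀ X ∈ s, ‖rightComp F (c • X)‖ ≤ r / 2 := by
    intro X hX
    refine (norm_rightComp_le _).trans (le_trans ?_ hc)
    rw [norm_smul]
    gcongr
    rw [hs, mem_closedBall_iff_norm] at hX
    linarith [norm_le_norm_add_norm_sub' X E]
  have hmaps : Set.MapsTo f s s := by
    intro X hX
    rw [hs, mem_closedBall_iff_norm, hf]
    simp only
    rw [add_sub_cancel_left]
    exact norm_opEval_le hr (hsmall X hX) hb
  have hlip : LipschitzOnWith (1 / 2 : NNReal) f s := by
    refine LipschitzOnWith.of_dist_le_mul fun X hX Y hY => ?_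
    rw [dist_eq_norm, dist_eq_norm, hf]
    simp only
    rw [add_sub_add_left_eq_sub]
    refine (norm_opEval_sub_le hr (hsmall X hX) (hsmall Y hY) hTs hb).trans ?_
    have h1 : rightComp F (c • X) - rightComp F (c • Y) = rightComp F (c • (X - Y)) := by
      rw [rightComp, rightComp, rightComp, smul_sub, map_sub]
    have h2 : ‖rightComp F (c • (X - Y))‖ ≤ ‖c‖ * ‖X - Y‖ := by
      rw [← norm_smul]
      exact norm_rightComp_le _
    rw [h1]
    have h3 : ((1 / 2 : NNReal) : ℝ) = 1 / 2 := by norm_num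
    rw [h3]
    calc _ ≤ 4 * b / r * (‖c‖ * ‖X - Y‖) := by gcongr
      _ = 4 * b / r * ‖c‖ * ‖X - Y‖ := by ring
      _ ≤ _ := by gcongr
  have hcontr : ContractingWith (1 / 2 : NNReal) (hmaps.restrict f s s) :=
    ⟨by norm_num, hlip.mapsToRestrict hmaps⟩
  have hEs : E ∈ s := Metric.mem_closedBall_self (by linarith)
  obtain ⟨X, hXs, hX, -⟩ := hcontr.exists_fixedPoint' Metric.isClosed_closedBall.isComplete hmaps
    hEs (edist_ne_top _ _)
  exact ⟨X, mem_closedBall_iff_norm.mp hXs, hX.symm⟩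

/-- Inversion of `1 + ω R₀(k) V` on the range of `R₀(k)`, for
`R₀(k) = (i / 2k) ι p + B(k)`, in terms of the inverse `D` of the effective matrix
`k + (iω/2) p V A ι`, where `A = (1 + ω B V)⁻¹`. -/
theorem one_add_mul_reduced_eq (ι : F →L[ℂ] H) (p : H →L[ℂ] F) (V B A : H →L[ℂ] H) (D : F →L[ℂ] F)
    {ω k : ℂ} (hk : k ≠ 0) (hA : (1 + ω • (B * V)) * A = 1)
    (hD : (k • 1 + (Complex.I / 2 * ω) • (p ∘L V ∘L A ∘L ι)) * D = 1) :
    (1 + ω • (((Complex.I / 2 * k⁻¹) • (ι ∘L p) + B) * V)) *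
      (A * B + (Complex.I / 2) • (A ∘L ι ∘L D ∘L p ∘L (1 - ω • (V * A * B)))) =
      (Complex.I / 2 * k⁻¹) • (ι ∘L p) + B := by
  ext w
  have hA' : ∀ x, A x + ω • B (V (A x)) = x := fun x =>
    congrArg (fun T : H →L[ℂ] H => T x) hA
  set q : F := D (p (w - ω • V (A (B w)))) with hq
  have hD' : k • q + (Complex.I / 2 * ω) • p (V (A (ι q))) = p (w - ω • V (A (B w))) :=
    congrArg (fun T : F →L[ℂ] F => T (p (w - ω • V (A (B w))))) hD
  have hD'' := congrArg ι hD'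
  simp only [map_add, map_smul, map_sub] at hD''
  have h1 := hA' (B w)
  have h2 := hA' (ι q)
  have goal : (A (B w) + (Complex.I / 2) • A (ι q)) +
      ω • ((Complex.I / 2 * k⁻¹) • ι (p (V (A (B w) + (Complex.I / 2) • A (ι q)))) +
        B (V (A (B w) + (Complex.I / 2) • A (ι q)))) =
      (Complex.I / 2 * k⁻¹) • ι (p w) + B w := by
    simp only [map_add, map_smul]
    have h3 : ι q = (k⁻¹ * k) • ι q := by rw [inv_mul_cancel₀ hk, one_smul]
    linear_combination (norm := module) h1 + (Complex.I / 2) • h2 + (Complex.I / 2 * k⁻¹) • hD'' +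
      (Complex.I / 2) • h3
  exact goal

/-- If `1 + ω R₀(k) V` is injective, then so is the effective matrix. -/
theorem injective_effective_of_injective (ι : F →L[ℂ] H) (p : H →L[ℂ] F) (hpι : p ∘L ι = 1)
    (V B A : H →L[ℂ] H) {ω k : ℂ} (hk : k ≠ 0) (hA : (1 + ω • (B * V)) * A = 1)
    (hinj : Function.Injective (1 + ω • (((Complex.I / 2 * k⁻¹) • (ι ∘L p) + B) * V) :
      H →L[ℂ] H)) :
    Function.Injective (k • 1 + (Complex.I / 2 * ω) • (p ∘L V ∘L A ∘L ι) : F →L[ℂ] F) := by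
  rw [injective_iff_map_eq_zero] at hinj ⊢
  intro v hv
  have hv' : k • v + (Complex.I / 2 * ω) • p (V (A (ι v))) = 0 := hv
  have hv'' := congrArg ι hv'
  simp only [map_add, map_smul, map_zero] at hv''
  have hA' : ∀ x, A x + ω • B (V (A x)) = x := fun x =>
    congrArg (fun T : H →L[ℂ] H => T x) hA
  have h1 := hA' (ι v)
  have h2 : A (ι v) + ω • ((Complex.I / 2 * k⁻¹) • ι (p (V (A (ι v)))) + B (V (A (ι v)))) = 0 := by
    have h3 : ι v = (k⁻¹ * k) • ι v := by rw [inv_mul_cancel₀ hk, one_smul]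
    linear_combination (norm := module) h1 + k⁻¹ • hv'' + h3
  have h4 : A (ι v) = 0 := hinj _ h2
  rw [h4, map_zero, map_zero, smul_zero, add_zero] at h1
  have h5 : p (ι v) = v := congrArg (fun T : F →L[ℂ] F => T v) hpι
  rw [← h5, ← h1, map_zero]

end Reduction

theorem diffContOnCl_of_analyticOnNhd_closedBall {E : Type*} [NormedAddCommGroup E]
    [NormedSpace ℂ E] {f : ℂ → E} {r : ℝ} (hr : 0 < r)
    (hf : AnalyticOnNhd ℂ f (Metric.closedBall 0 r)) : DiffContOnCl ℂ f (Metric.ball 0 r) := by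
  refine ⟨hf.differentiableOn.mono Metric.ball_subset_closedBall, ?_⟩
  rw [closure_ball _ hr.ne']
  exact hf.continuousOn

theorem analyticAt_clm_comp {E₁ E₂ E₃ : Type*} [NormedAddCommGroup E₁] [NormedSpace ℂ E₁]
    [NormedAddCommGroup E₂] [NormedSpace ℂ E₂] [NormedAddCommGroup E₃] [NormedSpace ℂ E₃]
    {f : ℂ → E₂ →L[ℂ] E₃} {g : ℂ → E₁ →L[ℂ] E₂} {z : ℂ} (hf : AnalyticAt ℂ f z)
    (hg : AnalyticAt ℂ g z) : AnalyticAt ℂ (fun k => f k ∘L g k) z :=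
  ((ContinuousLinearMap.compL ℂ E₁ E₂ E₃).analyticAt_bilinear (f z, g z)).comp₂ hf hg

theorem isUnit_of_injective_of_finiteDimensional {F : Type*} [NormedAddCommGroup F]
    [NormedSpace ℂ F] [FiniteDimensional ℂ F] {A : F →L[ℂ] F} (h : Function.Injective A) :
    IsUnit A := by
  have : CompleteSpace F := FiniteDimensional.complete ℂ F
  rw [ContinuousLinearMap.isUnit_iff_bijective]
  exact ⟨h, LinearMap.surjective_of_injective (f := (A : F →ₗ[ℂ] F)) h⟩

/-- Reduction of the weighted resolvent to a matrix. Up to a holomorphic term, the solution `R` of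
`(1 + ω R₀ V) R = R₀` with `R₀(k) = (i / 2k) ι p + B(k)` is the resolvent of the matrix
`-(iω/2) X`, placed between an injective and a surjective operator; here `X` does not depend on `k`
and is a perturbation of `p V ι`. The two outer operators do not depend on `k` either, because
the remainders of a division by `k + (iω/2) X` are constant. -/
theorem exists_reduction {F H : Type*} [NormedAddCommGroup F] [NormedSpace ℂ F]
    [FiniteDimensional ℂ F] [NormedAddCommGroup H] [NormedSpace ℂ H] [CompleteSpace H]
    (ι : F →L[ℂ] H) (p : H →L[ℂ] F) (hpι : p ∘L ι = 1) (V : H →L[ℂ] H) (B : ℂ → H →L[ℂ] H)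
    {r₀ : ℝ} (hr₀ : 0 < r₀) (hB : AnalyticOnNhd ℂ B (Metric.ball 0 r₀)) :
    ∃ r C : ℝ, 0 < r ∧ r ≤ r₀ ∧ ∀ᶠ ω in 𝓝 (0 : ℂ),
      ∃ (X : F →L[ℂ] F) (U : F →L[ℂ] H) (Y : H →L[ℂ] F) (Q : ℂ → H →L[ℂ] H),
        ‖X - p ∘L V ∘L ι‖ ≤ C * ‖ω‖ ∧ Function.Injective U ∧ Function.Surjective Y ∧
        AnalyticOnNhd ℂ Q (Metric.ball 0 r) ∧
        ∀ k ∈ Metric.ball (0 : ℂ) r, k ≠ 0 →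
          (IsUnit (1 + ω • (((Complex.I / 2 * k⁻¹) • (ι ∘L p) + B k) * V)) →
            IsUnit (k • 1 - (-(Complex.I / 2) * ω) • X)) ∧
          (IsUnit (k • 1 - (-(Complex.I / 2) * ω) • X) →
            (1 + ω • (((Complex.I / 2 * k⁻¹) • (ι ∘L p) + B k) * V)) *
              (Q k + (Complex.I / 2) •
                (U ∘L Ring.inverse (k • 1 - (-(Complex.I / 2) * ω) • X) ∘L Y)) =
              (Complex.I / 2 * k⁻¹) • (ι ∘L p) + B k) := by
  have : CompleteSpace F := FiniteDimensional.complete ℂ F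
  set r₁ := r₀ / 2 with hr₁
  have hr₁0 : 0 < r₁ := half_pos hr₀
  have hsub₁ : Metric.closedBall (0 : ℂ) r₁ ⊆ Metric.ball 0 r₀ :=
    Metric.closedBall_subset_ball (half_lt_self hr₀)
  set r := r₁ / 2 with hr
  have hr0 : 0 < r := half_pos hr₁0
  have hsub : Metric.closedBall (0 : ℂ) r ⊆ Metric.ball 0 r₁ :=
    Metric.closedBall_subset_ball (half_lt_self hr₁0)
  have hsub' : Metric.closedBall (0 : ℂ) r ⊆ Metric.closedBall 0 r₁ :=
    hsub.trans Metric.ball_subset_closedBall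
  obtain ⟨b, hb⟩ : ∃ b, ∀ z ∈ Metric.closedBall (0 : ℂ) r₁, ‖B z‖ ≤ b :=
    (isCompact_closedBall 0 r₁).exists_bound_of_continuousOn (hB.continuousOn.mono hsub₁)
  have hb0 : 0 ≤ b := (norm_nonneg _).trans (hb 0 (Metric.mem_closedBall_self hr₁0.le))
  set E : F →L[ℂ] F := p ∘L V ∘L ι with hE
  set CA : ℝ := 2 * (b * ‖V‖) with hCA
  set CT : ℝ := ‖p‖ * (‖V‖ * (CA * ‖ι‖)) with hCT
  set CY : ℝ → ℝ := fun t => 2 * (t * (4 * (CT * t) / r₁)) * (‖p‖ * 2) + ‖p‖ * (CA * t) with hCY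
  have small : ∀ (f : ℝ → ℝ) (ε : ℝ), Continuous f → f 0 = 0 → 0 < ε →
      ∀ᶠ ω in 𝓝 (0 : ℂ), f ‖ω‖ < ε := by
    intro f ε hf h0 hε
    have : Tendsto (fun ω : ℂ => f ‖ω‖) (𝓝 0) (𝓝 0) :=
      (hf.comp continuous_norm).tendsto' _ _ (by simp [h0])
    exact this.eventually_lt_const hε
  refine ⟨r, 2 * CT, hr0, by linarith, ?_⟩
  filter_upwards [small (fun t => t * (b * ‖V‖)) (1 / 2) (by fun_prop) (by simp) (by norm_num),
    small (fun t => 2 * (CT * t)) 1 (by fun_prop) (by simp) (by norm_num),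
    small (fun t => t * (‖E‖ + 1)) (r / 2) (by fun_prop) (by simp) (by positivity),
    small (fun t => 4 * (CT * t) / r₁ * t) (1 / 2) (by fun_prop) (by simp) (by norm_num),
    small (fun t => ‖p‖ * (2 * (CA * t * ‖ι‖))) 1 (by fun_prop) (by simp) (by norm_num),
    small (fun t => 2 * CY t * ‖ι‖) 1 (by fun_prop) (by simp [hCY]) (by norm_num)]
    with ω h₁ h₂ h₃ h₄ h₅ h₆
  set c : ℂ := -(Complex.I / 2) * ω with hc
  have hcω : ‖c‖ ≤ ‖ω‖ := by
    rw [hc, norm_mul, norm_neg, norm_div, Complex.norm_I, Complex.norm_ofNat]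
    linarith [norm_nonneg ω]
  -- the operator `A = (1 + ω B V)⁻¹`
  set A : ℂ → H →L[ℂ] H := fun k => Ring.inverse (1 + ω • (B k * V)) with hA
  have hωB : ∀ k ∈ Metric.closedBall (0 : ℂ) r₁, ‖ω • (B k * V)‖ ≤ ‖ω‖ * (b * ‖V‖) := by
    intro k hk
    rw [norm_smul]
    gcongr
    exact (norm_mul_le _ _).trans (mul_le_mul_of_nonneg_right (hb k hk) (norm_nonneg _))
  have hAunit : ∀ k ∈ Metric.closedBall (0 : ℂ) r₁, IsUnit (1 + ω • (B k * V)) := fun k hk =>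
    isUnit_one_add_of_norm_le_half ((hωB k hk).trans h₁.le)
  have hAan : AnalyticOnNhd ℂ A (Metric.closedBall 0 r₁) := fun k hk =>
    analyticAt_ring_inverse (analyticAt_const.fun_add (analyticAt_const.fun_smul
      ((hB k (hsub₁ hk)).fun_mul analyticAt_const))) (hAunit k hk)
  have hAR : ∀ k ∈ Metric.closedBall (0 : ℂ) r₁, (1 + ω • (B k * V)) * A k = 1 := fun k hk =>
    Ring.mul_inverse_cancel _ (hAunit k hk)
  have hA2 : ∀ k ∈ Metric.closedBall (0 : ℂ) r₁, ‖A k‖ ≤ 2 := fun k hk =>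
    (norm_inverse_one_add_le ContinuousLinearMap.norm_id_le ((hωB k hk).trans h₁.le)).1
  have hA1 : ∀ k ∈ Metric.closedBall (0 : ℂ) r₁, ‖A k - 1‖ ≤ CA * ‖ω‖ := by
    intro k hk
    have := (norm_inverse_one_add_le ContinuousLinearMap.norm_id_le ((hωB k hk).trans h₁.le)).2
    refine this.trans ?_
    have := hωB k hk
    rw [hCA]
    linarith
  have hCA0 : 0 ≤ CA := by positivity
  have hCT0 : 0 ≤ CT := by positivity
  -- the effective matrix is `k + (iω/2) (E + T k)`; the solvent `X` satisfies `X = E + T(cX)`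
  set u : ℂ → F →L[ℂ] H := fun k => (A k - 1) ∘L ι with hu
  have huan : AnalyticOnNhd ℂ u (Metric.closedBall 0 r₁) := fun k hk =>
    analyticAt_clm_comp ((hAan k hk).fun_sub analyticAt_const) analyticAt_const
  have hub : ∀ k ∈ Metric.closedBall (0 : ℂ) r₁, ‖u k‖ ≤ CA * ‖ω‖ * ‖ι‖ := fun k hk =>
    (ContinuousLinearMap.opNorm_comp_le _ _).trans
      (mul_le_mul_of_nonneg_right (hA1 k hk) (norm_nonneg _))
  set T : ℂ → F →L[ℂ] F := fun k => p ∘L V ∘L u k with hT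
  have hTan : AnalyticOnNhd ℂ T (Metric.closedBall 0 r₁) := fun k hk =>
    analyticAt_clm_comp analyticAt_const (analyticAt_clm_comp analyticAt_const (huan k hk))
  have hTb : ∀ k ∈ Metric.closedBall (0 : ℂ) r₁, ‖T k‖ ≤ CT * ‖ω‖ := by
    intro k hk
    calc ‖T k‖ ≤ ‖p‖ * (‖V‖ * ‖u k‖) :=
          (ContinuousLinearMap.opNorm_comp_le _ _).trans (mul_le_mul_of_nonneg_left
            (ContinuousLinearMap.opNorm_comp_le _ _) (norm_nonneg _))
      _ ≤ ‖p‖ * (‖V‖ * (CA * ‖ω‖ * ‖ι‖)) := by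
          gcongr
          exact hub k hk
      _ = CT * ‖ω‖ := by rw [hCT]; ring
  have hTd := diffContOnCl_of_analyticOnNhd_closedBall hr₁0 hTan
  have hcE : ‖c‖ * (‖E‖ + 1) ≤ r / 2 :=
    (mul_le_mul_of_nonneg_right hcω (by positivity)).trans h₃.le
  have hcT : 4 * (CT * ‖ω‖) / r₁ * ‖c‖ ≤ 1 / 2 :=
    (mul_le_mul_of_nonneg_left hcω (by positivity)).trans h₄.le
  obtain ⟨X, hXE, hX⟩ := exists_solvent E c hr₁0 hTd hTb h₂.le (hcE.trans (by linarith)) hcT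
  have hXE' : ‖X - E‖ ≤ 2 * CT * ‖ω‖ := by linarith
  have hcX : ‖c • X‖ ≤ r / 2 := by
    rw [norm_smul]
    refine le_trans ?_ hcE
    gcongr
    linarith [norm_le_norm_add_norm_sub' X E]
  have hRF : ‖rightComp F (c • X)‖ ≤ r₁ / 2 := (norm_rightComp_le _).trans (by linarith)
  have hRH : ‖rightComp H (c • X)‖ ≤ r₁ / 2 := (norm_rightComp_le _).trans (by linarith)
  have hLH : ‖leftComp H (c • X)‖ ≤ r / 2 := (norm_leftComp_le _).trans hcX
  -- `T k - T(cX)` is divisible by `k - cX`, which factors the effective matrix as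
  -- `(1 - c T' k) (k - cX)`
  set T' := opDiv T r₁ (rightComp F (c • X)) with hT'
  have hT'an : AnalyticOnNhd ℂ T' (Metric.ball 0 r₁) := analyticOnNhd_opDiv (by linarith) hTd
  have hT'b : ∀ k ∈ Metric.closedBall (0 : ℂ) r, ‖-(c • T' k)‖ ≤ ‖ω‖ * (4 * (CT * ‖ω‖) / r₁) := by
    intro k hk
    rw [norm_neg, norm_smul]
    exact mul_le_mul hcω (norm_opDiv_le hr₁0 hRF hTb (mem_closedBall_zero_iff.mp hk))
      (norm_nonneg _) (norm_nonneg _)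
  have hT'h : ∀ k ∈ Metric.closedBall (0 : ℂ) r, ‖-(c • T' k)‖ ≤ 1 / 2 := fun k hk =>
    (hT'b k hk).trans (by linarith)
  set Z : ℂ → F →L[ℂ] F := fun k => Ring.inverse (1 + -(c • T' k)) with hZ
  have hZunit : ∀ k ∈ Metric.closedBall (0 : ℂ) r, IsUnit (1 + -(c • T' k)) := fun k hk =>
    isUnit_one_add_of_norm_le_half (hT'h k hk)
  have hZan : AnalyticOnNhd ℂ Z (Metric.closedBall 0 r) := fun k hk =>
    analyticAt_ring_inverse (analyticAt_const.fun_add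
      (analyticAt_const.fun_smul (hT'an k (hsub hk))).fun_neg) (hZunit k hk)
  have hZ1 : ∀ k ∈ Metric.closedBall (0 : ℂ) r,
      ‖Z k - 1‖ ≤ 2 * (‖ω‖ * (4 * (CT * ‖ω‖) / r₁)) := by
    intro k hk
    refine (norm_inverse_one_add_le ContinuousLinearMap.norm_id_le (hT'h k hk)).2.trans ?_
    exact mul_le_mul_of_nonneg_left (hT'b k hk) (by norm_num)
  have hfac : ∀ k ∈ Metric.ball (0 : ℂ) r₁,
      k • 1 + (Complex.I / 2 * ω) • (p ∘L V ∘L A k ∘L ι) =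
        (1 + -(c • T' k)) * (k • 1 - c • X) := by
    intro k hk
    have h := opDiv_spec (by linarith : ‖rightComp F (c • X)‖ < r₁) hTd hk
    rw [← hT'] at h
    have hXE'' : opEval T r₁ (rightComp F (c • X)) = X - E := by
      conv_rhs => rw [hX]
      abel
    rw [hXE''] at h
    ext v
    have h' : k • T' k v - T' k (c • X v) = p (V (A k (ι v) - ι v)) - (X v - p (V (ι v))) :=
      congrArg (fun S : F →L[ℂ] F => S v) h
    change k • v + (Complex.I / 2 * ω) • p (V (A k (ι v))) =
      (k • v - c • X v) + -(c • T' k (k • v - c • X v))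
    simp only [map_sub, map_smul] at h' ⊢
    rw [hc] at h' ⊢
    linear_combination (norm := module) (-(Complex.I / 2 * ω)) • h'
  -- the right factor `(1 - c T' k)⁻¹ p A' k = p + y k`; below, `u` and `y` are divided by `k - cX`,
  -- and the remainders `u₀`, `y₀` give the factors `U = ι + u₀` and `Y = p + y₀`
  set A' : ℂ → H →L[ℂ] H := fun k => 1 - ω • (V * A k * B k) with hA'
  have hA'1 : ∀ k ∈ Metric.closedBall (0 : ℂ) r, ‖A' k - 1‖ ≤ CA * ‖ω‖ := by
    intro k hk
    have e : A' k - 1 = -(ω • (V * A k * B k)) := by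
      rw [hA']
      exact sub_sub_cancel_left _ _
    rw [e, norm_neg, norm_smul]
    calc ‖ω‖ * ‖V * A k * B k‖ ≤ ‖ω‖ * (‖V‖ * ‖A k‖ * ‖B k‖) := by
          gcongr
          exact (norm_mul_le _ _).trans
            (mul_le_mul_of_nonneg_right (norm_mul_le _ _) (norm_nonneg _))
      _ ≤ ‖ω‖ * (‖V‖ * 2 * b) := by
          gcongr
          · exact hA2 k (hsub' hk)
          · exact hb k (hsub' hk)
      _ = CA * ‖ω‖ := by rw [hCA]; ring
  have hA'2 : ∀ k ∈ Metric.closedBall (0 : ℂ) r, ‖A' k‖ ≤ 2 := by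
    intro k hk
    have h7 := norm_le_norm_add_norm_sub' (A' k) 1
    have h8 : ‖(1 : H →L[ℂ] H)‖ ≤ 1 := ContinuousLinearMap.norm_id_le
    have h9 := hA'1 k hk
    have h10 : CA * ‖ω‖ ≤ 1 := by
      rw [hCA]
      linarith
    linarith
  set y : ℂ → H →L[ℂ] F := fun k => Z k ∘L p ∘L A' k - p with hy
  have hyan : AnalyticOnNhd ℂ y (Metric.closedBall 0 r) := by
    intro k hk
    have h7 : AnalyticAt ℂ A' k := analyticAt_const.fun_sub (analyticAt_const.fun_smul
      ((analyticAt_const.fun_mul (hAan k (hsub' hk))).fun_mul (hB k (hsub₁ (hsub' hk)))))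
    exact (analyticAt_clm_comp (hZan k hk) (analyticAt_clm_comp analyticAt_const h7)).fun_sub
      analyticAt_const
  have hyb : ∀ k ∈ Metric.closedBall (0 : ℂ) r, ‖y k‖ ≤ CY ‖ω‖ := by
    intro k hk
    have e : y k = (Z k - 1) ∘L p ∘L A' k + p ∘L (A' k - 1) := by
      ext w
      change Z k (p (A' k w)) - p w = (Z k (p (A' k w)) - p (A' k w)) + p (A' k w - w)
      rw [map_sub]
      abel
    rw [e, hCY]
    refine (norm_add_le _ _).trans (add_le_add ?_ ?_)
    · calc _ ≤ ‖Z k - 1‖ * (‖p‖ * ‖A' k‖) :=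
            (ContinuousLinearMap.opNorm_comp_le _ _).trans (mul_le_mul_of_nonneg_left
              (ContinuousLinearMap.opNorm_comp_le _ _) (norm_nonneg _))
        _ ≤ _ := by
            gcongr
            · exact hZ1 k hk
            · exact hA'2 k hk
    · exact (ContinuousLinearMap.opNorm_comp_le _ _).trans
        (mul_le_mul_of_nonneg_left (hA'1 k hk) (norm_nonneg _))
  have hud := diffContOnCl_of_analyticOnNhd_closedBall hr₁0 huan
  have hyd := diffContOnCl_of_analyticOnNhd_closedBall hr0 hyan
  set u₀ := opEval u r₁ (rightComp H (c • X)) with hu₀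
  set u' := opDiv u r₁ (rightComp H (c • X)) with hu'
  set y₀ := opEval y r (leftComp H (c • X)) with hy₀
  set y' := opDiv y r (leftComp H (c • X)) with hy'
  have hinj : Function.Injective (ι + u₀) := by
    rw [injective_iff_map_eq_zero]
    intro v hv
    have h7 : v = -p (u₀ v) := by
      have h8 : p (ι v) = v := congrArg (fun T : F →L[ℂ] F => T v) hpι
      have h9 : ι v = -u₀ v := eq_neg_of_add_eq_zero_left hv
      rw [← map_neg, ← h9, h8]
    have h8 : ‖v‖ ≤ ‖p‖ * (2 * (CA * ‖ω‖ * ‖ι‖)) * ‖v‖ := by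
      conv_lhs => rw [h7, norm_neg]
      rw [mul_assoc]
      exact p.le_opNorm_of_le (u₀.le_of_opNorm_le (norm_opEval_le hr₁0 hRH hub) v)
    by_contra hv0
    have h9 : 0 < ‖v‖ := norm_pos_iff.mpr hv0
    have h10 : ‖p‖ * (2 * (CA * ‖ω‖ * ‖ι‖)) * ‖v‖ < 1 * ‖v‖ := mul_lt_mul_of_pos_right h₅ h9
    linarith
  have hsurj : Function.Surjective (p + y₀) := by
    have h7 : Function.Injective ((p + y₀) ∘L ι) := by
      rw [injective_iff_map_eq_zero]
      intro v hv
      have h8 : p (ι v) = v := congrArg (fun T : F →L[ℂ] F => T v) hpι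
      have h9 : p (ι v) + y₀ (ι v) = 0 := hv
      rw [h8] at h9
      have h10 : ‖v‖ ≤ 2 * CY ‖ω‖ * ‖ι‖ * ‖v‖ := by
        conv_lhs => rw [eq_neg_of_add_eq_zero_left h9, norm_neg]
        rw [mul_assoc]
        exact (y₀.le_of_opNorm_le (norm_opEval_le hr0 hLH hyb) _).trans
          (mul_le_mul_of_nonneg_left (ι.le_opNorm v)
            ((norm_nonneg _).trans (norm_opEval_le hr0 hLH hyb)))
      by_contra hv0
      have h11 : 0 < ‖v‖ := norm_pos_iff.mpr hv0
      have h12 : 2 * CY ‖ω‖ * ‖ι‖ * ‖v‖ < 1 * ‖v‖ := mul_lt_mul_of_pos_right h₆ h11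
      linarith
    have h8 : Function.Surjective ((p + y₀) ∘L ι) :=
      LinearMap.surjective_of_injective (f := (((p + y₀) ∘L ι : F →L[ℂ] F) : F →ₗ[ℂ] F)) h7
    intro v
    obtain ⟨x, hx⟩ := h8 v
    exact ⟨ι x, hx⟩
  refine ⟨X, ι + u₀, p + y₀, fun k => A k * B k +
    (Complex.I / 2) • ((ι + u₀) ∘L y' k + u' k ∘L (y k + p)), hXE', hinj, hsurj, ?_, ?_⟩
  · intro k hk
    have hk1 := hsub (Metric.ball_subset_closedBall hk)
    have hk2 := Metric.ball_subset_closedBall hk1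
    have h7 : AnalyticAt ℂ y' k := analyticOnNhd_opDiv (by linarith) hyd k hk
    have h8 : AnalyticAt ℂ u' k := analyticOnNhd_opDiv (by linarith) hud k hk1
    have h9 : AnalyticAt ℂ (fun k => (ι + u₀) ∘L y' k) k :=
      analyticAt_clm_comp analyticAt_const h7
    have h10 : AnalyticAt ℂ (fun k => u' k ∘L (y k + p)) k :=
      analyticAt_clm_comp h8
        ((hyan k (Metric.ball_subset_closedBall hk)).fun_add analyticAt_const)
    exact ((hAan k hk2).fun_mul (hB k (hsub₁ hk2))).fun_add
      (analyticAt_const.fun_smul (h9.fun_add h10))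
  · intro k hk hk0
    have hkc := Metric.ball_subset_closedBall hk
    have hk1 := hsub hkc
    have hk2 := Metric.ball_subset_closedBall hk1
    refine ⟨fun hunit => ?_, fun hunit => ?_⟩
    · have h7 := injective_effective_of_injective ι p hpι V (B k) (A k) hk0 (hAR k hk2)
        (ContinuousLinearMap.isUnit_iff_bijective.mp hunit).1
      rw [hfac k hk1] at h7
      refine isUnit_of_injective_of_finiteDimensional fun v w hvw => h7 ?_
      change (1 + -(c • T' k)) ((k • 1 - c • X) v) = (1 + -(c • T' k)) ((k • 1 - c • X) w)
      rw [hvw]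
    · set D := Ring.inverse (k • 1 - c • X) with hD
      have hDZ : (k • 1 + (Complex.I / 2 * ω) • (p ∘L V ∘L A k ∘L ι)) * (D * Z k) = 1 := by
        rw [hfac k hk1, mul_assoc, ← mul_assoc (k • 1 - c • X), hD,
          Ring.mul_inverse_cancel _ hunit, one_mul, hZ, Ring.mul_inverse_cancel _ (hZunit k hkc)]
      refine Eq.trans ?_
        (one_add_mul_reduced_eq ι p V (B k) (A k) (D * Z k) hk0 (hAR k hk2) hDZ)
      congr 1
      rw [add_assoc, ← smul_add]
      congr 2
      ext w
      have hyk : (y k + p) w = Z k (p (A' k w)) :=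
        congrArg (fun S : H →L[ℂ] F => S w) (sub_add_cancel (Z k ∘L p ∘L A' k) p)
      have hu'' := opDiv_spec (by linarith : ‖rightComp H (c • X)‖ < r₁) hud hk1
      have hy'' := opDiv_spec (by linarith : ‖leftComp H (c • X)‖ < r) hyd hk
      rw [← hu', ← hu₀] at hu''
      rw [← hy', ← hy₀] at hy''
      set q := D ((y k + p) w) with hq
      have h7 : k • u' k q - u' k (c • X q) = (A k (ι q) - ι q) - u₀ q :=
        congrArg (fun S : F →L[ℂ] H => S q) hu''
      have h8 : k • y' k w - c • X (y' k w) = y k w - y₀ w :=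
        congrArg (fun S : H →L[ℂ] F => S w) hy''
      have h9 : k • q - c • X q = (y k + p) w :=
        congrArg (fun S : F →L[ℂ] F => S ((y k + p) w)) (Ring.mul_inverse_cancel _ hunit)
      have h10 : ∀ v, D (k • v - c • X v) = v := fun v =>
        congrArg (fun S : F →L[ℂ] F => S v) (Ring.inverse_mul_cancel _ hunit)
      have h11 : q = y' k w + D ((p + y₀) w) := by
        have e : (y k + p) w = (k • y' k w - c • X (y' k w)) + (p + y₀) w := by
          rw [h8]
          change y k w + p w = (y k w - y₀ w) + (p w + y₀ w)
          abel
        rw [hq, e, map_add, h10]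
      have h12 : u' k ((y k + p) w) = A k (ι q) - (ι + u₀) q := by
        rw [← h9, map_sub, map_smul, h7]
        change _ = A k (ι q) - (ι q + u₀ q)
        abel
      have goal : (ι + u₀) (y' k w) + u' k ((y k + p) w) + (ι + u₀) (D ((p + y₀) w)) =
          A k (ι (D (Z k (p (A' k w))))) := by
        rw [h12, ← hyk, ← hq]
        conv_lhs => enter [1, 2, 2]; rw [h11, map_add]
        abel
      exact goal

/-! ### Translations and multiplication operators -/

section Operators

variable {G : Type*} [NormedAddCommGroup G] [InnerProductSpace ℂ G]

theorem norm_shiftOp_le (j : ℤ) : ‖shiftOp G j‖ ≤ 1 :=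
  LinearMap.mkContinuous_norm_le _ zero_le_one _

theorem shiftOp_mul (i j : ℤ) : shiftOp G i * shiftOp G j = shiftOp G (i + j) := by
  ext u n
  change u (n + i + j) = u (n + (i + j))
  rw [add_assoc]

theorem shiftOp_zero : shiftOp G 0 = 1 := by
  ext u n
  change u (n + 0) = u n
  rw [add_zero]

theorem shiftOp_pow (j : ℤ) (l : ℕ) : shiftOp G j ^ l = shiftOp G (l * j) := by
  induction l with
  | zero => rw [pow_zero, Nat.cast_zero, zero_mul, shiftOp_zero]
  | succ l ih =>
    rw [pow_succ, ih, shiftOp_mul]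
    congr 1
    push_cast
    ring

/-- The operator `I ⊗ T` on `ℓ²(ℤ; G)`. -/
noncomputable def fiberConst (T : G →L[ℂ] G) : L2Z G →L[ℂ] L2Z G :=
  fiberOp (fun _ => T) ⟨‖T‖, fun _ => le_rfl⟩

theorem fiberConst_apply (T : G →L[ℂ] G) (u : L2Z G) (n : ℤ) : fiberConst T u n = T (u n) := rfl

theorem fiberConst_mul (T T' : G →L[ℂ] G) : fiberConst T * fiberConst T' = fiberConst (T * T') := by
  ext u n
  rfl

theorem fiberConst_one : fiberConst (1 : G →L[ℂ] G) = 1 := by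
  ext u n
  rfl

theorem fiberConst_smul (c : ℂ) (T : G →L[ℂ] G) : fiberConst (c • T) = c • fiberConst T := by
  ext u n
  rfl

theorem fiberConst_add (T T' : G →L[ℂ] G) :
    fiberConst (T + T') = fiberConst T + fiberConst T' := by
  ext u n
  rfl

theorem fiberConst_zero : fiberConst (0 : G →L[ℂ] G) = 0 := by
  ext u n
  rfl

theorem fiberConst_sum {α : Type*} (s : Finset α) (T : α → G →L[ℂ] G) :
    fiberConst (∑ i ∈ s, T i) = ∑ i ∈ s, fiberConst (T i) := by
  classical
  induction s using Finset.induction_on with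
  | empty => rw [Finset.sum_empty, Finset.sum_empty, fiberConst_zero]
  | insert a s ha ih => rw [Finset.sum_insert ha, Finset.sum_insert ha, fiberConst_add, ih]

theorem commute_shiftOp_fiberConst (j : ℤ) (T : G →L[ℂ] G) :
    Commute (shiftOp G j) (fiberConst T) := by
  ext u n
  rfl

theorem weightOp_apply {s : ℝ} (hs : 0 < s) (u : L2Z G) (n : ℤ) :
    weightOp G s hs u n = (weightNeg s n : ℂ) • u n := rfl

theorem commute_weightOp_fiberConst {s : ℝ} (hs : 0 < s) (T : G →L[ℂ] G) :
    Commute (weightOp G s hs) (fiberConst T) := by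
  ext u n
  exact (map_smul T _ _).symm

theorem weightNeg_mul_weightNeg_le {s : ℝ} (hs : 0 < s) (n j : ℤ) :
    weightNeg s n * weightNeg s (n + j) ≤
      ((expNorm s)⁻¹) ^ 2 * Real.exp (-(s / 2) * |(j : ℝ)|) := by
  rw [weightNeg, weightNeg, sq, mul_mul_mul_comm, ← Real.exp_add]
  refine mul_le_mul_of_nonneg_left (Real.exp_le_exp.mpr ?_) (mul_self_nonneg _)
  have h1 : |(j : ℝ)| ≤ |(n : ℝ)| + |((n + j : ℤ) : ℝ)| := by
    have : (j : ℝ) = ((n + j : ℤ) : ℝ) - n := by push_cast; ring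
    rw [this, add_comm |(n : ℝ)|]
    exact norm_sub_le ((n + j : ℤ) : ℝ) (n : ℝ)
  nlinarith

theorem weightNeg_nonneg (s : ℝ) (n : ℤ) : 0 ≤ weightNeg s n :=
  mul_nonneg (inv_nonneg.mpr (Real.sqrt_nonneg _)) (Real.exp_pos _).le

/-- The weights on both sides make the translations exponentially small. -/
theorem norm_weightOp_shiftOp_weightOp_le {s : ℝ} (hs : 0 < s) (j : ℤ) :
    ‖weightOp G s hs * shiftOp G j * weightOp G s hs‖ ≤
      ((expNorm s)⁻¹) ^ 2 * Real.exp (-(s / 2) * |(j : ℝ)|) := by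
  set C := ((expNorm s)⁻¹) ^ 2 * Real.exp (-(s / 2) * |(j : ℝ)|) with hC
  have hC0 : 0 ≤ C := by positivity
  refine ContinuousLinearMap.opNorm_le_bound _ hC0 fun u => ?_
  have h1 : ‖(weightOp G s hs * shiftOp G j * weightOp G s hs) u‖ ≤ ‖(C : ℂ) • shiftOp G j u‖ := by
    refine lp.norm_mono (by norm_num) fun n => ?_
    change ‖(weightNeg s n : ℂ) • ((weightNeg s (n + j) : ℂ) • u (n + j))‖ ≤
      ‖(C : ℂ) • u (n + j)‖
    rw [smul_smul, norm_smul, norm_smul, ← Complex.ofReal_mul, Complex.norm_real,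
      Complex.norm_real, Real.norm_of_nonneg hC0,
      Real.norm_of_nonneg (mul_nonneg (weightNeg_nonneg s n) (weightNeg_nonneg s _))]
    exact mul_le_mul_of_nonneg_right (weightNeg_mul_weightNeg_le hs n j) (norm_nonneg _)
  refine h1.trans ?_
  rw [norm_smul, Complex.norm_real, Real.norm_of_nonneg hC0]
  refine mul_le_mul_of_nonneg_left ?_ hC0
  simpa using (shiftOp G j).le_of_opNorm_le (norm_shiftOp_le j) u

end Operators

/-! ### The resolvent of the discrete Laplacian -/

/-- With `a' = a⁻¹` and `x + x⁻¹ = 2 - ζ`, the element `2 - a - a⁻¹ - ζ` factors as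
`x⁻¹ (1 - x a) (1 - x a⁻¹)`; its inverse is computed by partial fractions. -/
theorem pencil_inverse {𝔸 : Type*} [Ring 𝔸] [Algebra ℂ 𝔸] {a a' : 𝔸} (h : a * a' = 1)
    (h' : a' * a = 1) {x ζ : ℂ} (hx0 : x ≠ 0) (hx1 : x ^ 2 ≠ 1) (hx : x + x⁻¹ = 2 - ζ)
    (hu : IsUnit (1 - x • a)) (hu' : IsUnit (1 - x • a')) :
    IsUnit ((2 : ℂ) • 1 - a - a' - ζ • 1) ∧
      Ring.inverse ((2 : ℂ) • 1 - a - a' - ζ • 1) = (x / (1 - x ^ 2)) •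
        (Ring.inverse (1 - x • a) + Ring.inverse (1 - x • a') - 1) := by
  have hx2 : 1 - x ^ 2 ≠ 0 := sub_ne_zero.mpr (Ne.symm hx1)
  have hmul : (1 - x • a) * (1 - x • a') = (1 + x ^ 2) • (1 : 𝔸) - x • a - x • a' := by
    simp only [sub_mul, mul_sub, one_mul, mul_one, smul_mul_smul_comm, h]
    module
  have hmul' : (1 - x • a') * (1 - x • a) = (1 - x • a) * (1 - x • a') := by
    rw [hmul]
    simp only [sub_mul, mul_sub, one_mul, mul_one, smul_mul_smul_comm, h']
    module
  have e : (2 : ℂ) • 1 - a - a' - ζ • 1 = x⁻¹ • ((1 - x • a) * (1 - x • a')) := by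
    rw [hmul]
    have h3 : x⁻¹ * (1 + x ^ 2) = 2 - ζ := by
      rw [← hx]
      field_simp
      ring
    simp only [smul_sub, smul_smul, h3, inv_mul_cancel₀ hx0, one_smul, sub_smul]
    abel
  have hunit : IsUnit ((2 : ℂ) • 1 - a - a' - ζ • 1) := by
    rw [e]
    exact (hu.mul hu').smul (Units.mk0 x⁻¹ (inv_ne_zero hx0))
  refine ⟨hunit, inverse_eq_of_mul_eq_one hunit ?_⟩
  have h4 : (1 - x • a) * (1 - x • a') *
      (Ring.inverse (1 - x • a) + Ring.inverse (1 - x • a') - 1) = (1 - x ^ 2) • (1 : 𝔸) := by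
    have h6 : (1 - x • a) * (1 - x • a') * Ring.inverse (1 - x • a) = 1 - x • a' := by
      rw [← hmul', mul_assoc, Ring.mul_inverse_cancel _ hu, mul_one]
    have h7 : (1 - x • a) * (1 - x • a') * Ring.inverse (1 - x • a') = 1 - x • a := by
      rw [mul_assoc, Ring.mul_inverse_cancel _ hu', mul_one]
    rw [mul_sub, mul_add, h6, h7, mul_one, hmul]
    module
  rw [e, smul_mul_smul_comm, h4, smul_smul]
  have h5 : x⁻¹ * (x / (1 - x ^ 2)) * (1 - x ^ 2) = 1 := by field_simp
  rw [h5, one_smul]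

theorem analyticAt_tsum_pow_smul {E : Type*} [NormedAddCommGroup E] [NormedSpace ℂ E]
    [CompleteSpace E] {a : ℕ → E} {C s : ℝ} (hs : 0 < s) (ha : ∀ l, ‖a l‖ ≤ C * s ^ l) {x : ℂ}
    (hx : ‖x‖ * s < 1) : AnalyticAt ℂ (fun z : ℂ => ∑' l : ℕ, z ^ l • a l) x := by
  obtain ⟨q, hxq, hq⟩ : ∃ q, ‖x‖ < q ∧ q < s⁻¹ :=
    exists_between (by rwa [← one_div, lt_div_iff₀ hs])
  have hq0 : 0 ≤ q := (norm_nonneg x).trans hxq.le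
  have hqs : q * s < 1 := by rwa [← one_div, lt_div_iff₀ hs] at hq
  have hsum : Summable fun l : ℕ => C * (q * s) ^ l :=
    (summable_geometric_of_lt_one (by positivity) hqs).mul_left C
  have hd := Complex.differentiableOn_tsum_of_summable_norm (F := fun (l : ℕ) (z : ℂ) => z ^ l • a l)
    hsum (fun l => ((differentiable_pow l).smul_const (a l)).differentiableOn)
    (Metric.isOpen_ball (x := (0 : ℂ)) (ε := q)) (fun l z hz => by
      rw [norm_smul, norm_pow]
      have hz' : ‖z‖ ≤ q := (mem_ball_zero_iff.mp hz).le
      calc ‖z‖ ^ l * ‖a l‖ ≤ q ^ l * (C * s ^ l) := by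
            gcongr
            exact ha l
        _ = C * (q * s) ^ l := by rw [mul_pow]; ring)
  exact hd.analyticAt (Metric.isOpen_ball.mem_nhds (mem_ball_zero_iff.mpr hxq))

section Resolvent

variable {G : Type*} [NormedAddCommGroup G] [InnerProductSpace ℂ G]

/-- The operator with kernel `W_{-s}(n) x^{|n-m|} W_{-s}(m)`. -/
noncomputable def weightedPowerOp (G : Type*) [NormedAddCommGroup G] [InnerProductSpace ℂ G]
    (s : ℝ) (hs : 0 < s) (x : ℂ) : L2Z G →L[ℂ] L2Z G :=
  ∑' l : ℕ, x ^ l • (weightOp G s hs * shiftOp G l * weightOp G s hs) +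
    ∑' l : ℕ, x ^ l • (weightOp G s hs * shiftOp G (-l) * weightOp G s hs) -
    weightOp G s hs * weightOp G s hs

theorem norm_weightOp_shiftOp_natCast_le {s : ℝ} (hs : 0 < s) (l : ℕ) :
    ‖weightOp G s hs * shiftOp G l * weightOp G s hs‖ ≤
      ((expNorm s)⁻¹) ^ 2 * Real.exp (-(s / 2)) ^ l ∧
    ‖weightOp G s hs * shiftOp G (-l) * weightOp G s hs‖ ≤
      ((expNorm s)⁻¹) ^ 2 * Real.exp (-(s / 2)) ^ l := by
  have h1 := norm_weightOp_shiftOp_weightOp_le (G := G) hs (l : ℤ)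
  have h2 := norm_weightOp_shiftOp_weightOp_le (G := G) hs (-(l : ℤ))
  have e : Real.exp (-(s / 2)) ^ l = Real.exp (-(s / 2) * |(((l : ℤ)) : ℝ)|) := by
    rw [← Real.exp_nat_mul, mul_comm, Int.cast_natCast, Nat.abs_cast]
  have e' : |((-(l : ℤ) : ℤ) : ℝ)| = |(((l : ℤ)) : ℝ)| := by rw [Int.cast_neg, abs_neg]
  rw [e'] at h2
  rw [e]
  exact ⟨h1, h2⟩

theorem analyticAt_weightedPowerOp [CompleteSpace G] {s : ℝ} (hs : 0 < s) {x : ℂ}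
    (hx : ‖x‖ * Real.exp (-(s / 2)) < 1) : AnalyticAt ℂ (weightedPowerOp G s hs) x :=
  ((analyticAt_tsum_pow_smul (Real.exp_pos _)
    (fun l => (norm_weightOp_shiftOp_natCast_le hs l).1) hx).fun_add
    (analyticAt_tsum_pow_smul (Real.exp_pos _)
    (fun l => (norm_weightOp_shiftOp_natCast_le hs l).2) hx)).fun_sub analyticAt_const

theorem inverse_one_sub_smul_shiftOp [CompleteSpace G] {s : ℝ} (hs : 0 < s) {x : ℂ} (hx : ‖x‖ < 1)
    (j : ℤ) : IsUnit (1 - x • shiftOp G j) ∧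
      weightOp G s hs * Ring.inverse (1 - x • shiftOp G j) * weightOp G s hs =
        ∑' l : ℕ, x ^ l • (weightOp G s hs * shiftOp G (l * j) * weightOp G s hs) := by
  have hn : ‖x • shiftOp G j‖ < 1 := by
    rw [norm_smul]
    exact (mul_le_of_le_one_right (norm_nonneg x) (norm_shiftOp_le j)).trans_lt hx
  have hu := isUnit_one_sub_of_norm_lt_one hn
  refine ⟨hu, ?_⟩
  have hs1 := summable_geometric_of_norm_lt_one hn
  have h1 : Ring.inverse (1 - x • shiftOp G j) = ∑' l : ℕ, (x • shiftOp G j) ^ l :=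
    inverse_eq_of_mul_eq_one hu (mul_neg_geom_series _ hn)
  rw [h1, ← hs1.tsum_mul_left, ← (hs1.mul_left _).tsum_mul_right]
  refine tsum_congr fun l => ?_
  rw [smul_pow, shiftOp_pow, mul_smul_comm, smul_mul_assoc]

/-- The weighted resolvent of the Laplacian at `ζ = 2 - x - x⁻¹`, `|x| < 1`. -/
theorem laplacian_resolvent [CompleteSpace G] {s : ℝ} (hs : 0 < s) {x ζ : ℂ} (hx0 : x ≠ 0)
    (hx1 : ‖x‖ < 1) (hx : x + x⁻¹ = 2 - ζ) :
    IsUnit (laplacian G - ζ • 1) ∧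
      weightOp G s hs * Ring.inverse (laplacian G - ζ • 1) * weightOp G s hs =
        (x / (1 - x ^ 2)) • weightedPowerOp G s hs x := by
  obtain ⟨hu, h1⟩ := inverse_one_sub_smul_shiftOp (G := G) hs hx1 1
  obtain ⟨hu', h1'⟩ := inverse_one_sub_smul_shiftOp (G := G) hs hx1 (-1)
  have hxs : x ^ 2 ≠ 1 := by
    intro h
    have := congrArg norm h
    rw [norm_pow, norm_one] at this
    have h2 := pow_lt_one₀ (norm_nonneg x) hx1 two_ne_zero
    linarith
  obtain ⟨hunit, hinv⟩ := pencil_inverse (𝔸 := L2Z G →L[ℂ] L2Z G) (a := shiftOp G 1)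
    (a' := shiftOp G (-1)) (by rw [shiftOp_mul, ← shiftOp_zero]; rfl)
    (by rw [shiftOp_mul, ← shiftOp_zero]; rfl) hx0 hxs hx hu hu'
  refine ⟨hunit, ?_⟩
  have h2 : Ring.inverse (laplacian G - ζ • 1) = _ := hinv
  rw [h2, mul_smul_comm, smul_mul_assoc, mul_sub, sub_mul, mul_add, add_mul, h1, h1',
    weightedPowerOp, mul_one]
  simp only [mul_one, mul_neg]

end Resolvent

/-! ### Analytic continuation of the parameter of the free resolvent -/

theorem im_add_inv (x : ℂ) : (x + x⁻¹).im = x.im * (1 - (Complex.normSq x)⁻¹) := by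
  rw [Complex.add_im, Complex.inv_im]
  ring

/-- If both `x` and `ζ = 2 - x - x⁻¹` lie in the upper half plane, then `|x| < 1`. -/
theorem norm_lt_one_of_im {x ζ : ℂ} (hx : x + x⁻¹ = 2 - ζ) (hxi : 0 < x.im) (hζ : 0 < ζ.im) :
    ‖x‖ < 1 := by
  have h1 := im_add_inv x
  rw [hx, Complex.sub_im] at h1
  have h2 : (2 : ℂ).im = 0 := rfl
  rw [h2, zero_sub] at h1
  have h3 : 1 - (Complex.normSq x)⁻¹ < 0 := by
    by_contra! h
    have := mul_nonneg hxi.le h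
    linarith
  have hx0 : x ≠ 0 := by
    rintro rfl
    exact lt_irrefl _ hxi
  have h4 : 0 < Complex.normSq x := Complex.normSq_pos.mpr hx0
  have h5 : Complex.normSq x < 1 := by
    have : 1 < (Complex.normSq x)⁻¹ := by linarith
    exact (one_lt_inv₀ h4).mp this
  rw [Complex.normSq_eq_norm_sq] at h5
  exact (sq_lt_one_iff₀ (norm_nonneg x)).mp h5

/-- A nonvanishing analytic function has an analytic square root with a prescribed value of the
root at the origin. -/
theorem exists_analyticAt_sqrt {f : ℂ → ℂ} (hf : AnalyticAt ℂ f 0) {s₀ : ℂ} (hs : s₀ ^ 2 = f 0)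
    (h0 : f 0 ≠ 0) : ∃ s : ℂ → ℂ, AnalyticAt ℂ s 0 ∧ s 0 = s₀ ∧ ∀ k, s k ^ 2 = f k := by
  refine ⟨fun k => s₀ * (f k / f 0) ^ (1 / 2 : ℂ), ?_, ?_, fun k => ?_⟩
  · refine analyticAt_const.fun_mul (AnalyticAt.cpow (hf.fun_div analyticAt_const h0)
      analyticAt_const ?_)
    rw [div_self h0]
    exact Complex.one_mem_slitPlane
  · simp only [div_self h0, Complex.one_cpow, mul_one]
  · have h1 : ((f k / f 0) ^ (1 / 2 : ℂ)) ^ 2 = f k / f 0 := by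
      rw [← Complex.cpow_nat_mul]
      norm_num
    rw [mul_pow, hs, h1, mul_div_cancel₀ _ h0]

theorem im_sq_pos {k : ℂ} (hr : 0 < k.re) (hi : 0 < k.im) : 0 < (k ^ 2).im := by
  rw [sq, Complex.mul_im]
  have := mul_pos hr hi
  linarith

/-- Away from the thresholds `0` and `4` of the Laplacian, the solution `x` of `x + x⁻¹ = 2 - ζ`
with `|x| < 1` continues analytically from the upper half plane; on the spectrum it is the solution
in the upper half plane. -/
theorem exists_analytic_root {ζ₀ : ℂ} (h0 : ζ₀ ≠ 0) (h4 : ζ₀ ≠ 4) :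
    ∃ x : ℂ → ℂ, AnalyticAt ℂ x 0 ∧ ‖x 0‖ ≤ 1 ∧ x 0 ^ 2 ≠ 1 ∧
      ∀ᶠ k in 𝓝 (0 : ℂ), x k ≠ 0 ∧ x k + (x k)⁻¹ = 2 - (ζ₀ + k ^ 2) ∧
        (0 < k.re → 0 < k.im → ‖x k‖ < 1) := by
  have hD : ζ₀ * (ζ₀ - 4) ≠ 0 := mul_ne_zero h0 (sub_ne_zero.mpr h4)
  obtain ⟨t, ht⟩ := IsAlgClosed.exists_pow_nat_eq (ζ₀ * (ζ₀ - 4)) two_pos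
  have ht0 : t ≠ 0 := by
    rintro rfl
    rw [zero_pow two_ne_zero] at ht
    exact hD ht.symm
  have hprod : ∀ s : ℂ, s ^ 2 = ζ₀ * (ζ₀ - 4) → (2 - ζ₀ + s) / 2 * ((2 - ζ₀ - s) / 2) = 1 := by
    intro s hs
    linear_combination (-1 / 4 : ℂ) * hs
  -- the two roots at `k = 0` are inverse to each other, and distinct; if both are unimodular, then
  -- neither is real, and exactly one lies in the upper half plane
  obtain ⟨s₀, hs₀, hcase⟩ : ∃ s₀ : ℂ, s₀ ^ 2 = ζ₀ * (ζ₀ - 4) ∧ (‖(2 - ζ₀ + s₀) / 2‖ < 1 ∨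
      (‖(2 - ζ₀ + s₀) / 2‖ = 1 ∧ 0 < ((2 - ζ₀ + s₀) / 2).im)) := by
    have h1 := hprod t ht
    have ht' : (-t) ^ 2 = ζ₀ * (ζ₀ - 4) := by rw [neg_sq, ht]
    have e : (2 - ζ₀ - t) / 2 = (2 - ζ₀ + -t) / 2 := by rw [sub_eq_add_neg]
    have hn := congrArg norm h1
    rw [norm_mul, norm_one, e] at hn
    rcases lt_trichotomy ‖(2 - ζ₀ + t) / 2‖ 1 with hlt | heq | hgt
    · exact ⟨t, ht, Or.inl hlt⟩
    · rw [heq, one_mul] at hn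
      rcases lt_trichotomy ((2 - ζ₀ + t) / 2).im 0 with hi | hi | hi
      · refine ⟨-t, ht', Or.inr ⟨hn, ?_⟩⟩
        rw [← e, eq_inv_of_mul_eq_one_right h1, Complex.inv_im]
        exact div_pos (by linarith) (Complex.normSq_pos.mpr (left_ne_zero_of_mul_eq_one h1))
      · exfalso
        have h2 : ((2 - ζ₀ + t) / 2) = (((2 - ζ₀ + t) / 2).re : ℂ) := by
          apply Complex.ext
          · rw [Complex.ofReal_re]
          · rw [Complex.ofReal_im, hi]
        have h3 : ((2 - ζ₀ + t) / 2).re ^ 2 = 1 := by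
          rw [h2, Complex.norm_real, Real.norm_eq_abs] at heq
          rw [← sq_abs, heq, one_pow]
        have h5 : ((2 - ζ₀ + t) / 2) ^ 2 = 1 := by
          rw [h2, ← Complex.ofReal_pow, h3, Complex.ofReal_one]
        have h6 : (2 - ζ₀ + t) / 2 = (2 - ζ₀ - t) / 2 := by
          have h7 : (2 - ζ₀ + t) / 2 ≠ 0 := left_ne_zero_of_mul_eq_one h1
          apply mul_left_cancel₀ h7
          rw [h1, ← sq, h5]
        apply ht0
        linear_combination h6
      · exact ⟨t, ht, Or.inr ⟨heq, hi⟩⟩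
    · refine ⟨-t, ht', Or.inl ?_⟩
      by_contra! hge
      nlinarith
  have han : AnalyticAt ℂ (fun k : ℂ => (ζ₀ + k ^ 2) * (ζ₀ + k ^ 2 - 4)) 0 := by fun_prop
  obtain ⟨s, hsan, hs0, hs⟩ := exists_analyticAt_sqrt han (s₀ := s₀)
    (by simp [hs₀]) (by simpa using ⟨h0, sub_ne_zero.mpr h4⟩)
  set x : ℂ → ℂ := fun k => (2 - (ζ₀ + k ^ 2) + s k) / 2 with hx
  have hxan : AnalyticAt ℂ x 0 := by
    refine AnalyticAt.fun_div (AnalyticAt.fun_add ?_ hsan) analyticAt_const two_ne_zero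
    fun_prop
  have hx0 : x 0 = (2 - ζ₀ + s₀) / 2 := by simp [hx, hs0]
  have hmul : ∀ k, x k * ((2 - (ζ₀ + k ^ 2) - s k) / 2) = 1 := by
    intro k
    rw [hx]
    linear_combination (-1 / 4 : ℂ) * hs k
  have hne : ∀ k, x k ≠ 0 := fun k => left_ne_zero_of_mul_eq_one (hmul k)
  have hinv : ∀ k, (x k)⁻¹ = (2 - (ζ₀ + k ^ 2) - s k) / 2 := fun k =>
    (eq_inv_of_mul_eq_one_right (hmul k)).symm
  have hadd : ∀ k, x k + (x k)⁻¹ = 2 - (ζ₀ + k ^ 2) := by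
    intro k
    rw [hinv, hx]
    ring
  refine ⟨x, hxan, ?_, ?_, ?_⟩
  · rw [hx0]
    rcases hcase with h | h
    · exact h.le
    · exact h.1.le
  · intro hsq
    have h1 : (x 0)⁻¹ = x 0 := inv_eq_of_mul_eq_one_right (by rw [← sq, hsq])
    rw [hinv, hx0, hs0] at h1
    simp only [ne_eq, OfNat.ofNat_ne_zero, not_false_eq_true, zero_pow, add_zero] at h1
    have h2 : s₀ = 0 := by linear_combination -h1
    rw [h2, zero_pow two_ne_zero] at hs₀
    exact hD hs₀.symm
  · rcases hcase with h | ⟨h, hi⟩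
    · have : ∀ᶠ k in 𝓝 (0 : ℂ), ‖x k‖ < 1 :=
        hxan.continuousAt.norm.eventually_lt_const (by simpa only [hx0] using h)
      filter_upwards [this] with k hk
      exact ⟨hne k, hadd k, fun _ _ => hk⟩
    · have h1 : ∀ᶠ k in 𝓝 (0 : ℂ), 0 < (x k).im :=
        (Complex.continuous_im.continuousAt.comp hxan.continuousAt).eventually_const_lt
          (by simpa [hx0] using hi)
      -- a unimodular root means that `ζ₀` lies on the spectrum `[0, 4]`, hence is real
      have h2 : ζ₀.im = 0 := by
        have h3 := im_add_inv (x 0)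
        rw [hadd, hx0, Complex.normSq_eq_norm_sq, h] at h3
        simpa using h3
      filter_upwards [h1] with k hk
      refine ⟨hne k, hadd k, fun hr hki => norm_lt_one_of_im (hadd k) hk ?_⟩
      rw [Complex.add_im, h2, zero_add]
      exact im_sq_pos hr hki

/-- At the threshold `0` of the Laplacian, the solution of `x + x⁻¹ = 2 - k²` with `|x| < 1` is
`x = e^{iθ}` with `k = 2 sin (θ / 2)`; here `s = cos (θ / 2)`. -/
theorem exists_analytic_root_threshold :
    ∃ x s : ℂ → ℂ, AnalyticAt ℂ x 0 ∧ AnalyticAt ℂ s 0 ∧ x 0 = 1 ∧ s 0 = 1 ∧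
      ∀ᶠ k in 𝓝 (0 : ℂ), x k ≠ 0 ∧ s k ≠ 0 ∧ x k + (x k)⁻¹ = 2 - k ^ 2 ∧
        (k ≠ 0 → x k / (1 - x k ^ 2) = Complex.I / (2 * k * s k)) ∧
        (0 < k.re → 0 < k.im → ‖x k‖ < 1) := by
  have han : AnalyticAt ℂ (fun k : ℂ => 1 - k ^ 2 / 4) 0 := by fun_prop
  obtain ⟨s, hsan, hs0, hs⟩ := exists_analyticAt_sqrt han (s₀ := 1) (by simp) (by simp)
  have hI : Complex.I ^ 2 = -1 := Complex.I_sq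
  have hmul : ∀ k, (s k + Complex.I * k / 2) ^ 2 * (s k - Complex.I * k / 2) ^ 2 = 1 := by
    intro k
    have h1 : (s k + Complex.I * k / 2) * (s k - Complex.I * k / 2) = 1 := by
      linear_combination hs k - k ^ 2 / 4 * hI
    rw [← mul_pow, h1, one_pow]
  have hinv : ∀ k, ((s k + Complex.I * k / 2) ^ 2)⁻¹ = (s k - Complex.I * k / 2) ^ 2 := fun k =>
    (eq_inv_of_mul_eq_one_right (hmul k)).symm
  have hadd : ∀ k, (s k + Complex.I * k / 2) ^ 2 + ((s k + Complex.I * k / 2) ^ 2)⁻¹ =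
      2 - k ^ 2 := by
    intro k
    rw [hinv]
    linear_combination 2 * hs k + k ^ 2 / 2 * hI
  have hre : ∀ᶠ k in 𝓝 (0 : ℂ), 1 / 2 < (s k).re :=
    (Complex.continuous_re.continuousAt.comp hsan.continuousAt).eventually_const_lt
      (by simp [hs0]; norm_num)
  have him : ∀ᶠ k in 𝓝 (0 : ℂ), k.im < 1 / 2 :=
    Complex.continuous_im.continuousAt.eventually_lt_const (by simp)
  refine ⟨fun k => (s k + Complex.I * k / 2) ^ 2, s, ?_, hsan, by simp [hs0], hs0, ?_⟩
  · refine AnalyticAt.fun_pow (hsan.fun_add ?_) 2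
    fun_prop
  · filter_upwards [hre, him] with k hk hki
    have hx0 : (s k + Complex.I * k / 2) ^ 2 ≠ 0 := left_ne_zero_of_mul_eq_one (hmul k)
    have hs0 : s k ≠ 0 := by
      intro h
      rw [h, Complex.zero_re] at hk
      linarith
    refine ⟨hx0, hs0, hadd k, fun hk0 => ?_, fun hr hi => ?_⟩
    · have h1 : 1 - ((s k + Complex.I * k / 2) ^ 2) ^ 2 =
          (s k + Complex.I * k / 2) ^ 2 * (-(2 * Complex.I * k * s k)) := by
        have h2 := hmul k
        linear_combination -h2
      rw [h1, div_mul_cancel_left₀ hx0, inv_eq_iff_eq_inv, inv_div, eq_div_iff Complex.I_ne_zero]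
      linear_combination (-2 * k * s k) * hI
    · have h1 := congrArg Complex.im (hs k)
      rw [sq, sq] at h1
      simp only [Complex.sub_im, Complex.one_im, Complex.mul_im, Complex.div_ofNat_im] at h1
      have hsi : (s k).im < 0 := by
        have := mul_pos hr hi
        by_contra! h
        nlinarith
      refine norm_lt_one_of_im (hadd k) ?_ (im_sq_pos hr hi)
      have h2 : (s k + Complex.I * k / 2) ^ 2 = 1 - k ^ 2 / 2 + Complex.I * (k * s k) := by
        linear_combination hs k + k ^ 2 / 4 * hI
      rw [h2, sq]
      simp only [Complex.add_im, Complex.sub_im, Complex.one_im, Complex.mul_im,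
        Complex.div_ofNat_im, Complex.I_re, Complex.I_im, Complex.mul_re]
      nlinarith [mul_pos hr hi, mul_pos hi (neg_pos.mpr hsi)]

/-! ### The spectral projections of a diagonalizable operator -/

/-- Operators that agree on the eigenvectors of a diagonalizable operator are equal. -/
theorem IsDiagonalizable.clm_ext {G : Type*} [NormedAddCommGroup G] [InnerProductSpace ℂ G]
    {M : G →L[ℂ] G} (hM : IsDiagonalizable M)
    {T T' : G →L[ℂ] G}
    (h : ∀ (μ : ℂ) (v : G), M v = μ • v → T v = T' v) : T = T' := by
  have h1 : (⊤ : Submodule ℂ G) ≤ LinearMap.eqLocus (T : G →ₗ[ℂ] G) (T' : G →ₗ[ℂ] G) := by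
    rw [← hM]
    exact iSup_le fun μ v hv => h μ v (Module.End.mem_eigenspace_iff.mp hv)
  ext v
  exact h1 (Submodule.mem_top : v ∈ ⊤)

section SpectralProjections

variable {G : Type*} [NormedAddCommGroup G] [InnerProductSpace ℂ G] [CompleteSpace G]
  [FiniteDimensional ℂ G]

/-- The contour integral defining `spectralProj M c` is the projection onto the generalized
eigenspace that commutes with `M`. -/
theorem spectralProj_spec (M : G →L[ℂ] G) (c : ℂ) :
    ∃ n : ℕ, spectralProj M c * spectralProj M c = spectralProj M c ∧
      Commute M (spectralProj M c) ∧
      LinearMap.range (spectralProj M c : G →ₗ[ℂ] G) =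
        Module.End.maxGenEigenspace (M : G →ₗ[ℂ] G) c ∧
      (M - c • 1) ^ n * spectralProj M c = 0 := by
  obtain ⟨n, P, g, hn, hPP, hMP, hr, hnil, hg, hexp⟩ := exists_resolvent_expansion M c
  have h : spectralProj M c = P := by
    have := residueAt_eq_coeff (a := fun l => (M - c • 1) ^ l * P) hg hn (hexp.mono fun z hz => hz.2)
    simpa [spectralProj] using this
  rw [h]
  exact ⟨n, hPP, hMP, hr, hnil⟩

theorem spectralProj_apply_of_eigenvector (M : G →L[ℂ] G) {c : ℂ} {v : G} (hv : M v = c • v) :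
    spectralProj M c v = v := by
  obtain ⟨n, hPP, -, hr, -⟩ := spectralProj_spec M c
  have h1 : v ∈ Module.End.maxGenEigenspace (M : G →ₗ[ℂ] G) c :=
    (Module.End.mem_maxGenEigenspace _ _ _).mpr ⟨1, by simp [hv]⟩
  rw [← hr] at h1
  obtain ⟨w, rfl⟩ := h1
  exact congrArg (fun T : G →L[ℂ] G => T w) hPP

theorem spectralProj_apply_of_eigenvector_ne (M : G →L[ℂ] G) {c μ : ℂ} (hne : μ ≠ c) {v : G}
    (hv : M v = μ • v) : spectralProj M c v = 0 := by
  obtain ⟨n, -, hc, -, hnil⟩ := spectralProj_spec M c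
  have hc' : Commute ((M - c • 1) ^ n) (spectralProj M c) :=
    (hc.sub_left ((Commute.one_left _).smul_left c)).pow_left n
  have h1 : ∀ l : ℕ, ((M - c • 1) ^ l : G →L[ℂ] G) v = (μ - c) ^ l • v := by
    intro l
    induction l with
    | zero => simp
    | succ l ih =>
      rw [pow_succ, mul_apply_eq_comp]
      have : (M - c • (1 : G →L[ℂ] G)) v = (μ - c) • v := by
        simp [hv, sub_smul]
      rw [this, map_smul, ih, smul_smul, pow_succ']
  have h2 : ((M - c • 1) ^ n * spectralProj M c) v = 0 := by rw [hnil]; rfl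
  rw [hc'.eq, mul_apply_eq_comp, h1, map_smul] at h2
  exact (smul_eq_zero.mp h2).resolve_left (pow_ne_zero _ (sub_ne_zero.mpr hne))

theorem IsDiagonalizable.mul_spectralProj {M : G →L[ℂ] G} (hM : IsDiagonalizable M) (c : ℂ) :
    M * spectralProj M c = c • spectralProj M c := by
  refine hM.clm_ext fun μ v hv => ?_
  by_cases hμ : μ = c
  · subst hμ
    simp [spectralProj_apply_of_eigenvector M hv, hv]
  · simp [spectralProj_apply_of_eigenvector_ne M hμ hv]

theorem IsDiagonalizable.sum_spectralProj {M : G →L[ℂ] G} (hM : IsDiagonalizable M) :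
    ∑ μ ∈ eigenvalueFinset (M : G →ₗ[ℂ] G), spectralProj M μ = 1 := by
  refine hM.clm_ext fun μ v hv => ?_
  by_cases hv0 : v = 0
  · simp [hv0]
  have hμ : μ ∈ eigenvalueFinset (M : G →ₗ[ℂ] G) :=
    mem_eigenvalueFinset.mpr (Module.End.hasEigenvalue_of_hasEigenvector
      (x := v) ⟨Module.End.mem_eigenspace_iff.mpr hv, hv0⟩)
  rw [sum_apply, Finset.sum_eq_single_of_mem μ hμ fun c _ hc =>
    spectralProj_apply_of_eigenvector_ne M hc.symm hv, spectralProj_apply_of_eigenvector M hv]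
  rfl

theorem IsDiagonalizable.range_spectralProj {M : G →L[ℂ] G} (hM : IsDiagonalizable M) (c : ℂ) :
    LinearMap.range (spectralProj M c : G →ₗ[ℂ] G) =
      Module.End.eigenspace (M : G →ₗ[ℂ] G) c := by
  ext v
  rw [Module.End.mem_eigenspace_iff]
  constructor
  · rintro ⟨w, rfl⟩
    exact congrArg (fun T : G →L[ℂ] G => T w) (hM.mul_spectralProj c)
  · intro hv
    exact ⟨v, spectralProj_apply_of_eigenvector M hv⟩

end SpectralProjections

/-! ### The free resolvent near a threshold -/

section FreeResolvent

variable {G : Type*} [NormedAddCommGroup G] [InnerProductSpace ℂ G]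

theorem commute_laplacian_fiberConst (T : G →L[ℂ] G) : Commute (laplacian G) (fiberConst T) :=
  ((((Commute.one_left _).smul_left _).sub_left (commute_shiftOp_fiberConst 1 T))).sub_left
    (commute_shiftOp_fiberConst (-1) T)

/-- Separation of variables: the resolvent of `Δ ⊗ I + I ⊗ M` splits along the eigenspaces
of `M`. -/
theorem freeOp_resolvent [CompleteSpace G] [FiniteDimensional ℂ G] {M : G →L[ℂ] G}
    (hM : IsDiagonalizable M) (z : ℂ)
    (hu : ∀ μ ∈ eigenvalueFinset (M : G →ₗ[ℂ] G), IsUnit (laplacian G - (z - μ) • 1)) :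
    IsUnit (freeOp M - z • 1) ∧ Ring.inverse (freeOp M - z • 1) =
      ∑ μ ∈ eigenvalueFinset (M : G →ₗ[ℂ] G),
        Ring.inverse (laplacian G - (z - μ) • 1) * fiberConst (spectralProj M μ) := by
  set S := eigenvalueFinset (M : G →ₗ[ℂ] G)
  have hfree : freeOp M = laplacian G + fiberConst M := rfl
  have hsum : ∑ μ ∈ S, fiberConst (spectralProj M μ) = (1 : L2Z G →L[ℂ] L2Z G) := by
    rw [← fiberConst_sum, hM.sum_spectralProj, fiberConst_one]
  have hcom : ∀ μ, Commute (laplacian G - (z - μ) • 1) (fiberConst (spectralProj M μ)) :=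
    fun μ => (commute_laplacian_fiberConst _).sub_left ((Commute.one_left _).smul_left _)
  have hl : ∀ μ, (freeOp M - z • 1) * fiberConst (spectralProj M μ) =
      (laplacian G - (z - μ) • 1) * fiberConst (spectralProj M μ) := by
    intro μ
    rw [hfree, sub_mul, add_mul, fiberConst_mul, hM.mul_spectralProj, fiberConst_smul, sub_mul,
      smul_mul_assoc, smul_mul_assoc, one_mul]
    module
  have hr : ∀ μ, fiberConst (spectralProj M μ) * (freeOp M - z • 1) =
      (laplacian G - (z - μ) • 1) * fiberConst (spectralProj M μ) := by
    intro μ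
    have hc : Commute (freeOp M - z • 1) (fiberConst (spectralProj M μ)) := by
      refine Commute.sub_left ?_ ((Commute.one_left _).smul_left _)
      rw [hfree]
      refine (commute_laplacian_fiberConst _).add_left ?_
      obtain ⟨n, -, h, -⟩ := spectralProj_spec M μ
      rw [Commute, SemiconjBy, fiberConst_mul, fiberConst_mul, h.eq]
    rw [← hc.eq, hl]
  have h1 : (freeOp M - z • 1) * ∑ μ ∈ S,
      Ring.inverse (laplacian G - (z - μ) • 1) * fiberConst (spectralProj M μ) = 1 := by
    rw [Finset.mul_sum]
    refine Eq.trans ?_ hsum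
    refine Finset.sum_congr rfl fun μ hμ => ?_
    have h2 : Ring.inverse (laplacian G - (z - μ) • 1) * fiberConst (spectralProj M μ) =
        fiberConst (spectralProj M μ) * Ring.inverse (laplacian G - (z - μ) • 1) := by
      obtain ⟨v, hv⟩ := hu μ hμ
      rw [← hv, Ring.inverse_unit]
      exact (Commute.units_inv_left (hv ▸ hcom μ)).eq
    rw [h2, ← mul_assoc, hl, (hcom μ).eq, mul_assoc, Ring.mul_inverse_cancel _ (hu μ hμ), mul_one]
  have h2 : (∑ μ ∈ S, Ring.inverse (laplacian G - (z - μ) • 1) *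
      fiberConst (spectralProj M μ)) * (freeOp M - z • 1) = 1 := by
    rw [Finset.sum_mul]
    refine Eq.trans ?_ hsum
    refine Finset.sum_congr rfl fun μ hμ => ?_
    rw [mul_assoc, hr, ← mul_assoc, Ring.inverse_mul_cancel _ (hu μ hμ), one_mul]
  have hU : IsUnit (freeOp M - z • 1) := ⟨⟨_, _, h1, h2⟩, rfl⟩
  exact ⟨hU, inverse_eq_of_mul_eq_one hU h1⟩

/-- Away from the thresholds of the Laplacian, the weighted resolvent continues analytically
across the cut. -/
theorem exists_laplacian_resolvent_extension [CompleteSpace G] {s : ℝ} (hs : 0 < s) {ζ₀ : ℂ}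
    (h0 : ζ₀ ≠ 0) (h4 : ζ₀ ≠ 4) :
    ∃ B : ℂ → L2Z G →L[ℂ] L2Z G, AnalyticAt ℂ B 0 ∧ ∀ᶠ k in 𝓝 (0 : ℂ), 0 < k.re → 0 < k.im →
      IsUnit (laplacian G - (ζ₀ + k ^ 2) • 1) ∧
      weightOp G s hs * Ring.inverse (laplacian G - (ζ₀ + k ^ 2) • 1) * weightOp G s hs =
        B k := by
  obtain ⟨x, hx, hx1, hx2, hev⟩ := exists_analytic_root h0 h4
  have hw : AnalyticAt ℂ (weightedPowerOp G s hs) (x 0) := analyticAt_weightedPowerOp hs <| by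
    have h1 : Real.exp (-(s / 2)) < 1 := by
      rw [← Real.exp_zero]
      exact Real.exp_lt_exp.mpr (by linarith)
    exact (mul_le_of_le_one_left (Real.exp_pos _).le hx1).trans_lt h1
  refine ⟨fun k => (x k / (1 - x k ^ 2)) • weightedPowerOp G s hs (x k), ?_, ?_⟩
  · refine AnalyticAt.fun_smul (hx.fun_div (analyticAt_const.fun_sub (hx.fun_pow 2)) ?_)
      (hw.fun_comp hx)
    exact sub_ne_zero.mpr (Ne.symm hx2)
  · filter_upwards [hev] with k hk hr hi
    exact laplacian_resolvent hs hk.1 (hk.2.2 hr hi) hk.2.1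

/-- At the lower threshold of the Laplacian, the weighted resolvent continues meromorphically
in the square root of the spectral parameter, with a simple pole. -/
theorem exists_laplacian_resolvent_extension_threshold [CompleteSpace G] {s : ℝ} (hs : 0 < s) :
    ∃ B : ℂ → L2Z G →L[ℂ] L2Z G, AnalyticAt ℂ B 0 ∧ ∀ᶠ k in 𝓝 (0 : ℂ), 0 < k.re → 0 < k.im →
      IsUnit (laplacian G - (k ^ 2) • 1) ∧
      weightOp G s hs * Ring.inverse (laplacian G - (k ^ 2) • 1) * weightOp G s hs =
        (Complex.I / 2 * k⁻¹) • weightedPowerOp G s hs 1 + B k := by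
  obtain ⟨x, t, hx, ht, hx0, ht0, hev⟩ := exists_analytic_root_threshold
  have hw : AnalyticAt ℂ (weightedPowerOp G s hs) (x 0) := analyticAt_weightedPowerOp hs <| by
    rw [hx0, norm_one, one_mul]
    rw [← Real.exp_zero]
    exact Real.exp_lt_exp.mpr (by linarith)
  -- the weighted resolvent is `k⁻¹ f(k)`, and `f 0` is the coefficient of the pole
  set f : ℂ → L2Z G →L[ℂ] L2Z G :=
    fun k => (Complex.I / 2 * (t k)⁻¹) • weightedPowerOp G s hs (x k) with hf
  have hfa : AnalyticAt ℂ f 0 :=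
    AnalyticAt.fun_smul (analyticAt_const.fun_mul (ht.fun_inv (by simp [ht0]))) (hw.fun_comp hx)
  obtain ⟨p, hp⟩ := hfa
  refine ⟨dslope f 0, hp.has_fpower_series_dslope_fslope.analyticAt, ?_⟩
  filter_upwards [hev] with k hk hr hi
  have hk0 : k ≠ 0 := by
    rintro rfl
    simp at hr
  obtain ⟨hu, he⟩ := laplacian_resolvent (G := G) hs hk.1 (hk.2.2.2.2 hr hi) hk.2.2.1
  refine ⟨hu, ?_⟩
  rw [he, hk.2.2.2.1 hk0, dslope_of_ne _ hk0, slope_def_module, hf]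
  simp only [hx0, ht0, sub_zero, smul_sub, smul_smul, inv_one, mul_one]
  rw [mul_comm k⁻¹ (Complex.I / 2), add_sub_cancel]
  congr 1
  have := hk.2.1
  field_simp

/-- The weighted free resolvent extends to a punctured neighbourhood of the threshold, with a
simple pole there. -/
theorem exists_freeOp_resolvent_extension [CompleteSpace G] [FiniteDimensional ℂ G]
    {M : G →L[ℂ] G} (hM : IsDiagonalizable M) {s : ℝ} (hs : 0 < s) {lam : ℂ}
    (hlam : Module.End.HasEigenvalue (M : G →ₗ[ℂ] G) lam) (hnd : ¬ IsDegenerate M lam) :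
    ∃ r : ℝ, 0 < r ∧ ∃ B : ℂ → L2Z G →L[ℂ] L2Z G, AnalyticOnNhd ℂ B (Metric.ball 0 r) ∧
      ∀ k ∈ Metric.ball (0 : ℂ) r, 0 < k.re → 0 < k.im →
        IsUnit (freeOp M - (lam + k ^ 2) • 1) ∧
        weightOp G s hs * Ring.inverse (freeOp M - (lam + k ^ 2) • 1) * weightOp G s hs =
          (Complex.I / 2 * k⁻¹) • (weightedPowerOp G s hs 1 * fiberConst (spectralProj M lam)) +
            B k := by
  classical
  set S := eigenvalueFinset (M : G →ₗ[ℂ] G) with hS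
  have hlS : lam ∈ S := mem_eigenvalueFinset.mpr hlam
  have key : ∀ μ ∈ S, ∃ B : ℂ → L2Z G →L[ℂ] L2Z G, AnalyticAt ℂ B 0 ∧
      ∀ᶠ k in 𝓝 (0 : ℂ), 0 < k.re → 0 < k.im →
        IsUnit (laplacian G - (lam + k ^ 2 - μ) • 1) ∧
        weightOp G s hs * Ring.inverse (laplacian G - (lam + k ^ 2 - μ) • 1) * weightOp G s hs =
          (if μ = lam then (Complex.I / 2 * k⁻¹) • weightedPowerOp G s hs 1 else 0) + B k := by
    intro μ hμ
    by_cases h : μ = lam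
    · subst h
      simpa using exists_laplacian_resolvent_extension_threshold (G := G) hs
    -- the upper thresholds `μ + 4` stay away from `lam` because `lam` is non-degenerate
    · have h4 : lam - μ ≠ 4 := fun h4 =>
        hnd ⟨μ, mem_eigenvalueFinset.mp hμ, by rw [← h4]; ring⟩
      simpa [h, sub_add_eq_add_sub] using exists_laplacian_resolvent_extension (G := G) hs
        (sub_ne_zero.mpr (Ne.symm h)) h4
  choose! B hB hev using key
  set B' : ℂ → L2Z G →L[ℂ] L2Z G :=
    fun k => ∑ μ ∈ S, B μ k * fiberConst (spectralProj M μ) with hB'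
  have hBa : AnalyticAt ℂ B' 0 :=
    Finset.analyticAt_fun_sum _ fun μ hμ => (hB μ hμ).fun_mul analyticAt_const
  have hall := (Filter.eventually_all_finset S).mpr hev
  obtain ⟨r, hr, hball⟩ := Metric.eventually_nhds_iff_ball.mp (hall.and hBa.eventually_analyticAt)
  refine ⟨r, hr, B', fun k hk => (hball k hk).2, fun k hk hre him => ?_⟩
  have h := fun μ hμ => (hball k hk).1 μ hμ hre him
  obtain ⟨hu, hinv⟩ := freeOp_resolvent hM (lam + k ^ 2) fun μ hμ => (h μ hμ).1
  refine ⟨hu, ?_⟩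
  rw [hinv, Finset.mul_sum, Finset.sum_mul]
  have h1 : ∀ μ ∈ S, weightOp G s hs * (Ring.inverse (laplacian G - (lam + k ^ 2 - μ) • 1) *
      fiberConst (spectralProj M μ)) * weightOp G s hs =
      (if μ = lam then (Complex.I / 2 * k⁻¹) •
        (weightedPowerOp G s hs 1 * fiberConst (spectralProj M lam)) else 0) +
      B μ k * fiberConst (spectralProj M μ) := by
    intro μ hμ
    rw [mul_assoc, mul_assoc, ← (commute_weightOp_fiberConst hs (spectralProj M μ)).eq,
      ← mul_assoc, ← mul_assoc, (h μ hμ).2, add_mul]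
    split_ifs with h'
    · rw [h', smul_mul_assoc]
    · rw [zero_mul]
  rw [Finset.sum_congr rfl h1, Finset.sum_add_distrib, Finset.sum_ite_eq' S lam, if_pos hlS]

end FreeResolvent

/-! ### The threshold projection -/

section ThresholdProjection

theorem summable_exp_neg_abs {a : ℝ} (ha : 0 < a) :
    Summable fun n : ℤ => Real.exp (-a * |(n : ℝ)|) := by
  have h : Summable fun n : ℕ => Real.exp (-a) ^ n :=
    summable_geometric_of_lt_one (Real.exp_pos _).le (by
      rw [← Real.exp_zero]
      exact Real.exp_lt_exp.mpr (by linarith))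
  have e : ∀ n : ℕ, Real.exp (-a) ^ n = Real.exp (-a * |(n : ℝ)|) := fun n => by
    rw [← Real.exp_nat_mul, mul_comm, Nat.abs_cast]
  simp only [e] at h
  refine Summable.of_nat_of_neg ?_ ?_
  · simpa using h
  · simpa using h

theorem summable_exp_neg_abs_sq {s : ℝ} (hs : 0 < s) :
    Summable fun n : ℤ => Real.exp (-(s / 2) * |(n : ℝ)|) ^ 2 := by
  refine (summable_exp_neg_abs hs).congr fun n => ?_
  rw [← Real.exp_nat_mul]
  congr 1
  push_cast
  ring

theorem expNorm_pos {s : ℝ} (hs : 0 < s) : 0 < expNorm s := by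
  refine Real.sqrt_pos.mpr ?_
  exact (summable_exp_neg_abs_sq hs).tsum_pos (fun n => by positivity) 0 (by positivity)

theorem weightNeg_pos {s : ℝ} (hs : 0 < s) (n : ℤ) : 0 < weightNeg s n :=
  mul_pos (inv_pos.mpr (expNorm_pos hs)) (Real.exp_pos _)

theorem weightNeg_mul_weightPos {s : ℝ} (hs : 0 < s) (n : ℤ) :
    weightNeg s n * weightPos s n = 1 := by
  have h := (expNorm_pos hs).ne'
  have h1 : Real.exp (-(s / 2) * |(n : ℝ)|) * Real.exp (s / 2 * |(n : ℝ)|) = 1 := by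
    rw [← Real.exp_add, ← Real.exp_zero]
    congr 1
    ring
  rw [weightNeg, weightPos]
  calc _ = (expNorm s)⁻¹ * expNorm s *
        (Real.exp (-(s / 2) * |(n : ℝ)|) * Real.exp (s / 2 * |(n : ℝ)|)) := by ring
    _ = 1 := by rw [h1, inv_mul_cancel₀ h, one_mul]

theorem summable_weightNeg {s : ℝ} (hs : 0 < s) : Summable (weightNeg s) :=
  (summable_exp_neg_abs (half_pos hs)).mul_left _

theorem hasSum_weightNeg_sq {s : ℝ} (hs : 0 < s) :
    HasSum (fun n : ℤ => weightNeg s n ^ 2) 1 := by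
  have h := (summable_exp_neg_abs_sq hs).hasSum.mul_left ((expNorm s)⁻¹ ^ 2)
  have h1 : expNorm s ^ 2 = ∑' n : ℤ, Real.exp (-(s / 2) * |(n : ℝ)|) ^ 2 :=
    Real.sq_sqrt (tsum_nonneg fun n => by positivity)
  rw [← h1, inv_pow, inv_mul_cancel₀ (pow_ne_zero 2 (expNorm_pos hs).ne')] at h
  simpa only [weightNeg, mul_pow, inv_pow] using h

variable {G : Type*} [NormedAddCommGroup G] [InnerProductSpace ℂ G]

theorem summable_weightNeg_smul [CompleteSpace G] {s : ℝ} (hs : 0 < s) (u : L2Z G) :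
    Summable fun m : ℤ => (weightNeg s m : ℂ) • u m := by
  refine Summable.of_norm_bounded ((summable_weightNeg hs).mul_right ‖u‖) fun m => ?_
  rw [norm_smul, Complex.norm_real, Real.norm_of_nonneg (weightNeg_nonneg s m)]
  exact mul_le_mul_of_nonneg_left (lp.norm_apply_le_norm (by norm_num) u m) (weightNeg_nonneg s m)

/-- At the threshold `x = 1` the weighted resolvent kernel `W(n) x^{|n-m|} W(m)` has rank one
on `ℓ²(ℤ)`. -/
theorem weightedPowerOp_one_apply [CompleteSpace G] {s : ℝ} (hs : 0 < s) (u : L2Z G) (n : ℤ) :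
    weightedPowerOp G s hs 1 u n =
      (weightNeg s n : ℂ) • ∑' m : ℤ, (weightNeg s m : ℂ) • u m := by
  set g : ℤ → G := fun m => (weightNeg s m : ℂ) • u m with hg
  have hgs : Summable g := summable_weightNeg_smul hs u
  have hgeo : Summable fun l : ℕ => ((expNorm s)⁻¹) ^ 2 * Real.exp (-(s / 2)) ^ l :=
    (summable_geometric_of_lt_one (Real.exp_pos _).le (by
      rw [← Real.exp_zero]
      exact Real.exp_lt_exp.mpr (by linarith))).mul_left _
  have happ : ∀ A : ℕ → L2Z G →L[ℂ] L2Z G, Summable A →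
      HasSum (fun l => A l u n) ((∑' l, A l) u n) := fun A hA =>
    (hA.hasSum.mapL (ContinuousLinearMap.apply ℂ (L2Z G) u)).mapL
      (lp.evalCLM ℂ (fun _ : ℤ => G) 2 n)
  have h1 := happ (fun l => (1 : ℂ) ^ l • (weightOp G s hs * shiftOp G l * weightOp G s hs))
    (Summable.of_norm_bounded hgeo fun l => by
      rw [one_pow, one_smul]
      exact (norm_weightOp_shiftOp_natCast_le hs l).1)
  have h2 := happ (fun l => (1 : ℂ) ^ l • (weightOp G s hs * shiftOp G (-l) * weightOp G s hs))
    (Summable.of_norm_bounded hgeo fun l => by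
      rw [one_pow, one_smul]
      exact (norm_weightOp_shiftOp_natCast_le hs l).2)
  have e : ∀ j : ℤ, (weightOp G s hs * shiftOp G j * weightOp G s hs) u n =
      (weightNeg s n : ℂ) • g (n + j) := fun j => rfl
  simp only [one_pow, one_smul, e] at h1 h2
  have h3 := HasSum.of_nat_of_neg (f := fun l : ℤ => (weightNeg s n : ℂ) • g (n + l)) h1 h2
  have h4 : HasSum (fun l : ℤ => (weightNeg s n : ℂ) • g (n + l))
      ((weightNeg s n : ℂ) • ∑' m, g m) :=
    ((Equiv.addLeft n).hasSum_iff.mpr hgs.hasSum).const_smul _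
  rw [← h3.unique h4, weightedPowerOp]
  simp only [one_pow, one_smul, add_zero]
  rfl

theorem thresholdProj_apply [CompleteSpace G] (M : G →L[ℂ] G) {s : ℝ} (hs : 0 < s) (lam : ℂ)
    (u : L2Z G) (n : ℤ) : thresholdProj M s lam u n =
      (weightNeg s n : ℂ) • spectralProj M lam (∑' m : ℤ, (weightNeg s m : ℂ) • u m) := by
  have hsum : Summable fun p : ℤ × ℤ => ‖(Complex.I / 2 * (weightNeg s p.1 : ℂ) *
      (weightNeg s p.2 : ℂ)) • spectralProj M lam‖ := by
    have h := ((summable_weightNeg hs).mul_of_nonneg (summable_weightNeg hs)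
      (weightNeg_nonneg s) (weightNeg_nonneg s)).mul_left (2⁻¹ * ‖spectralProj M lam‖)
    refine h.congr fun p => ?_
    simp only [norm_smul, norm_mul, norm_div, Complex.norm_I, Complex.norm_real,
      Real.norm_of_nonneg (weightNeg_nonneg s _), RCLike.norm_ofNat]
    ring
  have h1 : thresholdProj M s lam u n = (2 / Complex.I) • aOp s (spectralProj M lam) u n := rfl
  rw [h1, aOp, kernelOp_apply (fun n m => (Complex.I / 2 * (weightNeg s n : ℂ) *
    (weightNeg s m : ℂ)) • spectralProj M lam) hsum u n, (spectralProj M lam).map_tsum (summable_weightNeg_smul hs u)]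
  have h2 : ∀ m : ℤ, ((Complex.I / 2 * (weightNeg s n : ℂ) * (weightNeg s m : ℂ)) •
      spectralProj M lam) (u m) = (Complex.I / 2 * (weightNeg s n : ℂ)) •
      spectralProj M lam ((weightNeg s m : ℂ) • u m) := fun m => by
    rw [map_smul, smul_smul]
    rfl
  have h3 : Summable fun m : ℤ => spectralProj M lam ((weightNeg s m : ℂ) • u m) :=
    (summable_weightNeg_smul hs u).mapL (spectralProj M lam)
  rw [tsum_congr h2, h3.tsum_const_smul, smul_smul]
  congr 1
  have := Complex.I_ne_zero
  field_simp

/-- The threshold projection is the value at `x = 1` of the weighted kernel, on the range of the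
spectral projection. -/
theorem thresholdProj_eq [CompleteSpace G] (M : G →L[ℂ] G) {s : ℝ} (hs : 0 < s) (lam : ℂ) :
    thresholdProj M s lam = weightedPowerOp G s hs 1 * fiberConst (spectralProj M lam) := by
  ext u n
  have h : (weightedPowerOp G s hs 1 * fiberConst (spectralProj M lam)) u n =
    weightedPowerOp G s hs 1 (fiberConst (spectralProj M lam) u) n := rfl
  rw [h, thresholdProj_apply M hs, weightedPowerOp_one_apply,
    (spectralProj M lam).map_tsum (summable_weightNeg_smul hs u)]
  congr 1
  refine tsum_congr fun m => ?_
  rw [map_smul, fiberConst_apply]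

theorem memℓp_weightNeg_smul {s : ℝ} (hs : 0 < s) (v : G) :
    Memℓp (fun n : ℤ => (weightNeg s n : ℂ) • v) 2 := by
  refine memℓp_gen ?_
  refine ((hasSum_weightNeg_sq hs).summable.mul_right (‖v‖ ^ 2)).congr fun n => ?_
  rw [norm_smul, Complex.norm_real, Real.norm_of_nonneg (weightNeg_nonneg s n)]
  norm_num
  ring

/-- The embedding `v ↦ W_{-s} ⊗ v`; it is isometric because the weight is normalized in `ℓ²(ℤ)`. -/
noncomputable def weightTensor {s : ℝ} (hs : 0 < s) : G →ₗ[ℂ] L2Z G where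
  toFun v := ⟨fun n : ℤ => (weightNeg s n : ℂ) • v, memℓp_weightNeg_smul hs v⟩
  map_add' v w := by
    ext n
    exact smul_add _ _ _
  map_smul' c v := by
    ext n
    exact smul_comm _ _ _

theorem weightTensor_apply {s : ℝ} (hs : 0 < s) (v : G) (n : ℤ) :
    weightTensor hs v n = (weightNeg s n : ℂ) • v := rfl

theorem weightTensor_injective {s : ℝ} (hs : 0 < s) :
    Function.Injective (weightTensor (G := G) hs) := by
  intro v w h
  have h0 := congrArg (fun u : L2Z G => u 0) h
  simp only [weightTensor_apply] at h0
  exact smul_right_injective _ (Complex.ofReal_ne_zero.mpr (weightNeg_pos hs 0).ne') h0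

theorem tsum_weightNeg_smul_weightTensor {s : ℝ} (hs : 0 < s) (v : G) :
    ∑' m : ℤ, (weightNeg s m : ℂ) • weightTensor hs v m = v := by
  have h : HasSum (fun m : ℤ => ((weightNeg s m ^ 2 : ℝ) : ℂ) • v) (((1 : ℝ) : ℂ) • v) :=
    (Complex.hasSum_ofReal.mpr (hasSum_weightNeg_sq hs)).smul_const v
  rw [Complex.ofReal_one, one_smul] at h
  refine (tsum_congr fun m => ?_).trans h.tsum_eq
  rw [weightTensor_apply, smul_smul, sq, Complex.ofReal_mul]

theorem thresholdProj_eq_weightTensor [CompleteSpace G] (M : G →L[ℂ] G) {s : ℝ} (hs : 0 < s)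
    (lam : ℂ) (u : L2Z G) : thresholdProj M s lam u =
      weightTensor hs (spectralProj M lam (∑' m : ℤ, (weightNeg s m : ℂ) • u m)) := by
  ext n
  rw [thresholdProj_apply M hs, weightTensor_apply]

theorem thresholdProj_weightTensor [CompleteSpace G] (M : G →L[ℂ] G) {s : ℝ} (hs : 0 < s)
    (lam : ℂ) (v : G) :
    thresholdProj M s lam (weightTensor hs v) = weightTensor hs (spectralProj M lam v) := by
  rw [thresholdProj_eq_weightTensor M hs, tsum_weightNeg_smul_weightTensor]

theorem thresholdProj_mul_self [CompleteSpace G] [FiniteDimensional ℂ G] (M : G →L[ℂ] G) {s : ℝ}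
    (hs : 0 < s) (lam : ℂ) :
    thresholdProj M s lam * thresholdProj M s lam = thresholdProj M s lam := by
  obtain ⟨-, h, -⟩ := spectralProj_spec M lam
  refine ContinuousLinearMap.ext fun u => ?_
  rw [mul_apply_eq_comp, thresholdProj_eq_weightTensor M hs lam u,
    thresholdProj_weightTensor]
  exact congrArg (fun T : G →L[ℂ] G => weightTensor hs (T _)) h

theorem range_thresholdProj [CompleteSpace G] (M : G →L[ℂ] G) {s : ℝ} (hs : 0 < s) (lam : ℂ) :
    LinearMap.range (thresholdProj M s lam : L2Z G →ₗ[ℂ] L2Z G) =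
      (LinearMap.range (spectralProj M lam : G →ₗ[ℂ] G)).map (weightTensor hs) := by
  refine le_antisymm ?_ ?_
  · rintro _ ⟨u, rfl⟩
    exact ⟨_, ⟨_, rfl⟩, (thresholdProj_eq_weightTensor M hs lam u).symm⟩
  · rintro _ ⟨_, ⟨v, rfl⟩, rfl⟩
    exact ⟨weightTensor hs v, thresholdProj_weightTensor M hs lam v⟩

theorem finiteDimensional_range_thresholdProj [CompleteSpace G] [FiniteDimensional ℂ G]
    (M : G →L[ℂ] G) {s : ℝ} (hs : 0 < s) (lam : ℂ) :
    FiniteDimensional ℂ (LinearMap.range (thresholdProj M s lam : L2Z G →ₗ[ℂ] L2Z G)) := by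
  rw [range_thresholdProj M hs]
  infer_instance

theorem finrank_range_thresholdProj [CompleteSpace G] [FiniteDimensional ℂ G] {M : G →L[ℂ] G}
    (hM : IsDiagonalizable M) {s : ℝ} (hs : 0 < s) (lam : ℂ) :
    Module.finrank ℂ (LinearMap.range (thresholdProj M s lam : L2Z G →ₗ[ℂ] L2Z G)) =
      Module.finrank ℂ (Module.End.eigenspace (M : G →ₗ[ℂ] G) lam) := by
  rw [range_thresholdProj M hs, hM.range_spectralProj]
  exact (Submodule.equivMapOfInjective _ (weightTensor_injective hs) _).finrank_eq.symm

/-- The factorization `V = W_{-s} V_s W_{-s}`. -/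
theorem kernelOp_eq_weightOp_mul [CompleteSpace G] {V : ℤ → ℤ → G →L[ℂ] G} {s : ℝ} (hs : 0 < s)
    (hV : ∃ C : ℝ, 0 < C ∧ ∀ n m : ℤ,
      ‖V n m‖ ≤ C * Real.exp (-s * (|(n : ℝ)| + |(m : ℝ)|))) :
    kernelOp V = weightOp G s hs * weightedPotential V s * weightOp G s hs := by
  obtain ⟨C, hC, hV⟩ := hV
  have hprod : ∀ a : ℝ, 0 < a → Summable fun p : ℤ × ℤ =>
      Real.exp (-a * |(p.1 : ℝ)|) * Real.exp (-a * |(p.2 : ℝ)|) := fun a ha =>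
    (summable_exp_neg_abs ha).mul_of_nonneg (summable_exp_neg_abs ha)
      (fun _ => (Real.exp_pos _).le) fun _ => (Real.exp_pos _).le
  have hsum : Summable fun p : ℤ × ℤ => ‖V p.1 p.2‖ := by
    refine Summable.of_nonneg_of_le (fun _ => norm_nonneg _) (fun p => hV p.1 p.2)
      (((hprod s hs).mul_left C).congr fun p => ?_)
    rw [← Real.exp_add]
    congr 2
    ring
  have hpos : ∀ n, 0 ≤ weightPos s n := fun n => by
    have := weightNeg_mul_weightPos hs n
    have := weightNeg_pos hs n
    by_contra! h
    nlinarith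
  have hsum' : Summable fun p : ℤ × ℤ =>
      ‖((weightPos s p.1 * weightPos s p.2 : ℝ) : ℂ) • V p.1 p.2‖ := by
    refine Summable.of_nonneg_of_le (fun _ => norm_nonneg _) (fun p => ?_)
      ((hprod (s / 2) (half_pos hs)).mul_left (expNorm s ^ 2 * C))
    rw [norm_smul, Complex.norm_real, Real.norm_of_nonneg (mul_nonneg (hpos _) (hpos _))]
    refine (mul_le_mul_of_nonneg_left (hV p.1 p.2) (mul_nonneg (hpos _) (hpos _))).trans_eq ?_
    rw [weightPos, weightPos]
    have h1 : Real.exp (-s * (|(p.1 : ℝ)| + |(p.2 : ℝ)|)) =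
        Real.exp (-(s / 2) * |(p.1 : ℝ)|) * Real.exp (-(s / 2) * |(p.2 : ℝ)|) *
          (Real.exp (-(s / 2) * |(p.1 : ℝ)|) * Real.exp (-(s / 2) * |(p.2 : ℝ)|)) := by
      rw [← Real.exp_add, ← Real.exp_add]
      congr 1
      ring
    have h2 : ∀ t : ℝ, Real.exp (s / 2 * t) * Real.exp (-(s / 2) * t) = 1 := fun t => by
      rw [← Real.exp_add, ← Real.exp_zero]
      congr 1
      ring
    rw [h1]
    linear_combination (expNorm s ^ 2 * C * Real.exp (-(s / 2) * |(p.1 : ℝ)|) *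
      Real.exp (-(s / 2) * |(p.2 : ℝ)|)) * (h2 |(p.1 : ℝ)| * (Real.exp (s / 2 * |(p.2 : ℝ)|) *
        Real.exp (-(s / 2) * |(p.2 : ℝ)|)) + h2 |(p.2 : ℝ)|)
  ext u n
  have h : (weightOp G s hs * weightedPotential V s * weightOp G s hs) u n =
    (weightNeg s n : ℂ) • weightedPotential V s (weightOp G s hs u) n := rfl
  have hsm : Summable fun m : ℤ => ((weightPos s n * weightPos s m : ℝ) : ℂ) •
      V n m (weightOp G s hs u m) := by
    have h1 := (hsum'.comp_injective (i := fun m : ℤ => (n, m))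
      fun a b h => (Prod.mk.inj h).2).mul_right ‖weightOp G s hs u‖
    refine Summable.of_norm_bounded h1 fun m => ?_
    refine ((((weightPos s n * weightPos s m : ℝ) : ℂ) • V n m).le_opNorm _).trans ?_
    exact mul_le_mul_of_nonneg_left (lp.norm_apply_le_norm (by norm_num) _ m) (norm_nonneg _)
  rw [h, kernelOp_apply V hsum, weightedPotential, kernelOp_apply
    (fun n m => ((weightPos s n * weightPos s m : ℝ) : ℂ) • V n m) hsum']
  have h3 : ∑' m : ℤ, (((weightPos s n * weightPos s m : ℝ) : ℂ) • V n m)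
      (weightOp G s hs u m) = ∑' m : ℤ, ((weightPos s n * weightPos s m : ℝ) : ℂ) •
      V n m (weightOp G s hs u m) := rfl
  rw [h3, ← hsm.tsum_const_smul]
  refine tsum_congr fun m => ?_
  rw [weightOp_apply, map_smul, smul_smul, smul_smul, ← Complex.ofReal_mul, ← Complex.ofReal_mul]
  have h4 : weightNeg s n * (weightPos s n * weightPos s m) * weightNeg s m = 1 := by
    linear_combination weightNeg_mul_weightPos hs n * (weightNeg s m * weightPos s m) +
      weightNeg_mul_weightPos hs m
  rw [← mul_assoc] at h4 ⊢
  rw [h4, Complex.ofReal_one, one_smul]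

end ThresholdProjection

/-! ### Poles of the extended resolvent -/

section Poles

/-- The second resolvent identity in sandwiched form: with `R₀ = w a⁻¹ w` and
`R = w (a + ω w v w)⁻¹ w`, the element `1 + ω R₀ v` is invertible, and it maps `R` to `R₀`. -/
theorem one_add_sandwich {𝔸 : Type*} [Ring 𝔸] [Algebra ℂ 𝔸] {a w v : 𝔸} {ω : ℂ} (ha : IsUnit a)
    (hb : IsUnit (a + ω • (w * v * w))) :
    IsUnit (1 + ω • (w * Ring.inverse a * w * v)) ∧
      (1 + ω • (w * Ring.inverse a * w * v)) * (w * Ring.inverse (a + ω • (w * v * w)) * w) =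
        w * Ring.inverse a * w := by
  set b := a + ω • (w * v * w) with hbdef
  set R₀ := w * Ring.inverse a * w with hR₀
  set R := w * Ring.inverse b * w with hR
  have hba : b - a = ω • (w * v * w) := by rw [hbdef, add_sub_cancel_left]
  have e1 : Ring.inverse a - Ring.inverse b = ω • (Ring.inverse a * (w * v * w) * Ring.inverse b) :=
    calc _ = Ring.inverse a * (b - a) * Ring.inverse b := by
          rw [mul_sub, sub_mul, Ring.inverse_mul_cancel _ ha, one_mul, mul_assoc,
            Ring.mul_inverse_cancel _ hb, mul_one]
      _ = _ := by rw [hba, mul_smul_comm, smul_mul_assoc]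
  have e2 : Ring.inverse a - Ring.inverse b = ω • (Ring.inverse b * (w * v * w) * Ring.inverse a) :=
    calc _ = Ring.inverse b * (b - a) * Ring.inverse a := by
          rw [mul_sub, sub_mul, Ring.inverse_mul_cancel _ hb, one_mul, mul_assoc,
            Ring.mul_inverse_cancel _ ha, mul_one]
      _ = _ := by rw [hba, mul_smul_comm, smul_mul_assoc]
  have h1 : R₀ - R = ω • (R₀ * v * R) := by
    have := congrArg (fun t => w * t * w) e1
    simpa only [mul_sub, sub_mul, mul_smul_comm, smul_mul_assoc, mul_assoc, hR₀, hR] using this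
  have h2 : R₀ - R = ω • (R * v * R₀) := by
    have := congrArg (fun t => w * t * w) e2
    simpa only [mul_sub, sub_mul, mul_smul_comm, smul_mul_assoc, mul_assoc, hR₀, hR] using this
  have h3 : (1 + ω • (R₀ * v)) * (1 - ω • (R * v)) = 1 := by
    have : (1 + ω • (R₀ * v)) * (1 - ω • (R * v)) =
        1 + ω • ((R₀ - R - ω • (R₀ * v * R)) * v) := by
      simp only [mul_sub, add_mul, sub_mul, mul_smul_comm, smul_mul_assoc, mul_assoc, one_mul,
        mul_one]
      module
    rw [this, ← h1, sub_self, zero_mul, smul_zero, add_zero]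
  have h4 : (1 - ω • (R * v)) * (1 + ω • (R₀ * v)) = 1 := by
    have : (1 - ω • (R * v)) * (1 + ω • (R₀ * v)) =
        1 + ω • ((R₀ - R - ω • (R * v * R₀)) * v) := by
      simp only [mul_add, sub_mul, mul_smul_comm, smul_mul_assoc, mul_assoc, one_mul,
        mul_one]
      module
    rw [this, ← h2, sub_self, zero_mul, smul_zero, add_zero]
  refine ⟨⟨⟨_, _, h3, h4⟩, rfl⟩, ?_⟩
  rw [add_mul, one_mul, smul_mul_assoc, ← h1]
  abel

theorem algMult_smul {F : Type*} [NormedAddCommGroup F] [NormedSpace ℂ F] (X : F →L[ℂ] F) {c : ℂ}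
    (hc : c ≠ 0) (x : ℂ) : algMult ((c • X : F →L[ℂ] F) : F →ₗ[ℂ] F) (c * x) =
      algMult (X : F →ₗ[ℂ] F) x := by
  have h : Module.End.maxGenEigenspace ((c • X : F →L[ℂ] F) : F →ₗ[ℂ] F) (c * x) =
      Module.End.maxGenEigenspace (X : F →ₗ[ℂ] F) x := by
    ext v
    have e : ((c • X : F →L[ℂ] F) : F →ₗ[ℂ] F) - (c * x) • (1 : Module.End ℂ F) =
        c • ((X : F →ₗ[ℂ] F) - x • (1 : Module.End ℂ F)) := by
      rw [smul_sub, smul_smul]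
      rfl
    rw [Module.End.mem_maxGenEigenspace, Module.End.mem_maxGenEigenspace, e]
    refine exists_congr fun k => ?_
    rw [smul_pow, LinearMap.smul_apply, smul_eq_zero, or_iff_right (pow_ne_zero k hc)]
  rw [algMult, h]

/-- If `T` differs from `U (k - X)⁻¹ Y` by an analytic function, with `U` injective and `Y`
surjective, then the poles of `T` are the eigenvalues of `X`, and the rank of the residue is the
algebraic multiplicity. -/
theorem pole_structure {F H : Type*} [NormedAddCommGroup F] [NormedSpace ℂ F]
    [FiniteDimensional ℂ F] [NormedAddCommGroup H] [NormedSpace ℂ H] [CompleteSpace H]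
    {X : F →L[ℂ] F} {U : F →L[ℂ] H} {Y : H →L[ℂ] F} (hU : Function.Injective U)
    (hY : Function.Surjective Y) {Q T : ℂ → H →L[ℂ] H} {k₀ : ℂ} (hQ : AnalyticAt ℂ Q k₀)
    (hT : T =ᶠ[𝓝[≠] k₀]
      fun k => Q k + (Complex.I / 2) • (U ∘L Ring.inverse (k • 1 - X) ∘L Y)) :
    MeromorphicAt T k₀ ∧
      (meromorphicOrderAt T k₀ < 0 ↔ Module.End.HasEigenvalue (X : F →ₗ[ℂ] F) k₀) ∧
      resMult T k₀ = algMult (X : F →ₗ[ℂ] F) k₀ := by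
  obtain ⟨n, P, g, hn, -, -, hran, -, hg, hexp⟩ := exists_resolvent_expansion X k₀
  set L : (F →L[ℂ] F) → (H →L[ℂ] H) := fun A => (Complex.I / 2) • (U ∘L A ∘L Y) with hL
  have hL_add : ∀ A A', L (A + A') = L A + L A' := fun A A' => by
    simp only [hL, ContinuousLinearMap.add_comp, ContinuousLinearMap.comp_add, smul_add]
  have hL_smul : ∀ (c : ℂ) A, L (c • A) = c • L A := fun c A => by
    simp only [hL, ContinuousLinearMap.smul_comp, ContinuousLinearMap.comp_smul]
    rw [smul_comm]
  set Lm : (F →L[ℂ] F) →ₗ[ℂ] (H →L[ℂ] H) := ⟨⟨L, hL_add⟩, hL_smul⟩ with hLm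
  set q : ℂ → H →L[ℂ] H := fun k => Q k + L (g k) with hq
  set a : ℕ → H →L[ℂ] H := fun l => L ((X - k₀ • 1) ^ l * P) with ha
  have hqan : AnalyticAt ℂ q k₀ := hQ.fun_add
    (analyticAt_const.fun_smul (analyticAt_clm_comp analyticAt_const
      (analyticAt_clm_comp hg analyticAt_const)))
  have hTq : ∀ᶠ k in 𝓝[≠] k₀,
      T k = q k + ∑ l ∈ Finset.range n, ((k - k₀)⁻¹) ^ (l + 1) • a l := by
    filter_upwards [hT, hexp] with k hk hk'
    have h1 : Lm (∑ l ∈ Finset.range n, ((k - k₀)⁻¹) ^ (l + 1) • ((X - k₀ • 1) ^ l * P)) =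
        ∑ l ∈ Finset.range n, ((k - k₀)⁻¹) ^ (l + 1) • a l := by
      rw [map_sum]
      exact Finset.sum_congr rfl fun l _ => hL_smul _ _
    rw [hk, hq, ← h1, add_assoc]
    have h2 : (Complex.I / 2) • (U ∘L Ring.inverse (k • 1 - X) ∘L Y) =
      L (Ring.inverse (k • 1 - X)) := rfl
    rw [h2, hk'.2, hL_add]
    rfl
  have hmer : MeromorphicAt T k₀ := by
    refine MeromorphicAt.congr (f := fun k => q k +
      ∑ l ∈ Finset.range n, ((k - k₀)⁻¹) ^ (l + 1) • a l) ?_ ?_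
    · refine hqan.meromorphicAt.fun_add (MeromorphicAt.fun_sum fun l _ => ?_)
      refine MeromorphicAt.fun_smul ?_ analyticAt_const.meromorphicAt
      have h1 : AnalyticAt ℂ (fun k : ℂ => k - k₀) k₀ := by fun_prop
      exact (h1.meromorphicAt.fun_inv).fun_pow (l + 1)
    · filter_upwards [hTq] with k hk using hk.symm
  have hres : residueAt T k₀ = a 0 := residueAt_eq_coeff hqan hn hTq
  have hrank : resMult T k₀ = algMult (X : F →ₗ[ℂ] F) k₀ := by
    have hc : Complex.I / 2 ≠ 0 := div_ne_zero Complex.I_ne_zero two_ne_zero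
    have h1 : LinearMap.range (a 0).toLinearMap =
        (Module.End.maxGenEigenspace (X : F →ₗ[ℂ] F) k₀).map
          (((Complex.I / 2) • U : F →L[ℂ] H) : F →ₗ[ℂ] H) := by
      rw [← hran]
      ext h
      simp only [ha, hL, pow_zero, one_mul, LinearMap.mem_range, Submodule.mem_map]
      constructor
      · rintro ⟨u, rfl⟩
        exact ⟨P (Y u), ⟨Y u, rfl⟩, rfl⟩
      · rintro ⟨_, ⟨y, rfl⟩, rfl⟩
        obtain ⟨u, rfl⟩ := hY y
        exact ⟨u, rfl⟩
    have hinj : Function.Injective (((Complex.I / 2) • U : F →L[ℂ] H) : F →ₗ[ℂ] H) := by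
      intro x y hxy
      exact hU (smul_right_injective _ hc hxy)
    rw [resMult, hres, LinearMap.rank, h1, ← Module.finrank_eq_rank, Cardinal.toENat_nat,
      ← (Submodule.equivMapOfInjective _ hinj _).finrank_eq]
  refine ⟨hmer, ?_, hrank⟩
  constructor
  · intro hneg
    by_contra hne
    have h0 : Module.End.maxGenEigenspace (X : F →ₗ[ℂ] F) k₀ = ⊥ := by
      by_contra h
      exact hne (hasEigenvalue_iff_maxGenEigenspace_ne_bot.mpr h)
    have hP : P = 0 := by
      rw [h0, LinearMap.range_eq_bot] at hran
      exact ContinuousLinearMap.coe_injective hran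
    refine absurd hneg (not_lt.mpr (hmer.meromorphicOrderAt_nonneg_iff.mpr ⟨q, hqan, ?_⟩))
    filter_upwards [hTq] with k hk
    rw [hk, Finset.sum_eq_zero, add_zero]
    intro l _
    simp [ha, hL, hP]
  · intro hev
    by_contra hneg
    obtain ⟨f, hf, hTf⟩ := hmer.meromorphicOrderAt_nonneg_iff.mp (not_lt.mp hneg)
    have h1 : residueAt T k₀ = (0 : H →L[ℂ] H) :=
      residueAt_eq_coeff (a := fun _ => 0) hf one_pos (hTf.mono fun z hz => by simpa using hz)
    rw [resMult, h1] at hrank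
    have h2 : LinearMap.rank (0 : H →ₗ[ℂ] H) = 0 := LinearMap.rank_zero
    have h3 := algMult_pos_iff.mpr hev
    rw [ContinuousLinearMap.toLinearMap_zero, h2, map_zero] at hrank
    have h4 : algMult (X : F →ₗ[ℂ] F) k₀ = 0 := by exact_mod_cast hrank.symm
    omega

/-- Two meromorphic functions on a connected set that agree near one of its points agree
near every one of them. -/
theorem eventuallyEq_of_meromorphicOn {E : Type*} [NormedAddCommGroup E] [NormedSpace ℂ E]
    {f g : ℂ → E} {S : Set ℂ} (hf : MeromorphicOn f S) (hg : MeromorphicOn g S)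
    (hS : IsConnected S) {z₀ : ℂ} (hz₀ : z₀ ∈ S) (h : f =ᶠ[𝓝 z₀] g) {z : ℂ} (hz : z ∈ S) :
    f =ᶠ[𝓝[≠] z] g := by
  have hd : MeromorphicOn (f - g) S := hf.sub hg
  have h0 : meromorphicOrderAt (f - g) z₀ = ⊤ := by
    rw [meromorphicOrderAt_eq_top_iff]
    filter_upwards [h.filter_mono nhdsWithin_le_nhds] with k hk
    exact sub_eq_zero.mpr hk
  have h1 : meromorphicOrderAt (f - g) z = ⊤ := by
    by_contra hne
    exact (hd.exists_meromorphicOrderAt_ne_top_iff_forall_mem hS).mp ⟨z, hz, hne⟩ z₀ hz₀ h0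
  rw [meromorphicOrderAt_eq_top_iff] at h1
  filter_upwards [h1] with k hk
  exact sub_eq_zero.mp hk

end Poles

/-! ### Clusters of resonances -/

section Clusters

/-- The map `x ↦ -(iω/2) x` carries the disc of radius `C |ω|^(1/m)` around `α` onto the disc of
radius `(C/2) |ω|^(1+1/m)` around `-(iω/2) α`, so the clusters of resonances are the images of the
clusters of eigenvalues of `X`. -/
theorem cluster_eq_image {F H : Type*} [NormedAddCommGroup F] [NormedSpace ℂ F]
    [FiniteDimensional ℂ F] [NormedAddCommGroup H] [NormedSpace ℂ H] {X : F →L[ℂ] F}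
    {R : ℂ → H} {r C : ℝ} {ω : ℂ} (hω : 0 < ‖ω‖)
    (hres : resonances r R = (fun x => -(Complex.I / 2) * ω * x) ''
      (eigenvalueFinset (X : F →ₗ[ℂ] F) : Set ℂ)) (α : ℂ) (m : ℕ) :
    cluster r R (C / 2) ω α m = (fun x => -(Complex.I / 2) * ω * x) ''
      ({x ∈ eigenvalueFinset (X : F →ₗ[ℂ] F) | ‖x - α‖ ≤ C * ‖ω‖ ^ (1 / (m : ℝ))} :
        Finset ℂ) := by
  have key : ∀ x : ℂ, ‖-(Complex.I / 2) * ω * x - -(Complex.I / 2) * α * ω‖ ≤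
      C / 2 * ‖ω‖ ^ (1 + 1 / (m : ℝ)) ↔ ‖x - α‖ ≤ C * ‖ω‖ ^ (1 / (m : ℝ)) := by
    intro x
    have h1 : -(Complex.I / 2) * ω * x - -(Complex.I / 2) * α * ω =
        -(Complex.I / 2) * ω * (x - α) := by ring
    have h2 : ‖-(Complex.I / 2) * ω‖ = ‖ω‖ / 2 := by
      rw [norm_mul, norm_neg, norm_div, Complex.norm_I, Complex.norm_ofNat]
      ring
    rw [h1, norm_mul, h2, Real.rpow_add hω, Real.rpow_one,
      show C / 2 * (‖ω‖ * ‖ω‖ ^ (1 / (m : ℝ))) = ‖ω‖ / 2 * (C * ‖ω‖ ^ (1 / (m : ℝ))) by ring]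
    exact mul_le_mul_iff_right₀ (half_pos hω)
  ext k
  rw [cluster, Set.mem_ofPred_eq, hres]
  constructor
  · rintro ⟨⟨x, hx, rfl⟩, h⟩
    exact ⟨x, Finset.mem_coe.mpr (Finset.mem_filter.mpr ⟨Finset.mem_coe.mp hx, (key x).mp h⟩), rfl⟩
  · rintro ⟨x, hx, rfl⟩
    have hx' := Finset.mem_filter.mp (Finset.mem_coe.mp hx)
    exact ⟨⟨x, Finset.mem_coe.mpr hx'.1, rfl⟩, (key x).mpr hx'.2⟩

theorem injective_const_mul {ω : ℂ} (hω : 0 < ‖ω‖) :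
    Function.Injective fun x : ℂ => -(Complex.I / 2) * ω * x := by
  refine mul_right_injective₀ (mul_ne_zero (neg_ne_zero.mpr ?_) (norm_pos_iff.mp hω))
  exact div_ne_zero Complex.I_ne_zero two_ne_zero

theorem finsum_resMult_image {F H : Type*} [NormedAddCommGroup F] [NormedSpace ℂ F]
    [NormedAddCommGroup H] [NormedSpace ℂ H] {X : F →L[ℂ] F}
    {R : ℂ → H →L[ℂ] H} {ω : ℂ} (hω : 0 < ‖ω‖) (s : Finset ℂ)
    (hmult : ∀ x ∈ s, resMult R (-(Complex.I / 2) * ω * x) = algMult (X : F →ₗ[ℂ] F) x) :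
    ∑ᶠ k ∈ (fun x => -(Complex.I / 2) * ω * x) '' (s : Set ℂ), resMult R k =
      (∑ x ∈ s, algMult (X : F →ₗ[ℂ] F) x : ℕ) := by
  rw [finsum_mem_image (injective_const_mul hω).injOn, finsum_mem_coe_finset, Nat.cast_sum]
  exact Finset.sum_congr rfl hmult

end Clusters

/-- The weighted resolvent has, for every small coupling constant, a meromorphic extension, and the
poles of any such extension are the rescaled eigenvalues of a perturbation of the effective
operator. The effective operator is obtained as a continuous operator on the finite-dimensional
space `Ran Π`. -/
theorem exists_effective_operator {G : Type*} [NormedAddCommGroup G] [InnerProductSpace ℂ G]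
    [CompleteSpace G] [FiniteDimensional ℂ G]
    {M : G →L[ℂ] G} (hM : IsDiagonalizable M)
    {V : ℤ → ℤ → G →L[ℂ] G} {ρ : ℝ} (hρ : 0 < ρ)
    (hV : ∃ C : ℝ, 0 < C ∧ ∀ n m : ℤ,
      ‖V n m‖ ≤ C * Real.exp (-ρ * (|(n : ℝ)| + |(m : ℝ)|)))
    {lam : ℂ} (hlam : Module.End.HasEigenvalue (M : G →ₗ[ℂ] G) lam)
    (hnd : ¬ IsDegenerate M lam) :
    ∃ E : LinearMap.range (thresholdProj M ρ lam : L2Z G →ₗ[ℂ] L2Z G) →L[ℂ]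
        LinearMap.range (thresholdProj M ρ lam : L2Z G →ₗ[ℂ] L2Z G),
      E.toLinearMap = effOpRan M V ρ lam ∧ ∃ r C : ℝ, 0 < r ∧
      ∀ᶠ ω in 𝓝 (0 : ℂ), 0 < ‖ω‖ →
        ∃ X : LinearMap.range (thresholdProj M ρ lam : L2Z G →ₗ[ℂ] L2Z G) →L[ℂ]
          LinearMap.range (thresholdProj M ρ lam : L2Z G →ₗ[ℂ] L2Z G),
          ‖X - E‖ ≤ C * ‖ω‖ ∧
          (∃ R, IsResolventExtension M V ρ hρ lam ω r R) ∧
          ∀ R, IsResolventExtension M V ρ hρ lam ω r R → ∀ x : ℂ,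
            -(Complex.I / 2) * ω * x ∈ Metric.ball (0 : ℂ) r →
            (meromorphicOrderAt R (-(Complex.I / 2) * ω * x) < 0 ↔
              Module.End.HasEigenvalue X.toLinearMap x) ∧
            resMult R (-(Complex.I / 2) * ω * x) = algMult X.toLinearMap x := by
  set P := thresholdProj M ρ lam with hP
  set F := LinearMap.range (P : L2Z G →ₗ[ℂ] L2Z G) with hF
  have hfin : FiniteDimensional ℂ F := finiteDimensional_range_thresholdProj M hρ lam
  have hPP : P * P = P := thresholdProj_mul_self M hρ lam
  set ι : F →L[ℂ] L2Z G := F.subtypeL with hι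
  set p : L2Z G →L[ℂ] F := P.codRestrict F (fun u => ⟨u, rfl⟩) with hp
  have hfix : ∀ x : F, P x = x := by
    rintro ⟨_, u, rfl⟩
    exact congrArg (fun T : L2Z G →L[ℂ] L2Z G => T u) hPP
  have hpι : p ∘L ι = 1 := by
    refine ContinuousLinearMap.ext fun x => Subtype.ext ?_
    exact hfix x
  have hιp : ι ∘L p = P := rfl
  set Vr := weightedPotential V ρ with hVr
  set W := weightOp G ρ hρ with hW
  have hVW : kernelOp V = W * Vr * W := kernelOp_eq_weightOp_mul hρ hV
  obtain ⟨r₀, hr₀, B, hB, hfree⟩ := exists_freeOp_resolvent_extension hM hρ hlam hnd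
  rw [← thresholdProj_eq M hρ lam] at hfree
  obtain ⟨r, C, hr, hrr₀, hred⟩ := exists_reduction ι p hpι Vr B hr₀ hB
  refine ⟨p ∘L Vr ∘L ι, ?_, r, C, hr, ?_⟩
  · refine LinearMap.ext fun x => Subtype.ext ?_
    exact congrArg (fun y => P (Vr y)) (hfix x).symm
  -- a point of the open quadrant in which the perturbed resolvent exists for all small `ω`
  obtain ⟨k₁, hk₁, hk₁r, hk₁i⟩ : ∃ k₁ ∈ Metric.ball (0 : ℂ) r, 0 < k₁.re ∧ 0 < k₁.im := by
    refine ⟨((r / 4 : ℝ) : ℂ) * (1 + Complex.I), ?_, ?_, ?_⟩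
    · rw [mem_ball_zero_iff, norm_mul, Complex.norm_real, Real.norm_of_nonneg (by linarith)]
      have : ‖1 + Complex.I‖ ≤ 2 := (norm_add_le _ _).trans (by simp; norm_num)
      nlinarith
    · simpa using hr
    · simpa using hr
  have hseed : ∀ᶠ ω in 𝓝 (0 : ℂ), IsUnit (perturbedOp M V ω - (lam + k₁ ^ 2) • 1) := by
    have hc : Continuous fun ω : ℂ => perturbedOp M V ω - (lam + k₁ ^ 2) • 1 := by
      unfold perturbedOp
      fun_prop
    refine hc.continuousAt.eventually (Units.isOpen.mem_nhds ?_)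
    have := (hfree k₁ (Metric.ball_subset_ball hrr₀ hk₁) hk₁r hk₁i).1
    simpa [perturbedOp] using this
  filter_upwards [hred, hseed] with ω hω hωk hω0
  obtain ⟨X, U, Y, Q, hX, hU, hY, hQ, hk⟩ := hω
  set c : ℂ := -(Complex.I / 2) * ω with hc
  have hc0 : c ≠ 0 := by
    refine mul_ne_zero (neg_ne_zero.mpr ?_) (norm_pos_iff.mp hω0)
    exact div_ne_zero Complex.I_ne_zero two_ne_zero
  set R₁ : ℂ → L2Z G →L[ℂ] L2Z G :=
    fun k => Q k + (Complex.I / 2) • (U ∘L Ring.inverse (k • 1 - c • X) ∘L Y) with hR₁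
  have hmem : ∀ k, lam + k ^ 2 ∈ resolventSet ℂ (perturbedOp M V ω) ↔
      IsUnit (perturbedOp M V ω - (lam + k ^ 2) • 1) := fun k => by
    rw [spectrum.mem_resolventSet_iff, ← IsUnit.neg_iff, neg_sub, Algebra.algebraMap_eq_smul_one]
  -- where the resolvent exists, the reduction formula computes it
  have hformula : ∀ k ∈ Metric.ball (0 : ℂ) r, 0 < k.re → 0 < k.im →
      IsUnit (perturbedOp M V ω - (lam + k ^ 2) • 1) →
      R₁ k = W ∘L Ring.inverse (perturbedOp M V ω - (lam + k ^ 2) • 1) ∘L W := by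
    intro k hkr hre him hunit
    have hk0 : k ≠ 0 := by
      rintro rfl
      simp at hre
    obtain ⟨hfu, hfe⟩ := hfree k (Metric.ball_subset_ball hrr₀ hkr) hre him
    have hpert : perturbedOp M V ω - (lam + k ^ 2) • 1 =
        freeOp M - (lam + k ^ 2) • 1 + ω • (W * Vr * W) := by
      rw [perturbedOp, hVW]
      abel
    rw [hpert] at hunit
    obtain ⟨hu, he⟩ := one_add_sandwich hfu hunit
    rw [hfe] at hu he
    obtain ⟨hk₂, hk₃⟩ := hk k hkr hk0
    have h1 := hk₃ (hk₂ hu)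
    rw [hpert]
    refine hu.mul_left_cancel ?_
    exact h1.trans he.symm
  have hpole : ∀ T : ℂ → L2Z G →L[ℂ] L2Z G, ∀ k ∈ Metric.ball (0 : ℂ) r, T =ᶠ[𝓝[≠] k] R₁ →
      MeromorphicAt T k ∧
      (meromorphicOrderAt T k < 0 ↔ Module.End.HasEigenvalue (c • X).toLinearMap k) ∧
      resMult T k = algMult (c • X).toLinearMap k := fun T k hkr hT =>
    pole_structure hU hY (hQ k hkr) hT
  have hmer₁ : MeromorphicOn R₁ (Metric.ball 0 r) := fun k hkr =>
    (hpole R₁ k hkr (EventuallyEq.refl _ _)).1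
  refine ⟨X, hX, ⟨R₁, hmer₁, fun k hkr hre him hres => hformula k hkr hre him
    ((hmem k).mp hres)⟩, ?_⟩
  intro R hR x hx
  -- the given extension agrees with `R₁` near the point `k₁`, hence on the whole disc
  have hnear : R =ᶠ[𝓝 k₁] R₁ := by
    have hc' : Continuous fun k : ℂ => perturbedOp M V ω - (lam + k ^ 2) • 1 := by fun_prop
    have h1 : ∀ᶠ k in 𝓝 k₁, IsUnit (perturbedOp M V ω - (lam + k ^ 2) • 1) :=
      hc'.continuousAt.eventually (Units.isOpen.mem_nhds hωk)
    filter_upwards [h1, Metric.isOpen_ball.mem_nhds hk₁,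
      (isOpen_lt continuous_const Complex.continuous_re).mem_nhds hk₁r,
      (isOpen_lt continuous_const Complex.continuous_im).mem_nhds hk₁i] with k hku hkr hre him
    rw [hformula k hkr hre him hku]
    exact hR.eq_resolvent k hkr hre him ((hmem k).mpr hku)
  have hconn : IsConnected (Metric.ball (0 : ℂ) r) :=
    (convex_ball 0 r).isConnected ⟨0, Metric.mem_ball_self hr⟩
  obtain ⟨-, h1, h2⟩ := hpole R (c * x) hx
    (eventuallyEq_of_meromorphicOn hR.meromorphic hmer₁ hconn hk₁ hnear hx)
  have h3 := algMult_smul X hc0 x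
  refine ⟨h1.trans ?_, by rw [h2, h3]⟩
  rw [← algMult_pos_iff, ← algMult_pos_iff, h3]

end ThresholdResonances

theorem theorem3p1 {G : Type*} [NormedAddCommGroup G] [InnerProductSpace ℂ G] [CompleteSpace G]
    [FiniteDimensional ℂ G]
    (M : G →L[ℂ] G) (hM : IsDiagonalizable M)
    (V : ℤ → ℤ → G →L[ℂ] G) (ρ : ℝ) (hρ : 0 < ρ)
    (hV : ∃ C : ℝ, 0 < C ∧ ∀ n m : ℤ,
      ‖V n m‖ ≤ C * Real.exp (-ρ * (|(n : ℝ)| + |(m : ℝ)|)))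
    (lam : ℂ) (hlam : Module.End.HasEigenvalue (M : G →ₗ[ℂ] G) lam)
    (hnd : ¬ IsDegenerate M lam) :
    ∃ r ε₀ δ₀ C : ℝ, 0 < r ∧ 0 < ε₀ ∧ 0 < δ₀ ∧ 0 < C ∧ ε₀ * δ₀ ≤ r ∧
      ∀ ω : ℂ, 0 < ‖ω‖ → ‖ω‖ < δ₀ →
        (∃ R, IsResolventExtension M V ρ hρ lam ω r R) ∧
        ∀ R, IsResolventExtension M V ρ hρ lam ω r R →
          -- every resonance in the disk belongs to exactly one cluster
          (∀ k ∈ resonances r R, ‖k‖ < ε₀ * ‖ω‖ →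
            ∃! α : ℂ, Module.End.HasEigenvalue (effOpRan M V ρ lam) α ∧
              k ∈ cluster r R C ω α (effMult M V ρ lam α)) ∧
          -- every cluster lies in the disk, is nonempty and has at most `m` elements,
          -- even when they are counted with their multiplicities
          (∀ α : ℂ, Module.End.HasEigenvalue (effOpRan M V ρ lam) α →
            cluster r R C ω α (effMult M V ρ lam α) ⊆ Metric.ball 0 (ε₀ * ‖ω‖) ∧
            1 ≤ (cluster r R C ω α (effMult M V ρ lam α)).encard ∧
            (cluster r R C ω α (effMult M V ρ lam α)).encard ≤ effMult M V ρ lam α ∧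
            ∑ᶠ k ∈ cluster r R C ω α (effMult M V ρ lam α), resMult R k ≤
              effMult M V ρ lam α) ∧
          -- exact count in the selfadjoint case
          (IsSelfAdjoint M → IsSelfAdjoint (kernelOp V) →
            (∀ α : ℂ, Module.End.HasEigenvalue (effOpRan M V ρ lam) α →
              ∑ᶠ k ∈ cluster r R C ω α (effMult M V ρ lam α), resMult R k =
                effMult M V ρ lam α) ∧
            (resonances r R ∩ Metric.ball 0 (ε₀ * ‖ω‖)).Finite ∧
            ∑ᶠ k ∈ resonances r R ∩ Metric.ball 0 (ε₀ * ‖ω‖), resMult R k =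
              Module.finrank ℂ (Module.End.eigenspace (M : G →ₗ[ℂ] G) lam)) := by
  classical
  have hfin := finiteDimensional_range_thresholdProj M hρ lam
  obtain ⟨E, hE, r, C₁, hr, hev⟩ := exists_effective_operator hM hρ hV hlam hnd
  obtain ⟨C, hC, hclus⟩ := exists_eigenvalue_clusters E C₁
  obtain ⟨δ₁, hδ₁, hev⟩ := Metric.eventually_nhds_iff_ball.mp hev
  obtain ⟨δ₂, hδ₂, hclus⟩ := (mem_nhdsGT_iff_exists_Ioo_subset).mp hclus
  set S := eigenvalueFinset E.toLinearMap with hS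
  have hmemS : ∀ α, α ∈ S ↔ Module.End.HasEigenvalue (effOpRan M V ρ lam) α := fun α => by
    rw [hS, mem_eigenvalueFinset, hE]
  have hmult : ∀ α, effMult M V ρ lam α = algMult E.toLinearMap α := fun α => by
    rw [hE]
    rfl
  -- all eigenvalues of `X` will have modulus less than `2 ε₀`
  set ε₀ : ℝ := (∑ α ∈ S, ‖α‖ + 1) / 2 with hε₀
  have hε₀pos : 0 < ε₀ := by positivity
  set δ₀ := min (min δ₁ δ₂) (r / ε₀) with hδ₀
  refine ⟨r, ε₀, δ₀, C / 2, hr, hε₀pos, lt_min (lt_min hδ₁ hδ₂) (div_pos hr hε₀pos), half_pos hC,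
    ?_, ?_⟩
  · calc ε₀ * δ₀ ≤ ε₀ * (r / ε₀) := mul_le_mul_of_nonneg_left (min_le_right _ _) hε₀pos.le
      _ = r := mul_div_cancel₀ r hε₀pos.ne'
  intro ω hω hωδ
  have hω₁ : ‖ω‖ < δ₁ := hωδ.trans_le ((min_le_left _ _).trans (min_le_left _ _))
  have hω₂ : ‖ω‖ < δ₂ := hωδ.trans_le ((min_le_left _ _).trans (min_le_right _ _))
  have hω₃ : ε₀ * ‖ω‖ < r := by
    rw [mul_comm, ← lt_div_iff₀ hε₀pos]
    exact hωδ.trans_le (min_le_right _ _)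
  obtain ⟨X, hX, hexR, hR⟩ := hev ω (by rwa [mem_ball_zero_iff]) hω
  obtain ⟨hsmall, hcl⟩ := hclus ⟨hω, hω₂⟩
  obtain ⟨huniq, hcount⟩ := hcl X hX
  refine ⟨hexR, fun R hRext => ?_⟩
  have hR := hR R hRext
  set c : ℂ := -(Complex.I / 2) * ω with hc
  have hcn : ‖c‖ = ‖ω‖ / 2 := by
    rw [hc, norm_mul, norm_neg, norm_div, Complex.norm_I, Complex.norm_ofNat]
    ring
  have hc0 : c ≠ 0 := by
    rw [← norm_pos_iff, hcn]
    exact half_pos hω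
  set SX := eigenvalueFinset X.toLinearMap with hSX
  have hXball : ∀ x ∈ SX, c * x ∈ Metric.ball (0 : ℂ) (ε₀ * ‖ω‖) := by
    intro x hx
    obtain ⟨α, ⟨hα, hxα⟩, -⟩ := huniq x hx
    have h1 : ‖x‖ < ∑ α ∈ S, ‖α‖ + 1 := by
      have h2 : ‖α‖ ≤ ∑ α ∈ S, ‖α‖ :=
        Finset.single_le_sum (f := fun α : ℂ => ‖α‖) (fun _ _ => norm_nonneg _) hα
      have h3 : ‖x‖ ≤ ‖x - α‖ + ‖α‖ := by simpa using norm_add_le (x - α) α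
      have h4 := hsmall α hα
      linarith
    rw [mem_ball_zero_iff, norm_mul, hcn, hε₀]
    calc ‖ω‖ / 2 * ‖x‖ < ‖ω‖ / 2 * (∑ α ∈ S, ‖α‖ + 1) := mul_lt_mul_of_pos_left h1 (half_pos hω)
      _ = _ := by ring
  have hres : resonances r R = (fun x => c * x) '' (SX : Set ℂ) := by
    ext k
    constructor
    · rintro ⟨hkr, hneg⟩
      have hk : k = c * (k / c) := (mul_div_cancel₀ k hc0).symm
      rw [hk] at hkr hneg
      exact ⟨k / c, mem_eigenvalueFinset.mpr ((hR _ hkr).1.mp hneg), hk.symm⟩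
    · rintro ⟨x, hx, rfl⟩
      have hxr := Metric.ball_subset_ball hω₃.le (hXball x hx)
      exact ⟨hxr, (hR x hxr).1.mpr (mem_eigenvalueFinset.mp hx)⟩
  have hresball : resonances r R ∩ Metric.ball 0 (ε₀ * ‖ω‖) = (fun x => c * x) '' (SX : Set ℂ) := by
    rw [hres, Set.inter_eq_left]
    rintro _ ⟨x, hx, rfl⟩
    exact hXball x hx
  have hmulX : ∀ x ∈ SX, resMult R (c * x) = algMult X.toLinearMap x := fun x hx =>
    (hR x (Metric.ball_subset_ball hω₃.le (hXball x hx))).2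
  have hcluster : ∀ α, cluster r R (C / 2) ω α (effMult M V ρ lam α) = (fun x => c * x) ''
      (({x ∈ SX | ‖x - α‖ ≤ C * ‖ω‖ ^ (1 / (algMult E.toLinearMap α : ℝ))} : Finset ℂ) :
        Set ℂ) := fun α => by
    rw [hmult]
    exact cluster_eq_image hω hres α _
  have hsum : ∀ α ∈ S, ∑ᶠ k ∈ cluster r R (C / 2) ω α (effMult M V ρ lam α), resMult R k =
      effMult M V ρ lam α := by
    intro α hα
    rw [hcluster, finsum_resMult_image (X := X) hω _ fun x hx =>
      hmulX x (Finset.mem_filter.mp hx).1, hmult]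
    exact congrArg Nat.cast (hcount α hα)
  refine ⟨?_, ?_, ?_⟩
  · intro k hk _
    rw [hres] at hk
    obtain ⟨x, hx, rfl⟩ := hk
    have hiff : ∀ α, c * x ∈ cluster r R (C / 2) ω α (effMult M V ρ lam α) ↔
        ‖x - α‖ ≤ C * ‖ω‖ ^ (1 / (algMult E.toLinearMap α : ℝ)) := fun α => by
      rw [hcluster, (injective_const_mul hω).mem_set_image, Finset.mem_coe, Finset.mem_filter]
      exact and_iff_right hx
    simpa only [hiff, hmemS] using huniq x hx
  · intro α hα
    have hαS := (hmemS α).mpr hα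
    have hpos : 0 < algMult E.toLinearMap α := algMult_pos_iff.mpr (mem_eigenvalueFinset.mp hαS)
    set T : Finset ℂ := {x ∈ SX | ‖x - α‖ ≤ C * ‖ω‖ ^ (1 / (algMult E.toLinearMap α : ℝ))} with hT
    have hcard : (cluster r R (C / 2) ω α (effMult M V ρ lam α)).encard = T.card := by
      rw [hcluster, (injective_const_mul hω).encard_image, Set.encard_coe_eq_coe_finsetCard]
    refine ⟨?_, ?_, ?_, (hsum α hαS).le⟩
    · rw [hcluster]
      rintro _ ⟨x, hx, rfl⟩
      exact hXball x (Finset.mem_filter.mp (Finset.mem_coe.mp hx)).1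
    · rw [hcard]
      have hne : T.Nonempty := by
        rw [Finset.nonempty_iff_ne_empty]
        intro h0
        have := hcount α hαS
        rw [← hT, h0, Finset.sum_empty] at this
        omega
      exact_mod_cast hne.card_pos
    · rw [hcard, hmult]
      have : T.card ≤ algMult E.toLinearMap α := by
        rw [← show ∑ x ∈ T, algMult X.toLinearMap x = _ from hcount α hαS, Finset.card_eq_sum_ones]
        exact Finset.sum_le_sum fun x hx =>
          algMult_pos_iff.mpr (mem_eigenvalueFinset.mp (Finset.mem_filter.mp hx).1)
      exact_mod_cast this
  · intro _ _
    refine ⟨fun α hα => hsum α ((hmemS α).mpr hα), ?_, ?_⟩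
    · rw [hresball]
      exact SX.finite_toSet.image _
    · rw [hresball, finsum_resMult_image (X := X) hω SX hmulX, sum_algMult,
        finrank_range_thresholdProj hM hρ]
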